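/- \textbf{Setting.} Let $\mathfrak{H}$ be a $2$-category, and let $\mathrm{t}:\mathfrak{A}\to\dot{\mathfrak{A}}$ be an $\mathsf{a}$-inclusion: a fully faithful $2$-functor (an isomorphism on hom-categories) between small $2$-categories which is injective on objects and such that $\mathsf{a}$ is the only object of $\dot{\mathfrak{A}}$ outside its image. For a $2$-category $\mathfrak{X}$, $[\mathfrak{X},\mathfrak{H}]_{PS}$ denotes the $2$-category of pseudofunctors, pseudonatural transformations and modifications. A \emph{right pseudo-Kan extension} of $\mathcal{X}:\mathfrak{A}\to\mathfrak{H}$ along $\mathrm{t}$ is a pseudofunctor $\mathcal{R}:\dot{\mathfrak{A}}\to\mathfrak{H}$ with a pseudonatural transformation $\varepsilon:\mathcal{R}\circ\mathrm{t}\to\mathcal{X}$ such that, for every pseudofunctor $\mathcal{S}:\dot{\mathfrak{A}}\to\mathfrak{H}$, the functor $$[\dot{\mathfrak{A}},\mathfrak{H}]_{PS}(\mathcal{S},\mathcal{R})\to[\mathfrak{A},\mathfrak{H}]_{PS}(\mathcal{S}\circ\mathrm{t},\mathcal{X}),\qquad \sigma\mapsto\varepsilon\cdot(\sigma\mathrm{t})$$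 is an equivalence. It is \emph{pointwise} if it is preserved by every representable $\mathfrak{H}(W,-)$. For a pseudofunctor $\mathcal{F}:\dot{\mathfrak{A}}\to\mathfrak{H}$, let $(\mathcal{R},\varepsilon)$ be a right pseudo-Kan extension of $\mathcal{F}\circ\mathrm{t}$ along $\mathrm{t}$, and let $\eta_{\mathcal{F}}:\mathcal{F}\to\mathcal{R}$ be the comparison, i.e. the pseudonatural transformation, unique up to invertible modification, with $\varepsilon\cdot(\eta_{\mathcal{F}}\mathrm{t})\cong\mathrm{id}_{\mathcal{F}\circ\mathrm{t}}$. Then $\mathcal{F}$ is of \emph{almost $\mathrm{t}$-descent} / \emph{$\mathrm{t}$-descent} if the component $\eta_{\mathcal{F}}^{\mathsf{a}}$ is faithful / fully faithful, and of \emph{effective $\mathrm{t}$-descent} if $\eta_{\mathcal{F}}$ is a pseudonatural equivalence. Here a $1$-cell $f$ of $\mathfrak{H}$ is faithful / fully faithful if the functor $\mathfrak{H}(W,f)$ is so for every object $W$. A $1$-cell $r:e\to b$ of $\mathfrak{H}$ is \emph{almost monadic} / \emph{premonadic} / \emph{monadic} if it has a left adjoint $l$, the monad $rl$ on $b$ has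 an Eilenberg--Moore object (an object $E$ with a universal $rl$-algebra, inducing for every object $X$ an equivalence between $\mathfrak{H}(X,E)$ and the category of $rl$-algebras with domain $X$), and the Eilenberg--Moore comparison $e\to E$ is faithful / fully faithful / an equivalence. A pseudonatural transformation $\alpha:\mathcal{A}\to\mathcal{B}$ between pseudofunctors $\dot{\mathfrak{A}}\to\mathfrak{H}$ satisfies the \emph{Beck--Chevalley condition} if every component $\alpha_w$ has a left adjoint $\widehat{\alpha}^w$ and, for each $1$-cell $f:w\to c$ of $\dot{\mathfrak{A}}$, the mate $\widehat{\alpha}^{c}\mathcal{B}(f)\Rightarrow\mathcal{A}(f)\widehat{\alpha}^{w}$ of the invertible $2$-cell $\alpha_f:\mathcal{B}(f)\alpha_w\Rightarrow\alpha_c\mathcal{A}(f)$ is invertible. \textbf{Theorem (generalized B\'enabou--Roubaud theorem).} Let $\mathcal{A},\mathcal{B}:\dot{\mathfrak{A}}\to\mathfrak{H}$ be pseudofunctors such that $\mathcal{A}\circ\mathrm{t}$ and $\mathcal{B}\circ\mathrm{t}$ have pointwise right pseudo-Kan extensions along $\mathrm{t}$. Let $\alpha:\mathcal{A}\to\mathcal{B}$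 be a pseudonatural transformation satisfying the Beck--Chevalley condition, such that $\alpha_{\mathrm{t}(x)}$ is monadic for every object $x$ of $\mathfrak{A}$, and such that the monad induced by $\alpha_{\mathsf{a}}$ and its left adjoint has an Eilenberg--Moore object. Then: \begin{itemize} \item if $\mathcal{B}$ is of almost $\mathrm{t}$-descent, then $\alpha_{\mathsf{a}}$ is almost monadic if and only if $\mathcal{A}$ is of almost $\mathrm{t}$-descent; \item if $\mathcal{B}$ is of $\mathrm{t}$-descent, then $\alpha_{\mathsf{a}}$ is premonadic if and only if $\mathcal{A}$ is of $\mathrm{t}$-descent; \item if $\mathcal{B}$ is of effective $\mathrm{t}$-descent, then $\alpha_{\mathsf{a}}$ is monadic if and only if $\mathcal{A}$ is of effective $\mathrm{t}$-descent. \end{itemize} -/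

import Mathlib

open CategoryTheory Bicategory
open scoped CategoryTheory.Pseudofunctor.StrongTrans

universe w v u w₁ v₁ u₁ w₂ v₂ u₂ w₃ v₃ u₃ w₄ v₄ u₄

namespace PseudoDescent

/-! ### Classes of 1-cells in a bicategory -/

section Cells

variable {H : Type u} [Bicategory.{w, v} H]

/-- A 1-cell is faithful if its images by the covariant representables are faithful functors. -/
def FaithfulCell {x y : H} (f : x ⟶ y) : Prop :=
  ∀ W : H, (postcomp W f).Faithful

/-- A 1-cell is fully faithful if its images by the covariant representables are
fully faithful functors. -/
def FullyFaithfulCell {x y : H} (f : x ⟶ y) : Prop :=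
  ∀ W : H, (postcomp W f).Full ∧ (postcomp W f).Faithful

/-- A 1-cell is an equivalence if it underlies an (adjoint) equivalence. -/
def EquivalenceCell {x y : H} (f : x ⟶ y) : Prop :=
  ∃ e : x ≌ y, e.hom = f

end Cells

/-! ### Monads, Eilenberg-Moore objects and monadicity in a bicategory -/

section Monads

variable {H : Type u} [Bicategory.{w, v} H]

/-- A monad in a bicategory on the object `b`. -/
structure Mnd (b : H) where
  T : b ⟶ b
  unit : 𝟙 b ⟶ T
  mul : T ≫ T ⟶ T
  unit_left : unit ▷ T ≫ mul = (λ_ T).hom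
  unit_right : T ◁ unit ≫ mul = (ρ_ T).hom
  mul_assoc : mul ▷ T ≫ mul = (α_ T T T).hom ≫ T ◁ mul ≫ mul

/-- An algebra of the monad `T` with domain `X`: a 1-cell `X ⟶ b` with an action of `T`. -/
structure Alg {b : H} (T : Mnd b) (X : H) where
  carrier : X ⟶ b
  act : carrier ≫ T.T ⟶ carrier
  act_unit : carrier ◁ T.unit ≫ act = (ρ_ carrier).hom
  act_mul : carrier ◁ T.mul ≫ act = (α_ carrier T.T T.T).inv ≫ act ▷ T.T ≫ act

namespace Alg

variable {b : H} {T : Mnd b} {X Y : H}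

/-- A morphism of algebras is a 2-cell that commutes with the actions. -/
@[ext]
structure Hom (M N : Alg T X) where
  cell : M.carrier ⟶ N.carrier
  comm : M.act ≫ cell = cell ▷ T.T ≫ N.act

instance : Category (Alg T X) where
  Hom M N := Hom M N
  id M := { cell := 𝟙 M.carrier, comm := by simp }
  comp f g :=
    { cell := f.cell ≫ g.cell
      comm := by
        rw [← Category.assoc, f.comm, Category.assoc, g.comm, comp_whiskerRight, Category.assoc] }
  id_comp f := Hom.ext (Category.id_comp _)
  comp_id f := Hom.ext (Category.comp_id _)
  assoc f g h := Hom.ext (Category.assoc _ _ _)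

/-- Restriction of an algebra with domain `Y` along a 1-cell `f : X ⟶ Y`. -/
def restrict (M : Alg T Y) (f : X ⟶ Y) : Alg T X where
  carrier := f ≫ M.carrier
  act := (α_ f M.carrier T.T).hom ≫ f ◁ M.act
  act_unit := by
    have h := congrArg (fun z => f ◁ z) M.act_unit
    simp only [Bicategory.whiskerLeft_comp] at h
    simp [h]
  act_mul := by
    have h := congrArg (fun z => f ◁ z) M.act_mul
    simp only [Bicategory.whiskerLeft_comp] at h
    simp [h]

/-- The functor `H(X, Y) ⥤ Alg T X` that restricts a given algebra with domain `Y`. -/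
def restrictFunctor (M : Alg T Y) (X : H) : (X ⟶ Y) ⥤ Alg T X where
  obj f := M.restrict f
  map {f g} θ :=
    { cell := θ ▷ M.carrier
      comm := by
        dsimp [restrict]
        rw [Category.assoc, whisker_exchange, associator_naturality_left_assoc] }
  map_id f := Hom.ext (by simp only [id_whiskerRight]; rfl)
  map_comp f g := Hom.ext (by simp only [comp_whiskerRight]; rfl)

end Alg

/-- An Eilenberg-Moore object of the monad `T` (in the bicategorical sense): an object with a
universal algebra, so that 1-cells into it are, up to equivalence, the algebras of `T`. -/
structure EMObject {b : H} (T : Mnd b) where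
  obj : H
  univ : Alg T obj
  isEquivalence (X : H) : (univ.restrictFunctor X).IsEquivalence

/-- The monad induced by an adjunction. -/
def adjMnd {b e : H} {l : b ⟶ e} {r : e ⟶ b} (adj : l ⊣ r) : Mnd b where
  T := l ≫ r
  unit := adj.unit
  mul := (α_ l r (l ≫ r)).hom ≫ l ◁ ((α_ r l r).inv ≫ adj.counit ▷ r ≫ (λ_ r).hom)
  unit_left := by
    calc
      _ = 𝟙 _ ⊗≫ leftZigzag adj.unit adj.counit ▷ r ⊗≫ 𝟙 _ := by bicategory
      _ = _ := by rw [adj.left_triangle]; bicategory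
  unit_right := by
    calc
      _ = 𝟙 _ ⊗≫ l ◁ rightZigzag adj.unit adj.counit ⊗≫ 𝟙 _ := by bicategory
      _ = _ := by rw [adj.right_triangle]; bicategory
  mul_assoc := by
    calc
      _ = 𝟙 _ ⊗≫ l ◁ (adj.counit ▷ (r ≫ l) ≫ 𝟙 e ◁ adj.counit) ▷ r ⊗≫ 𝟙 _ := by bicategory
      _ = 𝟙 _ ⊗≫ l ◁ ((r ≫ l) ◁ adj.counit ≫ adj.counit ▷ 𝟙 e) ▷ r ⊗≫ 𝟙 _ := by
        rw [← whisker_exchange]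
      _ = _ := by bicategory

/-- The canonical algebra structure on the right adjoint, with action given by the counit. -/
def adjAlg {b e : H} {l : b ⟶ e} {r : e ⟶ b} (adj : l ⊣ r) : Alg (adjMnd adj) e where
  carrier := r
  act := (α_ r l r).inv ≫ adj.counit ▷ r ≫ (λ_ r).hom
  act_unit := by
    dsimp [adjMnd]
    calc
      _ = rightZigzag adj.unit adj.counit ⊗≫ 𝟙 _ := by bicategory
      _ = _ := by rw [adj.right_triangle]; bicategory
  act_mul := by
    dsimp [adjMnd]
    calc
      _ = 𝟙 _ ⊗≫ ((r ≫ l) ◁ adj.counit ≫ adj.counit ▷ 𝟙 e) ▷ r ⊗≫ 𝟙 _ := by bicategory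
      _ = 𝟙 _ ⊗≫ (adj.counit ▷ (r ≫ l) ≫ 𝟙 e ◁ adj.counit) ▷ r ⊗≫ 𝟙 _ := by
        rw [← whisker_exchange]
      _ = _ := by bicategory

/-- `c` is an Eilenberg-Moore comparison 1-cell of the adjunction: it classifies
the canonical algebra (hence it is unique up to an invertible 2-cell). -/
def IsEMComparison {b e : H} {l : b ⟶ e} {r : e ⟶ b} (adj : l ⊣ r)
    (E : EMObject (adjMnd adj)) (c : e ⟶ E.obj) : Prop :=
  Nonempty ((E.univ.restrictFunctor e).obj c ≅ adjAlg adj)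

/-- A right adjoint 1-cell with faithful Eilenberg-Moore comparison. -/
def AlmostMonadic {b e : H} (r : e ⟶ b) : Prop :=
  ∃ (l : b ⟶ e) (adj : l ⊣ r) (E : EMObject (adjMnd adj)) (c : e ⟶ E.obj),
    IsEMComparison adj E c ∧ FaithfulCell c

/-- A right adjoint 1-cell with fully faithful Eilenberg-Moore comparison. -/
def Premonadic {b e : H} (r : e ⟶ b) : Prop :=
  ∃ (l : b ⟶ e) (adj : l ⊣ r) (E : EMObject (adjMnd adj)) (c : e ⟶ E.obj),
    IsEMComparison adj E c ∧ FullyFaithfulCell c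

/-- A right adjoint 1-cell whose Eilenberg-Moore comparison is an equivalence. -/
def Monadic {b e : H} (r : e ⟶ b) : Prop :=
  ∃ (l : b ⟶ e) (adj : l ⊣ r) (E : EMObject (adjMnd adj)) (c : e ⟶ E.obj),
    IsEMComparison adj E c ∧ EquivalenceCell c

end Monads

/-! ### Whiskering of pseudonatural transformations -/

section Whiskering

variable {J : Type u₁} [Bicategory.{w₁, v₁} J] {K : Type u₂} [Bicategory.{w₂, v₂} K]
  {H : Type u₃} [Bicategory.{w₃, v₃} H] {L : Type u₄} [Bicategory.{w₄, v₄} L]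

/-- The whiskering `σ ∗ t : S ∘ t ⟶ R ∘ t` of a pseudonatural transformation. -/
def whiskerPre (t : J ⥤ᵖ K) {S R : K ⥤ᵖ H} (σ : S ⟶ R) : t.comp S ⟶ t.comp R :=
  Pseudofunctor.StrongTrans.mk
    (fun x => σ.app (t.obj x))
    (fun f => σ.naturality (t.map f))
    (fun η => σ.naturality_naturality (t.map₂ η))
    (fun x => by
      change (σ.naturality (t.map (𝟙 x))).hom ≫
          σ.app (t.obj x) ◁ (R.map₂ (t.mapId x).hom ≫ (R.mapId (t.obj x)).hom) =
        (S.map₂ (t.mapId x).hom ≫ (S.mapId (t.obj x)).hom) ▷ σ.app (t.obj x) ≫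
          (λ_ (σ.app (t.obj x))).hom ≫ (ρ_ (σ.app (t.obj x))).inv
      rw [Bicategory.whiskerLeft_comp,
        ← Pseudofunctor.StrongTrans.naturality_naturality_assoc,
        Pseudofunctor.StrongTrans.naturality_id, comp_whiskerRight, Category.assoc])
    (fun {x y z} f g => by
      change (σ.naturality (t.map (f ≫ g))).hom ≫
          σ.app (t.obj x) ◁ (R.map₂ (t.mapComp f g).hom ≫ (R.mapComp (t.map f) (t.map g)).hom) =
        (S.map₂ (t.mapComp f g).hom ≫ (S.mapComp (t.map f) (t.map g)).hom) ▷ σ.app (t.obj z) ≫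
          (α_ _ _ _).hom ≫ S.map (t.map f) ◁ (σ.naturality (t.map g)).hom ≫
            (α_ _ _ _).inv ≫ (σ.naturality (t.map f)).hom ▷ R.map (t.map g) ≫ (α_ _ _ _).hom
      rw [Bicategory.whiskerLeft_comp,
        ← Pseudofunctor.StrongTrans.naturality_naturality_assoc,
        Pseudofunctor.StrongTrans.naturality_comp, comp_whiskerRight, Category.assoc])

/-- The functor `[K, H](S, R) ⥤ [J, H](S ∘ t, R ∘ t)` given by whiskering with `t`. -/
def whiskerPreFunctor (t : J ⥤ᵖ K) (S R : K ⥤ᵖ H) : (S ⟶ R) ⥤ (t.comp S ⟶ t.comp R) where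
  obj σ := whiskerPre t σ
  map Γ := ⟨{ app := fun x => Γ.as.app (t.obj x)
              naturality := fun f => Γ.as.naturality (t.map f) }⟩

/-- The image under `U` of an invertible square. -/
def mapSquare (U : H ⥤ᵖ L) {a b c d : H} {f : a ⟶ b} {k : b ⟶ d} {m : a ⟶ c} {p : c ⟶ d}
    (ν : f ≫ k ≅ m ≫ p) : U.map f ≫ U.map k ≅ U.map m ≫ U.map p :=
  (U.mapComp f k).symm ≪≫ U.map₂Iso ν ≪≫ U.mapComp m p

theorem mapSquare_naturality (U : H ⥤ᵖ L) {a b c d : H} {f g : a ⟶ b} {k : b ⟶ d} {m : a ⟶ c}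
    {p q : c ⟶ d} (ν : f ≫ k ≅ m ≫ p) (ν' : g ≫ k ≅ m ≫ q) (θ : f ⟶ g) (φ : p ⟶ q)
    (h : θ ▷ k ≫ ν'.hom = ν.hom ≫ m ◁ φ) :
    U.map₂ θ ▷ U.map k ≫ (mapSquare U ν').hom =
      (mapSquare U ν).hom ≫ U.map m ◁ U.map₂ φ := by
  have h' := congrArg U.map₂ h
  rw [U.map₂_comp, U.map₂_comp, U.map₂_whisker_left, U.map₂_whisker_right] at h'
  rw [← cancel_epi (U.mapComp f k).hom, ← cancel_mono (U.mapComp m q).inv]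
  simpa [mapSquare] using h'

theorem map_whiskerLeft (U : H ⥤ᵖ L) {a b c : H} (f : a ⟶ b) {g h : b ⟶ c} (θ : g ⟶ h) :
    U.map f ◁ U.map₂ θ = (U.mapComp f g).inv ≫ U.map₂ (f ◁ θ) ≫ (U.mapComp f h).hom := by
  simp

theorem map_whiskerRight (U : H ⥤ᵖ L) {a b c : H} {f g : a ⟶ b} (θ : f ⟶ g) (h : b ⟶ c) :
    U.map₂ θ ▷ U.map h = (U.mapComp f h).inv ≫ U.map₂ (θ ▷ h) ≫ (U.mapComp g h).hom := by
  simp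

theorem mapSquare_id (U : H ⥤ᵖ L) {a d : H} {f f' : a ⟶ a} {k : a ⟶ d} {p : d ⟶ d}
    (ν : f ≫ k ≅ k ≫ p) (i : f ⟶ f') (i' : f' ⟶ 𝟙 a) (j : p ⟶ 𝟙 d)
    (h : ν.hom ≫ k ◁ j = (i ≫ i') ▷ k ≫ (λ_ k).hom ≫ (ρ_ k).inv) :
    (mapSquare U ν).hom ≫ U.map k ◁ (U.map₂ j ≫ (U.mapId d).hom) =
      (U.map₂ i ≫ U.map₂ i' ≫ (U.mapId a).hom) ▷ U.map k ≫
        (λ_ (U.map k)).hom ≫ (ρ_ (U.map k)).inv := by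
  have e : U.map₂ (ρ_ k).inv ≫ (U.mapComp k (𝟙 d)).hom ≫ U.map k ◁ (U.mapId d).hom =
      (ρ_ (U.map k)).inv := by
    rw [← cancel_mono (ρ_ (U.map k)).hom, ← cancel_epi (U.map₂ (ρ_ k).hom)]
    simp only [Category.assoc, ← U.map₂_right_unitor, Iso.inv_hom_id, Category.comp_id]
    rw [← U.map₂_comp, Iso.inv_hom_id, U.map₂_id, Category.comp_id]
  have e' : (U.mapComp (𝟙 a) k).hom ≫ (U.mapId a).hom ▷ U.map k ≫ (λ_ (U.map k)).hom =
      U.map₂ (λ_ k).hom := (U.map₂_left_unitor k).symm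
  have h' := congrArg U.map₂ h
  rw [U.map₂_comp, U.map₂_comp, U.map₂_comp, comp_whiskerRight, U.map₂_comp] at h'
  simp only [mapSquare, Iso.trans_hom, Iso.symm_hom, PrelaxFunctor.map₂Iso_hom,
    Bicategory.whiskerLeft_comp, comp_whiskerRight, Category.assoc, map_whiskerLeft,
    map_whiskerRight, Iso.hom_inv_id_assoc]
  rw [reassoc_of% h', e, reassoc_of% e']

theorem mapSquare_comp (U : H ⥤ᵖ L) {a b c a' b' c' : H} {f : a ⟶ b} {g : b ⟶ c} {f' : a' ⟶ b'}
    {g' : b' ⟶ c'} {h h₁ : a ⟶ c} {h' : a' ⟶ c'} {k : a ⟶ a'} {l : b ⟶ b'} {m : c ⟶ c'}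
    (ν : f ≫ l ≅ k ≫ f') (ν' : g ≫ m ≅ l ≫ g') (ν'' : h ≫ m ≅ k ≫ h')
    (i : h ⟶ h₁) (i' : h₁ ⟶ f ≫ g) (j : h' ⟶ f' ≫ g')
    (e : ν''.hom ≫ k ◁ j = (i ≫ i') ▷ m ≫ (α_ _ _ _).hom ≫ f ◁ ν'.hom ≫ (α_ _ _ _).inv ≫
      ν.hom ▷ g' ≫ (α_ _ _ _).hom) :
    (mapSquare U ν'').hom ≫ U.map k ◁ (U.map₂ j ≫ (U.mapComp f' g').hom) =
      (U.map₂ i ≫ U.map₂ i' ≫ (U.mapComp f g).hom) ▷ U.map m ≫ (α_ _ _ _).hom ≫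
        U.map f ◁ (mapSquare U ν').hom ≫ (α_ _ _ _).inv ≫ (mapSquare U ν).hom ▷ U.map g' ≫
          (α_ _ _ _).hom := by
  have e' := congrArg U.map₂ e
  rw [U.map₂_comp, U.map₂_comp, U.map₂_comp, U.map₂_comp, U.map₂_comp, U.map₂_comp,
    comp_whiskerRight, U.map₂_comp] at e'
  have e₁ : (U.mapComp (f ≫ g) m).hom ≫ (U.mapComp f g).hom ▷ U.map m ≫ (α_ _ _ _).hom =
      U.map₂ (α_ f g m).hom ≫ (U.mapComp f (g ≫ m)).hom ≫ U.map f ◁ (U.mapComp g m).hom := by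
    simp
  have e₂ : U.map f ◁ (U.mapComp l g').hom ≫ (α_ _ _ _).inv ≫ (U.mapComp f l).inv ▷ U.map g' =
      (U.mapComp f (l ≫ g')).inv ≫ U.map₂ (α_ f l g').inv ≫ (U.mapComp (f ≫ l) g').hom := by
    rw [← cancel_epi (U.mapComp f (l ≫ g')).hom, Pseudofunctor.mapComp_assoc_right_hom_assoc]
    simp
  have e₃ : (U.mapComp (k ≫ f') g').hom ≫ (U.mapComp k f').hom ▷ U.map g' ≫ (α_ _ _ _).hom =
      U.map₂ (α_ k f' g').hom ≫ (U.mapComp k (f' ≫ g')).hom ≫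
        U.map k ◁ (U.mapComp f' g').hom := by
    simp
  simp only [mapSquare, Iso.trans_hom, Iso.symm_hom, PrelaxFunctor.map₂Iso_hom,
    Bicategory.whiskerLeft_comp, comp_whiskerRight, Category.assoc, map_whiskerLeft,
    map_whiskerRight, Iso.hom_inv_id_assoc]
  rw [reassoc_of% e', reassoc_of% e₁]
  simp only [whiskerLeft_hom_inv_assoc]
  rw [reassoc_of% e₂, e₃]
  simp only [Iso.hom_inv_id_assoc]

/-- The image `U κ : (U ∘ R) ∘ t ⟶ U ∘ X` of a pseudonatural transformation `κ : R ∘ t ⟶ X` under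
a pseudofunctor `U`. -/
def whiskerPost {t : J ⥤ᵖ K} {R : K ⥤ᵖ H} {X : J ⥤ᵖ H} (κ : t.comp R ⟶ X) (U : H ⥤ᵖ L) :
    t.comp (R.comp U) ⟶ X.comp U :=
  Pseudofunctor.StrongTrans.mk
    (fun x => U.map (κ.app x))
    (fun {_ _} f => mapSquare U (f := R.map (t.map f)) (κ.naturality f))
    (fun {_ _ f g} η => mapSquare_naturality U (κ.naturality f) (κ.naturality g)
      (R.map₂ (t.map₂ η)) (X.map₂ η) (κ.naturality_naturality η))
    (fun x => mapSquare_id U (κ.naturality (𝟙 x)) (R.map₂ (t.mapId x).hom)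
      (R.mapId (t.obj x)).hom (X.mapId x).hom (κ.naturality_id x))
    (fun f g => mapSquare_comp U (κ.naturality f) (κ.naturality g) (κ.naturality (f ≫ g))
      (R.map₂ (t.mapComp f g).hom) (R.mapComp (t.map f) (t.map g)).hom (X.mapComp f g).hom
      (κ.naturality_comp f g))

/-- The covariant representable pseudofunctor `H(W, -)`. -/
def corepresentable (W : H) : H ⥤ᵖ Cat.{w₃, v₃} where
  toPrelaxFunctor := PrelaxFunctor.mkOfHomFunctors (fun X => Cat.of (W ⟶ X))
    (fun X Y => postcomposingCat W X Y)
  mapId X := rightUnitorNatIsoCat W X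
  mapComp f g := (associatorNatIsoLeftCat W f g).symm
  map₂_whisker_left {a b c} f g h η := by
    refine Cat.Hom₂.ext (NatTrans.ext (funext fun z => ?_))
    change (W ⟶ a) at z
    change z ◁ f ◁ η = (α_ z f g).inv ≫ (z ≫ f) ◁ η ≫ (α_ z f h).hom
    simp
  map₂_whisker_right {a b c} f g η h := by
    refine Cat.Hom₂.ext (NatTrans.ext (funext fun z => ?_))
    change (W ⟶ a) at z
    change z ◁ η ▷ h = (α_ z f h).inv ≫ (z ◁ η) ▷ h ≫ (α_ z g h).hom
    simp
  map₂_associator {a b c d} f g h := by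
    refine Cat.Hom₂.ext (NatTrans.ext (funext fun z => ?_))
    change (W ⟶ a) at z
    change z ◁ (α_ f g h).hom = (α_ z (f ≫ g) h).inv ≫ (α_ z f g).inv ▷ h ≫ 𝟙 _ ≫
      (α_ (z ≫ f) g h).hom ≫ (α_ z f (g ≫ h)).hom
    simp
  map₂_left_unitor {a b} f := by
    refine Cat.Hom₂.ext (NatTrans.ext (funext fun z => ?_))
    change (W ⟶ a) at z
    change z ◁ (λ_ f).hom = (α_ z (𝟙 a) f).inv ≫ (ρ_ z).hom ▷ f ≫ 𝟙 _
    simp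
  map₂_right_unitor {a b} f := by
    refine Cat.Hom₂.ext (NatTrans.ext (funext fun z => ?_))
    change (W ⟶ a) at z
    change z ◁ (ρ_ f).hom = (α_ z f (𝟙 b)).inv ≫ (ρ_ (z ≫ f)).hom ≫ 𝟙 _
    simp

end Whiskering

/-! ### Pseudo-Kan extensions -/

section PseudoKan

variable {J : Type u₁} [Bicategory.{w₁, v₁} J] {K : Type u₂} [Bicategory.{w₂, v₂} K]
  {H : Type u₃} [Bicategory.{w₃, v₃} H]

/-- The functor `[K, H](S, R) ⥤ [J, H](S ∘ t, X)`, `σ ↦ κ · (σ ∗ t)`, induced by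
`κ : R ∘ t ⟶ X`. -/
def ranFunctor (t : J ⥤ᵖ K) {X : J ⥤ᵖ H} {R : K ⥤ᵖ H} (κ : t.comp R ⟶ X) (S : K ⥤ᵖ H) :
    (S ⟶ R) ⥤ (t.comp S ⟶ X) :=
  whiskerPreFunctor t S R ⋙ postcomp (t.comp S) κ

/-- `R` with universal arrow `κ : R ∘ t ⟶ X` is a right pseudo-Kan extension of `X` along `t`,
that is, a right bicategorical reflection of `X` along `[t, H] : [K, H] ⥤ᵖ [J, H]`. -/
def IsPseudoRan (t : J ⥤ᵖ K) {X : J ⥤ᵖ H} (R : K ⥤ᵖ H) (κ : t.comp R ⟶ X) : Prop :=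
  ∀ S : K ⥤ᵖ H, (ranFunctor t κ S).IsEquivalence

/-- A pointwise right pseudo-Kan extension: one that is preserved by all the covariant
representable pseudofunctors. -/
def IsPointwisePseudoRan (t : J ⥤ᵖ K) {X : J ⥤ᵖ H} (R : K ⥤ᵖ H) (κ : t.comp R ⟶ X) : Prop :=
  IsPseudoRan t R κ ∧
    ∀ W : H, IsPseudoRan t (R.comp (corepresentable W)) (whiskerPost κ (corepresentable W))

/-- The pseudofunctor `X` has a pointwise right pseudo-Kan extension along `t`. -/
def HasPointwisePseudoRan (t : J ⥤ᵖ K) (X : J ⥤ᵖ H) : Prop :=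
  ∃ (R : K ⥤ᵖ H) (κ : t.comp R ⟶ X), IsPointwisePseudoRan t R κ

/-- `η : F ⟶ R` is a comparison (a component at `F` of the unit of the biadjunction between
`[t, H]` and the pseudo-Kan extension): it corresponds to the identity of `F ∘ t`. When
`(R, κ)` is a pseudo-Kan extension of `F ∘ t`, it is unique up to an invertible modification. -/
def IsComparison (t : J ⥤ᵖ K) {F R : K ⥤ᵖ H} (κ : t.comp R ⟶ t.comp F) (η : F ⟶ R) : Prop :=
  Nonempty ((ranFunctor t κ F).obj η ≅ 𝟙 (t.comp F))

/-- `F` is of almost `t`-descent (`t` an `a`-inclusion): the component at `a` of the comparison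
is faithful. -/
def AlmostDescent (t : J ⥤ᵖ K) (a : K) (F : K ⥤ᵖ H) : Prop :=
  ∃ (R : K ⥤ᵖ H) (κ : t.comp R ⟶ t.comp F) (η : F ⟶ R),
    IsPseudoRan t R κ ∧ IsComparison t κ η ∧ FaithfulCell (η.app a)

/-- `F` is of `t`-descent (`t` an `a`-inclusion): the component at `a` of the comparison
is fully faithful. -/
def Descent (t : J ⥤ᵖ K) (a : K) (F : K ⥤ᵖ H) : Prop :=
  ∃ (R : K ⥤ᵖ H) (κ : t.comp R ⟶ t.comp F) (η : F ⟶ R),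
    IsPseudoRan t R κ ∧ IsComparison t κ η ∧ FullyFaithfulCell (η.app a)

/-- `F` is of effective `t`-descent, that is, it is a pseudoalgebra of the idempotent pseudomonad
`F ↦ PsRan_t (F ∘ t)`: the comparison is an equivalence in `[K, H]`. -/
def EffectiveDescent (t : J ⥤ᵖ K) (F : K ⥤ᵖ H) : Prop :=
  ∃ (R : K ⥤ᵖ H) (κ : t.comp R ⟶ t.comp F) (η : F ⟶ R),
    IsPseudoRan t R κ ∧ IsComparison t κ η ∧ EquivalenceCell η

/-- An `a`-inclusion: a fully faithful 2-functor (an isomorphism on each hom-category), injective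
on objects, whose codomain has `a` as the only object outside the image. -/
structure IsInclusion (t : StrictPseudofunctor J K) (a : K) : Prop where
  obj_injective : Function.Injective t.obj
  mem_range_iff (x : K) : x ∈ Set.range t.obj ↔ x ≠ a
  map_bijective (x y : J) : Function.Bijective (fun f : x ⟶ y => t.map f)
  map₂_bijective {x y : J} (f g : x ⟶ y) : Function.Bijective (fun θ : f ⟶ g => t.map₂ θ)

/-- The Beck-Chevalley condition: all the components of `α` have left adjoints, and the mates
of the invertible 2-cells `𝓑(f) α_x ⟶ α_y 𝓐(f)` are invertible. -/
def BeckChevalley {𝓐 𝓑 : K ⥤ᵖ H} (α : 𝓐 ⟶ 𝓑) : Prop :=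
  ∃ (l : ∀ x : K, 𝓑.obj x ⟶ 𝓐.obj x) (adj : ∀ x : K, l x ⊣ α.app x),
    ∀ {x y : K} (f : x ⟶ y),
      IsIso ((mateEquiv (adj x) (adj y)).symm (α.naturality f).inv)

end PseudoKan

end PseudoDescent

/-! Everything is tested on representables, which moves the theorem into `Cat`.

Descent side. Fix `W` and put `Q = H(W, 𝓕 -)`. The bicategorical Yoneda lemma and restriction along
`t` give a functor `descentFunctor t Q c : Q c ⥤ [J, Cat](K(c, t -), Q t)`. If `𝓕 ∘ t` has a
pointwise extension, postcomposition with `η.app c` is this functor up to equivalences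
(`postcomp_comparison_iff`). At `c = t x` it is always an equivalence, so only `a` matters. Hence
the three kinds of descent say that `descentFunctor` at `a` is faithful, fully faithful or an
equivalence for every `W`.

Monadic side. By the universal property of the Eilenberg-Moore object, the three kinds of monadicity
say the same of `comparisonFunctor adj W : H(W, e) ⥤ Alg W`, whichever left adjoint is chosen.

Link. The mates of `α` give 2-cells between the monads on the `𝓑 x`. Beck-Chevalley makes them
invertible, so the monads on `Q x = H(W, 𝓑 x)` form one pseudonatural monad `T`, which acts on `H(W,
α) : Q₀ ⟶ Q`, where `Q₀ = H(W, 𝓐 -)`. This gives a square, commuting up to isomorphism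
(`comparisonDescentIso`): the descent functor of `Q₀` followed by postcomposition with `H(W, α) ∗
t`, against the comparison `Q₀ a ⥤ Alg(T a)` followed by the descent functor on algebras. Monadicity
of the `α.app (t.obj x)` makes the postcomposition an equivalence onto transformations with action
(`Action.postcomp_isEquivalence`). The descent functor on algebras inherits faithfulness, full
faithfulness or being an equivalence from the descent functor of `Q`, that is, from the descent
hypothesis on `𝓑`. So the two remaining sides of the square have the property in question together,
which is the theorem. -/

namespace PseudoDescent

/-! ### Equivalences are detected by representables -/

section CellLemmas

variable {H : Type u} [Bicategory.{w, v} H]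

/-- Postcomposition with a composite is the composite of the postcompositions. -/
def postcompComp (W : H) {x y z : H} (f : x ⟶ y) (g : y ⟶ z) :
    postcomp W (f ≫ g) ≅ postcomp W f ⋙ postcomp W g :=
  NatIso.ofComponents (fun h => (α_ h f g).symm) (fun θ => by
    change θ ▷ (f ≫ g) ≫ (α_ _ _ _).inv = (α_ _ _ _).inv ≫ (θ ▷ f) ▷ g
    simp)

def postcompIso (W : H) {x y : H} {f g : x ⟶ y} (i : f ≅ g) : postcomp W f ≅ postcomp W g :=
  NatIso.ofComponents (fun h => whiskerLeftIso h i) (fun θ => by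
    change θ ▷ f ≫ _ ◁ i.hom = _ ◁ i.hom ≫ θ ▷ g
    rw [whisker_exchange])

def postcompId (W x : H) : postcomp W (𝟙 x) ≅ 𝟭 (W ⟶ x) :=
  NatIso.ofComponents (fun h => ρ_ h) (fun θ => by
    change θ ▷ 𝟙 x ≫ (ρ_ _).hom = (ρ_ _).hom ≫ θ
    simp)

theorem EquivalenceCell.isEquivalence_postcomp {x y : H} {f : x ⟶ y} (hf : EquivalenceCell f)
    (W : H) : (postcomp W f).IsEquivalence := by
  obtain ⟨e, rfl⟩ := hf
  exact (CategoryTheory.Equivalence.mk (postcomp W e.hom) (postcomp W e.inv)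
    ((postcompId W x).symm ≪≫ postcompIso W e.unit ≪≫ postcompComp W e.hom e.inv)
    ((postcompComp W e.inv e.hom).symm ≪≫ postcompIso W e.counit ≪≫
      postcompId W y)).isEquivalence_functor

/-- Yoneda argument: essential surjectivity at `W = y` produces a right inverse `d` of `f`, and full
faithfulness at `W = x` lifts `f ≅ (f ≫ d) ≫ f` to `𝟙 x ≅ f ≫ d`. -/
theorem equivalenceCell_iff {x y : H} (f : x ⟶ y) :
    EquivalenceCell f ↔ ∀ W : H, (postcomp W f).IsEquivalence := by
  refine ⟨fun hf => hf.isEquivalence_postcomp, fun hf => ?_⟩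
  have := hf y
  have := hf x
  let d := (postcomp y f).objPreimage (𝟙 y)
  let c : d ≫ f ≅ 𝟙 y := (postcomp y f).objObjPreimageIso (𝟙 y)
  let k : 𝟙 x ≅ f ≫ d := (postcomp x f).preimageIso
    ((λ_ f ≪≫ (ρ_ f).symm ≪≫ whiskerLeftIso f c.symm ≪≫ (α_ _ _ _).symm :
      𝟙 x ≫ f ≅ (f ≫ d) ≫ f))
  exact ⟨Bicategory.Equivalence.mkOfAdjointifyCounit k c, rfl⟩

end CellLemmas

/-! ### Lifting transformations and modifications along faithful components -/

section Lift

variable {J : Type u₁} [Bicategory.{w₁, v₁} J] {C : Type u₂} [Bicategory.{w₂, v₂} C]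
variable {P Q Q' : J ⥤ᵖ C}

theorem FaithfulCell.ext {H : Type u} [Bicategory.{w, v} H] {x y : H} {f : x ⟶ y}
    (hf : FaithfulCell f) {W : H} {g h : W ⟶ x} {a b : g ⟶ h} (e : a ▷ f = b ▷ f) : a = b :=
  (hf W).map_injective e

theorem naturality_inv_comp_map₂ (U : Q ⟶ Q') {x y : J} {f g : x ⟶ y} (η : f ⟶ g) :
    (U.naturality f).inv ≫ Q.map₂ η ▷ U.app y = U.app x ◁ Q'.map₂ η ≫ (U.naturality g).inv := by
  rw [Iso.inv_comp_eq, ← Category.assoc, Iso.eq_comp_inv]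
  exact U.naturality_naturality η

theorem whiskerLeft_naturality_inv_comp_map₂ (U : Q ⟶ Q') {x y : J} {f g : x ⟶ y} (η : f ⟶ g)
    {w : C} (s : w ⟶ Q.obj x) :
    s ◁ (U.naturality f).inv ≫ s ◁ Q.map₂ η ▷ U.app y =
      s ◁ U.app x ◁ Q'.map₂ η ≫ s ◁ (U.naturality g).inv := by
  rw [← Bicategory.whiskerLeft_comp, naturality_inv_comp_map₂, Bicategory.whiskerLeft_comp]

/-- Lifting of a pseudonatural transformation along one with faithful components. -/
def liftTrans (U : Q ⟶ Q') (hU : ∀ x, FaithfulCell (U.app x)) (s' : P ⟶ Q')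
    (s : ∀ x, P.obj x ⟶ Q.obj x) (j : ∀ x, s x ≫ U.app x ≅ s'.app x)
    (ν : ∀ {x y : J} (g : x ⟶ y), P.map g ≫ s y ≅ s x ≫ Q.map g)
    (hν : ∀ {x y : J} (g : x ⟶ y), (ν g).hom ▷ U.app y =
      (α_ _ _ _).hom ≫ P.map g ◁ (j y).hom ≫ (s'.naturality g).hom ≫ (j x).inv ▷ Q'.map g ≫
        (α_ _ _ _).hom ≫ s x ◁ (U.naturality g).inv ≫ (α_ _ _ _).inv) : P ⟶ Q :=
  Pseudofunctor.StrongTrans.mk s (fun g => ν g)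
    -- Each coherence law is checked after whiskering with `U`, where `hν` replaces `ν` by a pasting
    -- of cells of `s'` and `U`; it then follows from the same law for `s'` and for `U`.
    (fun {x y f g} η => (hU y).ext (by
      simp only [comp_whiskerRight, hν, whisker_assoc, Category.assoc, Iso.inv_hom_id_assoc]
      rw [reassoc_of% whiskerLeft_naturality_inv_comp_map₂, associator_naturality_left_assoc,
        ← whisker_exchange_assoc, ← associator_naturality_right_assoc,
        ← whisker_exchange_assoc, s'.naturality_naturality_assoc]))
    (fun x => (hU x).ext (by
      simp only [comp_whiskerRight, hν, whisker_assoc, Category.assoc]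
      rw [U.naturality_id_inv, s'.naturality_id_hom]
      simp only [Bicategory.whiskerLeft_comp, Category.assoc, Iso.inv_hom_id_assoc]
      have e₁ : s x ◁ (Q.mapId x).inv ▷ U.app x ≫ s x ◁ (Q.mapId x).hom ▷ U.app x = 𝟙 _ := by
        simp [← Bicategory.whiskerLeft_comp]
      rw [reassoc_of% e₁, ← associator_naturality_right_assoc, ← whisker_exchange_assoc,
        whiskerLeft_inv_hom_assoc, whisker_exchange_assoc]
      simp))
    (fun {x y z} f g => (hU z).ext (by
      -- By interchange, the naturality cell of `U` at `g` slides past `ν f`, so that `ν f` meets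
      -- `U.app y` instead of `U.app z` and `hν` applies to it.
      have e : ∀ (a : Q.obj y ⟶ Q.obj z) (a' : Q'.obj y ⟶ Q'.obj z)
          (b : U.app y ≫ a' ⟶ a ≫ U.app z),
          P.map f ◁ s y ◁ b ≫ P.map f ◁ (α_ _ _ _).inv ≫ (α_ _ _ _).inv ≫
            (α_ _ _ _).inv ▷ U.app z ≫ (ν f).hom ▷ a ▷ U.app z =
          (𝟙 _) ⊗≫ ((ν f).hom ▷ U.app y) ▷ a' ⊗≫ s x ◁ Q.map f ◁ b ⊗≫ 𝟙 _ := by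
        intro a a' b
        calc
          _ = 𝟙 _ ⊗≫ ((P.map f ≫ s y) ◁ b ≫ (ν f).hom ▷ (a ≫ U.app z)) ⊗≫ 𝟙 _ := by bicategory
          _ = _ := by rw [whisker_exchange]; bicategory
      simp only [comp_whiskerRight, hν, whisker_assoc, Category.assoc, Bicategory.whiskerLeft_comp]
      rw [reassoc_of% e, hν]
      rw [U.naturality_comp_inv, s'.naturality_comp_hom]
      have e₁ : s x ◁ (U.app x ◁ (Q'.mapComp f g).hom ≫ (α_ _ _ _).inv ≫
            (U.naturality f).inv ▷ Q'.map g ≫ (α_ _ _ _).hom ≫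
            Q.map f ◁ (U.naturality g).inv ≫ (α_ _ _ _).inv ≫
              (Q.mapComp f g).inv ▷ U.app z) ≫ (α_ _ _ _).inv ≫
          (α_ _ _ _).hom ≫ s x ◁ (Q.mapComp f g).hom ▷ U.app z =
          s x ◁ (U.app x ◁ (Q'.mapComp f g).hom ≫ (α_ _ _ _).inv ≫
            (U.naturality f).inv ▷ Q'.map g ≫ (α_ _ _ _).hom ≫
            Q.map f ◁ (U.naturality g).inv ≫ (α_ _ _ _).inv) := by
        rw [Iso.inv_hom_id_assoc, ← Bicategory.whiskerLeft_comp]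
        congr 1
        simp
      have e₂ : (j x).inv ▷ Q'.map (f ≫ g) ≫ (α_ _ _ _).hom ≫
          s x ◁ U.app x ◁ (Q'.mapComp f g).hom = s'.app x ◁ (Q'.mapComp f g).hom ≫
            (j x).inv ▷ (Q'.map f ≫ Q'.map g) ≫ (α_ _ _ _).hom := by
        rw [← associator_naturality_right, whisker_exchange_assoc]
      simp only [Category.assoc] at e₁ ⊢
      rw [reassoc_of% e₁]
      simp only [Category.assoc, Bicategory.whiskerLeft_comp]
      rw [reassoc_of% e₂, whiskerLeft_inv_hom_assoc, whisker_exchange_assoc]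
      symm
      calc
        _ = 𝟙 _ ⊗≫ (P.mapComp f g).hom ▷ (s z ≫ U.app z) ⊗≫ P.map f ◁ P.map g ◁ (j z).hom ≫
            P.map f ◁ (s'.naturality g).hom ⊗≫ P.map f ◁ ((j y).inv ≫ (j y).hom) ▷ Q'.map g ⊗≫
            (s'.naturality f).hom ▷ Q'.map g ⊗≫ (j x).inv ▷ (Q'.map f ≫ Q'.map g) ⊗≫
            s x ◁ (U.naturality f).inv ▷ Q'.map g ⊗≫
            s x ◁ Q.map f ◁ (U.naturality g).inv ⊗≫ 𝟙 _ := by bicategory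
        _ = _ := by rw [Iso.inv_hom_id]; bicategory))

/-- The lift composes to the original pseudonatural transformation. -/
def liftTransComp (U : Q ⟶ Q') (hU : ∀ x, FaithfulCell (U.app x)) (s' : P ⟶ Q')
    (s : ∀ x, P.obj x ⟶ Q.obj x) (j : ∀ x, s x ≫ U.app x ≅ s'.app x)
    (ν : ∀ {x y : J} (g : x ⟶ y), P.map g ≫ s y ≅ s x ≫ Q.map g)
    (hν : ∀ {x y : J} (g : x ⟶ y), (ν g).hom ▷ U.app y =
      (α_ _ _ _).hom ≫ P.map g ◁ (j y).hom ≫ (s'.naturality g).hom ≫ (j x).inv ▷ Q'.map g ≫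
        (α_ _ _ _).hom ≫ s x ◁ (U.naturality g).inv ≫ (α_ _ _ _).inv) :
    liftTrans U hU s' s j ν hν ≫ U ≅ s' :=
  Pseudofunctor.StrongTrans.isoMk j (fun {x y} g => by
    rw [Pseudofunctor.StrongTrans.categoryStruct_comp_naturality_hom]
    change _ = ((α_ _ _ _).inv ≫ (ν g).hom ▷ U.app y ≫ (α_ _ _ _).hom ≫
      s x ◁ (U.naturality g).hom ≫ (α_ _ _ _).inv) ≫ (j x).hom ▷ Q'.map g
    rw [hν]
    simp
    rfl)

/-- A modification that lifts componentwise along a pseudonatural transformation with faithful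
components lifts. -/
def liftModification (U : Q ⟶ Q') (hU : ∀ x, FaithfulCell (U.app x)) {s₁ s₂ : P ⟶ Q}
    (m : s₁ ≫ U ⟶ s₂ ≫ U) (n : ∀ x, s₁.app x ⟶ s₂.app x)
    (h : ∀ x, n x ▷ U.app x = m.as.app x) : s₁ ⟶ s₂ where
  as :=
  { app := n
    naturality := fun {x y} g => (hU y).ext (by
      have e : P.map g ◁ n y ▷ U.app y ≫ (α_ _ _ _).inv ≫ (s₂.naturality g).hom ▷ U.app y ≫
          (α_ _ _ _).hom ≫ s₂.app x ◁ (U.naturality g).hom ≫ (α_ _ _ _).inv =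
          ((α_ _ _ _).inv ≫ (s₁.naturality g).hom ▷ U.app y ≫
          (α_ _ _ _).hom ≫ s₁.app x ◁ (U.naturality g).hom ≫ (α_ _ _ _).inv) ≫
            (n x ▷ U.app x) ▷ Q'.map g := by
        rw [h, h]
        exact m.as.naturality g
      rw [← cancel_mono (α_ _ _ _).hom, ← cancel_mono (s₂.app x ◁ (U.naturality g).hom),
        ← cancel_mono (α_ _ _ _).inv]
      rw [← cancel_epi (α_ _ _ _).inv]
      simp only [Category.assoc] at e
      rw [← associator_inv_naturality_left, whisker_exchange_assoc] at e
      simpa using e) }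

theorem faithful_postcomp (U : Q ⟶ Q') (hU : ∀ x, FaithfulCell (U.app x)) (P : J ⥤ᵖ C) :
    (postcomp P U).Faithful where
  map_injective {s₁ s₂ m n} h := by
    refine Pseudofunctor.StrongTrans.homCategory.ext fun x => (hU x).ext ?_
    exact congrArg (fun k => k.as.app x) h

/-- Fullness of the components gives preimages one object at a time; their faithfulness makes these
preimages a modification. -/
theorem full_postcomp (U : Q ⟶ Q') (hU : ∀ x, FullyFaithfulCell (U.app x)) (P : J ⥤ᵖ C) :
    (postcomp P U).Full where
  map_surjective {s₁ s₂} m := by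
    have h (x : J) : ∃ n : s₁.app x ⟶ s₂.app x, n ▷ U.app x = m.as.app x := by
      have := (hU x (P.obj x)).1
      exact (postcomp (P.obj x) (U.app x)).map_surjective (m.as.app x)
    choose n hn using h
    exact ⟨liftModification U (fun x W => (hU x W).2) m n hn,
      Pseudofunctor.StrongTrans.homCategory.ext hn⟩

/-- A pseudonatural transformation whose components are equivalences is an equivalence. -/
theorem equivalenceCell_of_app (U : Q ⟶ Q') (hU : ∀ x, EquivalenceCell (U.app x)) :
    EquivalenceCell U := by
  have hU' (x : J) (W : C) : (postcomp W (U.app x)).IsEquivalence :=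
    (hU x).isEquivalence_postcomp W
  have hF (x : J) : FullyFaithfulCell (U.app x) := fun W => by
    have := hU' x W
    exact ⟨inferInstance, inferInstance⟩
  refine (equivalenceCell_iff U).2 fun P => ?_
  have := faithful_postcomp U (fun x W => (hF x W).2) P
  have := full_postcomp U hF P
  have : (postcomp P U).EssSurj := ⟨fun s' => by
    let s (x : J) : P.obj x ⟶ Q.obj x :=
      have := hU' x (P.obj x)
      (postcomp (P.obj x) (U.app x)).objPreimage (s'.app x)
    let j (x : J) : s x ≫ U.app x ≅ s'.app x :=
      have := hU' x (P.obj x)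
      (postcomp (P.obj x) (U.app x)).objObjPreimageIso (s'.app x)
    let k {x y : J} (g : x ⟶ y) : (P.map g ≫ s y) ≫ U.app y ≅ (s x ≫ Q.map g) ≫ U.app y :=
      α_ _ _ _ ≪≫ whiskerLeftIso (P.map g) (j y) ≪≫ s'.naturality g ≪≫
        whiskerRightIso (j x).symm (Q'.map g) ≪≫ α_ _ _ _ ≪≫
        whiskerLeftIso (s x) (U.naturality g).symm ≪≫ (α_ _ _ _).symm
    let ν {x y : J} (g : x ⟶ y) : P.map g ≫ s y ≅ s x ≫ Q.map g :=
      have := hU' y (P.obj x)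
      (postcomp (P.obj x) (U.app y)).preimageIso (k g)
    -- The naturality cells of the lift are forced: they are the preimages of the pasting `k g`,
    -- which is the hypothesis `hν` of `liftTrans`.
    have hν {x y : J} (g : x ⟶ y) : (ν g).hom ▷ U.app y = (k g).hom := by
      have := hU' y (P.obj x)
      exact (postcomp (P.obj x) (U.app y)).map_preimage (k g).hom
    exact ⟨_, ⟨liftTransComp U (fun x W => (hF x W).2) s' s j ν (fun g => by
      rw [hν]; rfl)⟩⟩⟩
  exact {}

/-- The components of an equivalence of pseudofunctors are equivalences. -/
theorem EquivalenceCell.app {U : Q ⟶ Q'} (hU : EquivalenceCell U) (x : J) :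
    EquivalenceCell (U.app x) := by
  obtain ⟨e, rfl⟩ := hU
  let ev {s t : Q ⟶ Q} (i : s ≅ t) : s.app x ≅ t.app x :=
    ⟨i.hom.as.app x, i.inv.as.app x, congrArg (fun m => m.as.app x) i.hom_inv_id,
      congrArg (fun m => m.as.app x) i.inv_hom_id⟩
  let ev' {s t : Q' ⟶ Q'} (i : s ≅ t) : s.app x ≅ t.app x :=
    ⟨i.hom.as.app x, i.inv.as.app x, congrArg (fun m => m.as.app x) i.hom_inv_id,
      congrArg (fun m => m.as.app x) i.inv_hom_id⟩
  exact ⟨Bicategory.Equivalence.mkOfAdjointifyCounit (f := e.hom.app x) (g := e.inv.app x)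
    (ev e.unit) (ev' e.counit), rfl⟩

end Lift

theorem comp_id_comp_id_comp_id {C : Type u} [Category.{v} C] {a b c d : C}
    (f : a ⟶ b) (g : b ⟶ c) (h : c ⟶ d) :
    f ≫ 𝟙 b ≫ g ≫ 𝟙 c ≫ h ≫ 𝟙 d = f ≫ g ≫ h := by simp

/-! ### Transformations of `Cat`-valued pseudofunctors and evaluation at an element -/

section CatValued

variable {J : Type u₁} [Bicategory.{w₁, v₁} J] {P Q : J ⥤ᵖ Cat.{w₂, v₂}}

/-- An invertible 2-cell of `Cat` from a natural isomorphism. -/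
def catIso {C D : Cat.{w₂, v₂}} {F G : C ⟶ D} (e : F.toFunctor ≅ G.toFunctor) : F ≅ G where
  hom := ⟨e.hom⟩
  inv := ⟨e.inv⟩
  hom_inv_id := Cat.Hom₂.ext e.hom_inv_id
  inv_hom_id := Cat.Hom₂.ext e.inv_hom_id

theorem Cat_congr_app {C D : Cat.{w₂, v₂}} {F G : C ⟶ D} {α β : F ⟶ G} (h : α = β) (c : C) :
    α.toNatTrans.app c = β.toNatTrans.app c := by rw [h]

theorem modification_naturality_app {s s' : P ⟶ Q} (m : s ⟶ s') {y z : J} (g : y ⟶ z)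
    (q : P.obj y) :
    (m.as.app z).toNatTrans.app ((P.map g).toFunctor.obj q) ≫
        (s'.naturality g).hom.toNatTrans.app q =
      (s.naturality g).hom.toNatTrans.app q ≫
        (Q.map g).toFunctor.map ((m.as.app y).toNatTrans.app q) :=
  Cat_congr_app (m.as.naturality g) q

theorem naturality_naturality_app' (s : P ⟶ Q) {y z : J} {f g : y ⟶ z} (η : f ⟶ g)
    (q : P.obj y) :
    (s.app z).toFunctor.map ((P.map₂ η).toNatTrans.app q) ≫
        (s.naturality g).hom.toNatTrans.app q =
      (s.naturality f).hom.toNatTrans.app q ≫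
        (Q.map₂ η).toNatTrans.app ((s.app y).toFunctor.obj q) :=
  Cat_congr_app (s.naturality_naturality η) q

theorem naturality_map_app (s : P ⟶ Q) {y z : J} (g : y ⟶ z) {q q' : P.obj y} (k : q ⟶ q') :
    (s.app z).toFunctor.map ((P.map g).toFunctor.map k) ≫
        (s.naturality g).hom.toNatTrans.app q' =
      (s.naturality g).hom.toNatTrans.app q ≫
        (Q.map g).toFunctor.map ((s.app y).toFunctor.map k) :=
  (s.naturality g).hom.toNatTrans.naturality k

theorem mapComp_naturality_app (Q : J ⥤ᵖ Cat.{w₂, v₂}) {x y z : J} (f : x ⟶ y) (g : y ⟶ z)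
    {q q' : Q.obj x} (k : q ⟶ q') :
    (Q.map (f ≫ g)).toFunctor.map k ≫ (Q.mapComp f g).hom.toNatTrans.app q' =
      (Q.mapComp f g).hom.toNatTrans.app q ≫
        (Q.map g).toFunctor.map ((Q.map f).toFunctor.map k) :=
  (Q.mapComp f g).hom.toNatTrans.naturality k

theorem naturality_comp_app' (s : P ⟶ Q) {x y z : J} (f : x ⟶ y) (g : y ⟶ z) (p : P.obj x) :
    (s.naturality (f ≫ g)).hom.toNatTrans.app p ≫
      (Q.mapComp f g).hom.toNatTrans.app ((s.app x).toFunctor.obj p) =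
    (s.app z).toFunctor.map ((P.mapComp f g).hom.toNatTrans.app p) ≫
      (s.naturality g).hom.toNatTrans.app ((P.map f).toFunctor.obj p) ≫
        (Q.map g).toFunctor.map ((s.naturality f).hom.toNatTrans.app p) := by
  refine (Cat_congr_app (s.naturality_comp f g) p).trans ?_
  change (s.app z).toFunctor.map _ ≫ 𝟙 _ ≫ (s.naturality g).hom.toNatTrans.app _ ≫ 𝟙 _ ≫
    (Q.map g).toFunctor.map _ ≫ 𝟙 _ = _
  rw [Category.comp_id, Category.id_comp, Category.id_comp]

theorem naturality_id_app' (s : P ⟶ Q) (x : J) (p : P.obj x) :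
    (s.naturality (𝟙 x)).hom.toNatTrans.app p ≫
        (Q.mapId x).hom.toNatTrans.app ((s.app x).toFunctor.obj p) =
      (s.app x).toFunctor.map ((P.mapId x).hom.toNatTrans.app p) := by
  refine (Cat_congr_app (s.naturality_id x) p).trans ?_
  change (s.app x).toFunctor.map _ ≫ 𝟙 _ ≫ 𝟙 _ = _
  rw [Category.comp_id, Category.comp_id]

/-- The components of the naturality isomorphisms of a transformation of `Cat`-valued
pseudofunctors. -/
def naturalityAt (s : P ⟶ Q) {y z : J} (g : y ⟶ z) (q : P.obj y) :
    (s.app z).toFunctor.obj ((P.map g).toFunctor.obj q) ≅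
      (Q.map g).toFunctor.obj ((s.app y).toFunctor.obj q) :=
  (Cat.Hom.toNatIso (s.naturality g)).app q

theorem comp_naturality_app {Q₀ : J ⥤ᵖ Cat.{w₂, v₂}} (s : P ⟶ Q₀) (U : Q₀ ⟶ Q) {x y : J}
    (f : x ⟶ y) (p : P.obj x) :
    ((s ≫ U).naturality f).hom.toNatTrans.app p =
      (U.app y).toFunctor.map ((s.naturality f).hom.toNatTrans.app p) ≫
        (U.naturality f).hom.toNatTrans.app ((s.app x).toFunctor.obj p) := by
  rw [Pseudofunctor.StrongTrans.categoryStruct_comp_naturality_hom]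
  change 𝟙 _ ≫ (U.app y).toFunctor.map _ ≫ 𝟙 _ ≫ (U.naturality f).hom.toNatTrans.app _ ≫ 𝟙 _ = _
  rw [Category.id_comp, Category.id_comp, Category.comp_id]

/-- Modifications between transformations of `Cat`-valued pseudofunctors. -/
def catModification {s s' : P ⟶ Q}
    (n : ∀ (y : J) (q : P.obj y), (s.app y).toFunctor.obj q ⟶ (s'.app y).toFunctor.obj q)
    (h₁ : ∀ (y : J) {q q' : P.obj y} (k : q ⟶ q'),
      (s.app y).toFunctor.map k ≫ n y q' = n y q ≫ (s'.app y).toFunctor.map k)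
    (h₂ : ∀ {y z : J} (g : y ⟶ z) (q : P.obj y),
      n z ((P.map g).toFunctor.obj q) ≫ (s'.naturality g).hom.toNatTrans.app q =
        (s.naturality g).hom.toNatTrans.app q ≫ (Q.map g).toFunctor.map (n y q)) : s ⟶ s' where
  as :=
  { app := fun y => ⟨{ app := n y, naturality := fun _ _ k => h₁ y k }⟩
    naturality := fun g => Cat.Hom₂.ext (NatTrans.ext (funext fun q => h₂ g q)) }

/-- Evaluation of transformations at an element of the domain. -/
def evalAt (P Q : J ⥤ᵖ Cat.{w₂, v₂}) {x : J} (p : P.obj x) : (P ⟶ Q) ⥤ Q.obj x where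
  obj s := (s.app x).toFunctor.obj p
  map m := (m.as.app x).toNatTrans.app p

/-- The functor `J(x, y) ⥤ P y` induced by an element of `P x`. -/
def orbit (P : J ⥤ᵖ Cat.{w₂, v₂}) {x : J} (p : P.obj x) (y : J) : (x ⟶ y) ⥤ P.obj y where
  obj g := (P.map g).toFunctor.obj p
  map η := (P.map₂ η).toNatTrans.app p
  map_id g := by rw [P.map₂_id]; rfl
  map_comp η θ := by rw [P.map₂_comp]; rfl

variable {x : J} (p : P.obj x)

/-- Every object of `P y` is isomorphic to some `P(g) p`, and the modification axiom at `g`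
determines the component there from the one at `p`. -/
theorem evalAt_faithful (hp : ∀ y, (orbit P p y).EssSurj) : (evalAt P Q p).Faithful where
  map_injective {s s' m n} h := by
    refine Pseudofunctor.StrongTrans.homCategory.ext fun y =>
      Cat.Hom₂.ext (NatTrans.ext (funext fun q => ?_))
    have := hp y
    let i := (orbit P p y).objObjPreimageIso q
    rw [← cancel_epi ((s.app y).toFunctor.map i.hom)]
    refine ((m.as.app y).toNatTrans.naturality i.hom).trans
      (Eq.trans ?_ ((n.as.app y).toNatTrans.naturality i.hom).symm)
    congr 1
    change (m.as.app x).toNatTrans.app p = (n.as.app x).toNatTrans.app p at h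
    have e₁ := modification_naturality_app m ((orbit P p y).objPreimage q) p
    have e₂ := modification_naturality_app n ((orbit P p y).objPreimage q) p
    rw [h, ← e₂] at e₁
    exact (cancel_mono (naturalityAt s' ((orbit P p y).objPreimage q) p).hom).1 e₁

/-- A morphism `u` at `p` is transported along each `g` to `P(g) p`, and then to all objects by
chosen isomorphisms. Fullness of the orbits makes the transports natural, since every morphism
between transports of `p` comes from a 2-cell. -/
theorem evalAt_full (hp : ∀ y, (orbit P p y).EssSurj) (hp' : ∀ y, (orbit P p y).Full) :
    (evalAt P Q p).Full where
  map_surjective {s s'} u := by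
    change (s.app x).toFunctor.obj p ⟶ (s'.app x).toFunctor.obj p at u
    let c {y : J} (g : x ⟶ y) : (s.app y).toFunctor.obj ((P.map g).toFunctor.obj p) ⟶
        (s'.app y).toFunctor.obj ((P.map g).toFunctor.obj p) :=
      (naturalityAt s g p).hom ≫ (Q.map g).toFunctor.map u ≫ (naturalityAt s' g p).inv
    have hc {y : J} (g g' : x ⟶ y)
        (k : (P.map g).toFunctor.obj p ⟶ (P.map g').toFunctor.obj p) :
        (s.app y).toFunctor.map k ≫ c g' = c g ≫ (s'.app y).toFunctor.map k := by
      have := hp' y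
      obtain ⟨η, rfl⟩ := (orbit P p y).map_surjective (X := g) (Y := g') k
      have e₁ := naturality_naturality_app' s η p
      have e₂ := naturality_naturality_app' s' η p
      have e₃ := (Q.map₂ η).toNatTrans.naturality u
      change (s.app y).toFunctor.map ((P.map₂ η).toNatTrans.app p) ≫
          (s.naturality g').hom.toNatTrans.app p ≫ _ ≫ _ =
        ((s.naturality g).hom.toNatTrans.app p ≫ _ ≫ _) ≫
          (s'.app y).toFunctor.map ((P.map₂ η).toNatTrans.app p)
      rw [reassoc_of% e₁, ← reassoc_of% e₃, Category.assoc, Category.assoc]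
      congr 2
      rw [Iso.comp_inv_eq, Category.assoc, Iso.eq_inv_comp]
      exact e₂.symm
    let g (y : J) (q : P.obj y) : x ⟶ y := have := hp y; (orbit P p y).objPreimage q
    let i (y : J) (q : P.obj y) : (P.map (g y q)).toFunctor.obj p ≅ q :=
      have := hp y
      (orbit P p y).objObjPreimageIso q
    let n (y : J) (q : P.obj y) : (s.app y).toFunctor.obj q ⟶ (s'.app y).toFunctor.obj q :=
      (s.app y).toFunctor.map (i y q).inv ≫ c (g y q) ≫ (s'.app y).toFunctor.map (i y q).hom
    have h₁ (y : J) {q q' : P.obj y} (k : q ⟶ q') :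
        (s.app y).toFunctor.map k ≫ n y q' = n y q ≫ (s'.app y).toFunctor.map k := by
      have e := hc (g y q) (g y q') ((i y q).hom ≫ k ≫ (i y q').inv)
      rw [← cancel_epi ((s.app y).toFunctor.map (i y q).hom)]
      simp only [Functor.map_comp, Category.assoc] at e
      simp only [n, Category.assoc]
      rw [reassoc_of% e, Iso.map_inv_hom_id, Iso.map_hom_inv_id_assoc, Category.comp_id]
    -- Independence of the choice: at `P(f) p` the chosen 1-cell may differ from `f`, but `hc`
    -- identifies the two values.
    have hn {y : J} (f : x ⟶ y) : n y ((P.map f).toFunctor.obj p) = c f := by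
      have e := hc (g y _) f (i y ((P.map f).toFunctor.obj p)).hom
      simp only [n]
      rw [← e, ← Functor.map_comp_assoc]
      simp
    refine ⟨catModification n h₁ (fun {y z} f q => ?_), ?_⟩
    · let g₀ := g y q
      have hμ := naturality_comp_app' s g₀ f p
      have hμ' := naturality_comp_app' s' g₀ f p
      -- The modification axiom is first proved at the transport `P(g₀) p` from the coherence for
      -- composites, then carried to `q` along the chosen isomorphism `i y q`.
      have key : n z ((P.map f).toFunctor.obj ((P.map g₀).toFunctor.obj p)) ≫
          (s'.naturality f).hom.toNatTrans.app ((P.map g₀).toFunctor.obj p) =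
        (s.naturality f).hom.toNatTrans.app ((P.map g₀).toFunctor.obj p) ≫
          (Q.map f).toFunctor.map (c g₀) := by
        let μ : (P.map (g₀ ≫ f)).toFunctor.obj p ≅
            (P.map f).toFunctor.obj ((P.map g₀).toFunctor.obj p) :=
          (Cat.Hom.toNatIso (P.mapComp g₀ f)).app p
        have κ := mapComp_naturality_app Q g₀ f u
        rw [← cancel_epi ((s.app z).toFunctor.map μ.hom),
          ← cancel_mono ((Q.map f).toFunctor.map (naturalityAt s' g₀ p).hom)]
        have e₁ := h₁ z μ.hom
        have e₂ := hn (g₀ ≫ f)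
        have e₃ : c (g₀ ≫ f) ≫ (s'.naturality (g₀ ≫ f)).hom.toNatTrans.app p =
            (s.naturality (g₀ ≫ f)).hom.toNatTrans.app p ≫ (Q.map (g₀ ≫ f)).toFunctor.map u := by
          change (_ ≫ _ ≫ (naturalityAt s' (g₀ ≫ f) p).inv) ≫
            (naturalityAt s' (g₀ ≫ f) p).hom = _
          simp only [Category.assoc, Iso.inv_hom_id, Category.comp_id]
          rfl
        have e₄ : c g₀ ≫ (naturalityAt s' g₀ p).hom =
            (s.naturality g₀).hom.toNatTrans.app p ≫ (Q.map g₀).toFunctor.map u := by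
          change (_ ≫ _ ≫ (naturalityAt s' g₀ p).inv) ≫ (naturalityAt s' g₀ p).hom = _
          simp only [Category.assoc, Iso.inv_hom_id, Category.comp_id]
          rfl
        simp only [Category.assoc]
        rw [reassoc_of% e₁, ← Functor.map_comp, e₄, Functor.map_comp, e₂]
        change c (g₀ ≫ f) ≫ (s'.app z).toFunctor.map ((P.mapComp g₀ f).hom.toNatTrans.app p) ≫
          (s'.naturality f).hom.toNatTrans.app _ ≫
            (Q.map f).toFunctor.map ((s'.naturality g₀).hom.toNatTrans.app p) =
          (s.app z).toFunctor.map ((P.mapComp g₀ f).hom.toNatTrans.app p) ≫ _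
        rw [← hμ', reassoc_of% e₃, κ, reassoc_of% hμ]
      have e₁ := h₁ z ((P.map f).toFunctor.map (i y q).hom)
      have e₂ := naturality_map_app s f (i y q).hom
      have e₃ := naturality_map_app s' f (i y q).hom
      have e₄ := h₁ y (i y q).hom
      rw [hn] at e₄
      rw [← cancel_epi ((s.app z).toFunctor.map ((P.map f).toFunctor.map (i y q).hom)),
        reassoc_of% e₁, e₃, reassoc_of% e₂, ← Functor.map_comp, e₄, Functor.map_comp,
        reassoc_of% key]
    · change n x p = u
      let ι : (P.map (𝟙 x)).toFunctor.obj p ≅ p := (Cat.Hom.toNatIso (P.mapId x)).app p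
      rw [← cancel_epi ((s.app x).toFunctor.map ι.hom), h₁ x ι.hom, hn]
      have e : (naturalityAt s' (𝟙 x) p).inv ≫ (s'.app x).toFunctor.map ι.hom =
          (Q.mapId x).hom.toNatTrans.app ((s'.app x).toFunctor.obj p) := by
        rw [Iso.inv_comp_eq]
        exact (naturality_id_app' s' x p).symm
      have e' : (Q.map (𝟙 x)).toFunctor.map u ≫
          (Q.mapId x).hom.toNatTrans.app ((s'.app x).toFunctor.obj p) =
          (Q.mapId x).hom.toNatTrans.app ((s.app x).toFunctor.obj p) ≫ u :=
        (Q.mapId x).hom.toNatTrans.naturality u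
      simp only [c, Category.assoc]
      rw [e, e', ← Category.assoc]
      exact congrArg (· ≫ u) (naturality_id_app' s x p)

end CatValued

/-! ### The bicategorical Yoneda lemma for `Cat`-valued pseudofunctors -/

section Yoneda

variable {J : Type u₁} [Bicategory.{w₁, v₁} J]

section

variable (Q : J ⥤ᵖ Cat.{w₂, v₂}) {c x y z : J} (q : Q.obj c)

theorem map₂_whiskerRight_mapComp_app {f f' : c ⟶ x} (θ : f ⟶ f') (g : x ⟶ y) :
    (Q.map₂ (θ ▷ g)).toNatTrans.app q ≫ (Q.mapComp f' g).hom.toNatTrans.app q =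
      (Q.mapComp f g).hom.toNatTrans.app q ≫
        (Q.map g).toFunctor.map ((Q.map₂ θ).toNatTrans.app q) :=
  Cat_congr_app (α := Q.map₂ (θ ▷ g) ≫ (Q.mapComp f' g).hom)
    (β := (Q.mapComp f g).hom ≫ Q.map₂ θ ▷ Q.map g) (by simp) q

theorem map₂_whiskerLeft_mapComp_app (k : c ⟶ x) {f g : x ⟶ y} (η : f ⟶ g) :
    (Q.map₂ (k ◁ η)).toNatTrans.app q ≫ (Q.mapComp k g).hom.toNatTrans.app q =
      (Q.mapComp k f).hom.toNatTrans.app q ≫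
        (Q.map₂ η).toNatTrans.app ((Q.map k).toFunctor.obj q) :=
  Cat_congr_app (α := Q.map₂ (k ◁ η) ≫ (Q.mapComp k g).hom)
    (β := (Q.mapComp k f).hom ≫ Q.map k ◁ Q.map₂ η) (by simp) q

theorem mapComp_mapId_app (k : c ⟶ x) :
    (Q.mapComp k (𝟙 x)).hom.toNatTrans.app q ≫
        (Q.mapId x).hom.toNatTrans.app ((Q.map k).toFunctor.obj q) =
      (Q.map₂ (ρ_ k).hom).toNatTrans.app q := by
  refine Eq.trans ?_ (Cat_congr_app (Q.map₂_right_unitor k) q).symm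
  change _ = _ ≫ _ ≫ 𝟙 _
  rw [Category.comp_id]
  rfl

theorem mapComp_mapComp_app (k : c ⟶ x) (f : x ⟶ y) (g : y ⟶ z) :
    (Q.mapComp k (f ≫ g)).hom.toNatTrans.app q ≫
        (Q.mapComp f g).hom.toNatTrans.app ((Q.map k).toFunctor.obj q) =
      (Q.map₂ (α_ k f g).inv).toNatTrans.app q ≫
        (Q.mapComp (k ≫ f) g).hom.toNatTrans.app q ≫
          (Q.map g).toFunctor.map ((Q.mapComp k f).hom.toNatTrans.app q) := by
  refine (Cat_congr_app (Q.mapComp_assoc_right_hom k f g) q).trans ?_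
  change _ ≫ _ ≫ _ ≫ 𝟙 _ = _
  rw [Category.comp_id]
  rfl

end

/-- The transformation from a representable that corresponds to an element. -/
def yonedaObj (Q : J ⥤ᵖ Cat.{w₁, v₁}) {c : J} (q : Q.obj c) : corepresentable c ⟶ Q :=
  Pseudofunctor.StrongTrans.mk (F := corepresentable c) (G := Q)
    (fun x => Cat.Hom.ofFunctor (orbit Q q x))
    (fun {x y} g => catIso (NatIso.ofComponents
      (fun f => (Cat.Hom.toNatIso (Q.mapComp f g)).app q)
      (fun {f f'} θ => map₂_whiskerRight_mapComp_app Q q (f := f) (f' := f') θ g)))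
    (fun {x y f g} η => Cat.Hom₂.ext (NatTrans.ext (funext fun k =>
      map₂_whiskerLeft_mapComp_app Q q k η)))
    (fun x => Cat.Hom₂.ext (NatTrans.ext (funext fun k => by
      refine (mapComp_mapId_app Q q k).trans ?_
      exact ((congrArg (_ ≫ ·) (Category.comp_id (𝟙 _))).trans (Category.comp_id _)).symm)))
    (fun {x y z} f g => Cat.Hom₂.ext (NatTrans.ext (funext fun k => by
      refine (mapComp_mapComp_app Q q k f g).trans ?_
      exact (comp_id_comp_id_comp_id _ _ _).symm)))

/-- The Yoneda functor of a `Cat`-valued pseudofunctor. -/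
def yonedaFunctor (Q : J ⥤ᵖ Cat.{w₁, v₁}) (c : J) : Q.obj c ⥤ (corepresentable c ⟶ Q) where
  obj q := yonedaObj Q q
  map {q q'} u := catModification (s := yonedaObj Q q) (s' := yonedaObj Q q')
    (fun _ f => (Q.map f).toFunctor.map u)
    (fun _ _ _ k => ((Q.map₂ k).toNatTrans.naturality u).symm)
    (fun g f => mapComp_naturality_app Q f g u)
  map_id q := Pseudofunctor.StrongTrans.homCategory.ext fun _ =>
    Cat.Hom₂.ext (NatTrans.ext (funext fun f => (Q.map f).toFunctor.map_id q))
  map_comp u v := Pseudofunctor.StrongTrans.homCategory.ext fun _ =>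
    Cat.Hom₂.ext (NatTrans.ext (funext fun f => (Q.map f).toFunctor.map_comp u v))

/-- The identity of `c` is a universal element of the representable at `c`. -/
def orbitCorepresentable (c y : J) :
    orbit (corepresentable c) (x := c) (𝟙 c) y ≅ 𝟭 (c ⟶ y) :=
  NatIso.ofComponents (fun f => λ_ f) (fun η => leftUnitor_naturality η)

theorem orbit_corepresentable_isEquivalence (c y : J) :
    (orbit (corepresentable c) (x := c) (𝟙 c) y).IsEquivalence :=
  have : (𝟭 (c ⟶ y)).IsEquivalence := inferInstance
  Functor.isEquivalence_of_iso (F := 𝟭 (c ⟶ y)) (orbitCorepresentable c y).symm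

/-- Evaluation at the identity is a retraction of the Yoneda functor. -/
def yonedaFunctorEvalAt (Q : J ⥤ᵖ Cat.{w₁, v₁}) (c : J) :
    yonedaFunctor Q c ⋙ evalAt (corepresentable c) Q (x := c) (𝟙 c) ≅ 𝟭 (Q.obj c) :=
  Cat.Hom.toNatIso (Q.mapId c)

/-- The orbit of `𝟙 c` is isomorphic to the identity functor, so evaluation there is fully faithful;
the Yoneda functor provides the preimages of objects. -/
theorem evalAt_corepresentable_isEquivalence (Q : J ⥤ᵖ Cat.{w₁, v₁}) (c : J) :
    (evalAt (corepresentable c) Q (x := c) (𝟙 c)).IsEquivalence := by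
  have h := orbit_corepresentable_isEquivalence c
  have := evalAt_faithful (Q := Q) (P := corepresentable c) (x := c) (𝟙 c) (fun y => inferInstance)
  have := evalAt_full (Q := Q) (P := corepresentable c) (x := c) (𝟙 c) (fun y => inferInstance)
    (fun y => inferInstance)
  have : (evalAt (corepresentable c) Q (x := c) (𝟙 c)).EssSurj :=
    ⟨fun q => ⟨(yonedaFunctor Q c).obj q, ⟨(yonedaFunctorEvalAt Q c).app q⟩⟩⟩
  exact {}

theorem yonedaFunctor_isEquivalence (Q : J ⥤ᵖ Cat.{w₁, v₁}) (c : J) :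
    (yonedaFunctor Q c).IsEquivalence := by
  have := evalAt_corepresentable_isEquivalence Q c
  have : (yonedaFunctor Q c ⋙ evalAt (corepresentable c) Q (x := c) (𝟙 c)).IsEquivalence :=
    Functor.isEquivalence_of_iso (yonedaFunctorEvalAt Q c).symm
  exact Functor.isEquivalence_of_comp_right _ (evalAt (corepresentable c) Q (x := c) (𝟙 c))

/-- The composite of a transformation that corresponds to an element. -/
def yonedaObjComp {Q Q' : J ⥤ᵖ Cat.{w₁, v₁}} (U : Q ⟶ Q') {c : J} (q : Q.obj c) :
    yonedaObj Q q ≫ U ≅ yonedaObj Q' ((U.app c).toFunctor.obj q) :=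
  Pseudofunctor.StrongTrans.isoMk
    (fun x => catIso (NatIso.ofComponents (fun f : c ⟶ x => naturalityAt U f q)
      (fun {f f'} θ => naturality_naturality_app' U (f := f) (g := f') θ q)))
    (fun {x y} g => Cat.Hom₂.ext (NatTrans.ext (funext fun f => by
      refine (naturality_comp_app' U (show c ⟶ x from f) g q).trans
        ((Category.assoc _ _ _).symm.trans ?_)
      exact congrArg (· ≫ (Q'.map g).toFunctor.map (naturalityAt U f q).hom)
        (comp_naturality_app (yonedaObj Q q) U g f).symm)))

/-- Naturality of the Yoneda functor in the pseudofunctor. -/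
def yonedaFunctorComp {Q Q' : J ⥤ᵖ Cat.{w₁, v₁}} (U : Q ⟶ Q') (c : J) :
    yonedaFunctor Q c ⋙ postcomp (corepresentable c) U ≅
      (U.app c).toFunctor ⋙ yonedaFunctor Q' c :=
  NatIso.ofComponents (yonedaObjComp U) (fun k =>
    Pseudofunctor.StrongTrans.homCategory.ext fun _ =>
      Cat.Hom₂.ext (NatTrans.ext (funext fun f => naturality_map_app U f k)))

end Yoneda

/-! ### Transferring properties of functors across a square -/

section Transfer

variable {A : Type u₁} [Category.{v₁} A] {B : Type u₂} [Category.{v₂} B]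
  {C : Type u₃} [Category.{v₃} C] {D : Type u₄} [Category.{v₄} D]

/-- `E` and `E'` need only be as good as the property transferred: faithful here, fully faithful or
equivalences in the next two results. This is what lets a descent hypothesis on `𝓑` of each strength
yield a conclusion of the same strength. -/
theorem faithful_iff_of_iso {F : A ⥤ B} {E : B ⥤ D} {G : A ⥤ C} {E' : C ⥤ D}
    (hE : E.Faithful) (hE' : E'.Faithful) (i : F ⋙ E ≅ G ⋙ E') : F.Faithful ↔ G.Faithful := by
  constructor <;> intro h
  · have := Functor.Faithful.of_iso i
    exact Functor.Faithful.of_comp G E'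
  · have := Functor.Faithful.of_iso i.symm
    exact Functor.Faithful.of_comp F E

theorem full_iff_of_iso {F : A ⥤ B} {E : B ⥤ D} {G : A ⥤ C} {E' : C ⥤ D}
    (hE : E.FullyFaithful) (hE' : E'.FullyFaithful) (i : F ⋙ E ≅ G ⋙ E') :
    F.Full ↔ G.Full := by
  have := hE.full
  have := hE.faithful
  have := hE'.full
  have := hE'.faithful
  constructor <;> intro h
  · have := Functor.Full.of_iso i
    exact Functor.Full.of_comp_faithful G E'
  · have := Functor.Full.of_iso i.symm
    exact Functor.Full.of_comp_faithful F E

theorem isEquivalence_iff_of_iso {F : A ⥤ B} {E : B ⥤ D} {G : A ⥤ C} {E' : C ⥤ D}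
    (hE : E.IsEquivalence) (hE' : E'.IsEquivalence) (i : F ⋙ E ≅ G ⋙ E') :
    F.IsEquivalence ↔ G.IsEquivalence := by
  constructor <;> intro h
  · have := Functor.isEquivalence_of_iso i
    exact Functor.isEquivalence_of_comp_right G E'
  · have := Functor.isEquivalence_of_iso i.symm
    exact Functor.isEquivalence_of_comp_right F E

end Transfer

section CatCells

theorem equivalenceCell_of_isEquivalence {C D : Cat.{w₂, v₂}} (f : C ⟶ D)
    (hf : f.toFunctor.IsEquivalence) : EquivalenceCell f :=
  ⟨Bicategory.Equivalence.mkOfAdjointifyCounit (f := f) (g := Cat.Hom.ofFunctor f.toFunctor.inv)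
    (catIso f.toFunctor.asEquivalence.unitIso) (catIso f.toFunctor.asEquivalence.counitIso), rfl⟩

end CatCells

/-! ### Functoriality of whiskering -/

section WhiskerFunctors

variable {J : Type u₁} [Bicategory.{w₁, v₁} J] {K : Type u₂} [Bicategory.{w₂, v₂} K]
  {H : Type u₃} [Bicategory.{w₃, v₃} H] {L : Type u₄} [Bicategory.{w₄, v₄} L]

/-- This is the modification axiom for a family of identity 2-cells between transformations with the
same underlying data. -/
theorem whiskerLeft_id_comp_eq {a b c d : H} {f : a ⟶ b} {g : b ⟶ d} {h : a ⟶ c} {k : c ⟶ d}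
    (θ : f ≫ g ⟶ h ≫ k) : f ◁ 𝟙 g ≫ θ = θ ≫ 𝟙 h ▷ k := by simp

def whiskerPreComp (t : J ⥤ᵖ K) {S R T : K ⥤ᵖ H} (σ : S ⟶ R) (τ : R ⟶ T) :
    whiskerPre t (σ ≫ τ) ≅ whiskerPre t σ ≫ whiskerPre t τ :=
  Pseudofunctor.StrongTrans.isoMk (fun x => Iso.refl (σ.app (t.obj x) ≫ τ.app (t.obj x)))
    (fun f =>
      whiskerLeft_id_comp_eq ((σ ≫ τ).naturality (t.map f)).hom)

def whiskerPreId (t : J ⥤ᵖ K) (S : K ⥤ᵖ H) : whiskerPre t (𝟙 S) ≅ 𝟙 (t.comp S) :=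
  Pseudofunctor.StrongTrans.isoMk (fun x => Iso.refl (𝟙 (S.obj (t.obj x))))
    (fun f =>
      whiskerLeft_id_comp_eq ((𝟙 S : S ⟶ S).naturality (t.map f)).hom)

/-- Whiskering commutes with postcomposition. -/
def whiskerPreFunctorPostcomp (t : J ⥤ᵖ K) (S : K ⥤ᵖ H) {R T : K ⥤ᵖ H} (τ : R ⟶ T) :
    postcomp S τ ⋙ whiskerPreFunctor t S T ≅
      whiskerPreFunctor t S R ⋙ postcomp (t.comp S) (whiskerPre t τ) :=
  NatIso.ofComponents (fun σ => whiskerPreComp t σ τ) (fun {σ σ'} m =>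
    Pseudofunctor.StrongTrans.homCategory.ext fun x => by
      change (m.as.app (t.obj x) ▷ τ.app (t.obj x)) ≫ 𝟙 _ =
        𝟙 _ ≫ (m.as.app (t.obj x) ▷ τ.app (t.obj x))
      simp)

/-- The image of a pseudonatural transformation under a pseudofunctor. -/
def whiskerRightTrans {R X : K ⥤ᵖ H} (κ : R ⟶ X) (U : H ⥤ᵖ L) : R.comp U ⟶ X.comp U :=
  Pseudofunctor.StrongTrans.mk
    (fun x => U.map (κ.app x))
    (fun {_ _} f => mapSquare U (κ.naturality f))
    (fun {_ _ f g} η => mapSquare_naturality U (κ.naturality f) (κ.naturality g)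
      (R.map₂ η) (X.map₂ η) (κ.naturality_naturality η))
    (fun x => by
      -- The slot filled by `𝟙 _` is the one that carries the unit constraint of `t` in
      -- `whiskerPost`; here there is no `t`.
      have h := mapSquare_id U (κ.naturality (𝟙 x)) (𝟙 _) (R.mapId x).hom (X.mapId x).hom
        (by simp)
      rw [U.map₂_id, Category.id_comp] at h
      exact h)
    (fun {x y z} f g => by
      have h := mapSquare_comp U (κ.naturality f) (κ.naturality g) (κ.naturality (f ≫ g))
        (𝟙 _) (R.mapComp f g).hom (X.mapComp f g).hom (by simp)
      rw [U.map₂_id, Category.id_comp] at h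
      exact h)

end WhiskerFunctors

/-! ### Descent expressed through the descent functors -/

section Comparison

variable {J : Type u₁} [Bicategory.{w, v} J] {K : Type u₂} [Bicategory.{w, v} K]
  {H : Type u₃} [Bicategory.{w, v} H]

/-- The functor `Q c ⥤ [J, Cat](K(c, t -), Q t)`. -/
def descentFunctor (t : J ⥤ᵖ K) (Q : K ⥤ᵖ Cat.{w, v}) (c : K) :
    Q.obj c ⥤ (t.comp (corepresentable c) ⟶ t.comp Q) :=
  yonedaFunctor Q c ⋙ whiskerPreFunctor t _ _

def descentFunctorComp (t : J ⥤ᵖ K) {Q Q' : K ⥤ᵖ Cat.{w, v}} (U : Q ⟶ Q') (c : K) :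
    descentFunctor t Q c ⋙ postcomp (t.comp (corepresentable c)) (whiskerPre t U) ≅
      (U.app c).toFunctor ⋙ descentFunctor t Q' c :=
  Functor.isoWhiskerLeft (yonedaFunctor Q c) (whiskerPreFunctorPostcomp t _ U).symm ≪≫
    Functor.isoWhiskerRight (yonedaFunctorComp U c) (whiskerPreFunctor t _ _)

/-- `t` is fully faithful in the bicategorical sense. -/
structure LocallyEquivalence (t : J ⥤ᵖ K) : Prop where
  surj {x y : J} (g : t.obj x ⟶ t.obj y) : ∃ f : x ⟶ y, Nonempty (t.map f ≅ g)
  full {x y : J} {f g : x ⟶ y} (θ : t.map f ⟶ t.map g) : ∃ η : f ⟶ g, t.map₂ η = θ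

/-- The restriction of `K(t x, -)` along `t` still has `𝟙 (t x)` as a universal element, because `t`
is essentially surjective and full on hom-categories. Evaluation there is an equivalence with the
descent functor as a section. -/
theorem descentFunctor_isEquivalence {t : J ⥤ᵖ K} (ht : LocallyEquivalence t)
    (Q : K ⥤ᵖ Cat.{w, v}) (x : J) : (descentFunctor t Q (t.obj x)).IsEquivalence := by
  let c := t.obj x
  let p : (t.comp (corepresentable c)).obj x := 𝟙 c
  have h₁ (y : J) : (orbit (t.comp (corepresentable c)) p y).EssSurj := ⟨fun g => by
    change c ⟶ t.obj y at g
    obtain ⟨f, ⟨i⟩⟩ := ht.surj g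
    exact ⟨f, ⟨(λ_ (t.map f) ≪≫ i : 𝟙 c ≫ t.map f ≅ g)⟩⟩⟩
  have h₂ (y : J) : (orbit (t.comp (corepresentable c)) p y).Full := ⟨fun {f g} k => by
    change 𝟙 c ≫ t.map f ⟶ 𝟙 c ≫ t.map g at k
    obtain ⟨η, hη⟩ := ht.full ((λ_ _).inv ≫ k ≫ (λ_ _).hom)
    refine ⟨η, ?_⟩
    change 𝟙 c ◁ t.map₂ η = k
    rw [hη]
    simp⟩
  have := evalAt_faithful (Q := t.comp Q) p h₁
  have := evalAt_full (Q := t.comp Q) p h₁ h₂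
  let i : descentFunctor t Q c ⋙ evalAt (t.comp (corepresentable c)) (t.comp Q) p ≅ 𝟭 _ :=
    yonedaFunctorEvalAt Q c
  have : (evalAt (t.comp (corepresentable c)) (t.comp Q) p).EssSurj :=
    ⟨fun q => ⟨(descentFunctor t Q c).obj q, ⟨i.app q⟩⟩⟩
  have : (evalAt (t.comp (corepresentable c)) (t.comp Q) p).IsEquivalence := {}
  have : (descentFunctor t Q c ⋙
      evalAt (t.comp (corepresentable c)) (t.comp Q) p).IsEquivalence :=
    have : (𝟭 (Q.obj c)).IsEquivalence := inferInstance
    Functor.isEquivalence_of_iso (F := 𝟭 (Q.obj c)) i.symm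
  exact Functor.isEquivalence_of_comp_right _
    (evalAt (t.comp (corepresentable c)) (t.comp Q) p)

variable {t : J ⥤ᵖ K} {F R : K ⥤ᵖ H} {κ : t.comp R ⟶ t.comp F} {η : F ⟶ R}

/-- Since `H(W, -)` preserves the extension, Yoneda gives `H(W, R c) ≃ [K, Cat](K(c, -), H(W, R -))
≃ [J, Cat](K(c, t -), H(W, F t -))`. Under these equivalences, composition with `η.app c` becomes
the descent functor. -/
theorem IsPointwisePseudoRan.exists_iso (h : IsPointwisePseudoRan t R κ)
    (hη : IsComparison t κ η) (W : H) (c : K) :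
    ∃ (E : (W ⟶ R.obj c) ⥤ (t.comp (corepresentable c) ⟶
        (t.comp F).comp (corepresentable W)))
      (E' : (t.comp (corepresentable c) ⟶ t.comp (F.comp (corepresentable W))) ⥤
        (t.comp (corepresentable c) ⟶ (t.comp F).comp (corepresentable W))),
      E.IsEquivalence ∧ E'.IsEquivalence ∧
      Nonempty (postcomp W (η.app c) ⋙ E ≅
        descentFunctor t (F.comp (corepresentable W)) c ⋙ E') := by
  let U := corepresentable W
  let κ' := whiskerPost κ U
  let ηU := whiskerRightTrans η U
  let ω := whiskerPre t ηU ≫ κ'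
  -- A component of `ω` is composition with `η.app (t.obj x)` and then `κ.app x`; by definition of a
  -- comparison their composite is isomorphic to an identity.
  have hω : EquivalenceCell ω := equivalenceCell_of_app ω fun x => by
    refine equivalenceCell_of_isEquivalence _ ?_
    obtain ⟨m⟩ := hη
    let i : η.app (t.obj x) ≫ κ.app x ≅ 𝟙 (F.obj (t.obj x)) :=
      ⟨m.hom.as.app x, m.inv.as.app x, congrArg (fun m => m.as.app x) m.hom_inv_id,
        congrArg (fun m => m.as.app x) m.inv_hom_id⟩
    have : (𝟭 (W ⟶ F.obj (t.obj x))).IsEquivalence := inferInstance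
    exact Functor.isEquivalence_of_iso (F := 𝟭 (W ⟶ F.obj (t.obj x)))
      ((postcompId W _).symm ≪≫ postcompIso W i.symm ≪≫ postcompComp W _ _)
  have h₁ := yonedaFunctor_isEquivalence (R.comp U) c
  have h₂ := h.2 W (corepresentable c)
  have hE : (yonedaFunctor (R.comp U) c ⋙
      ranFunctor t κ' (corepresentable c)).IsEquivalence := inferInstance
  refine ⟨yonedaFunctor (R.comp U) c ⋙ ranFunctor t κ' (corepresentable c),
    postcomp _ ω, hE, hω.isEquivalence_postcomp _, ⟨?_⟩⟩
  exact Functor.isoWhiskerRight (descentFunctorComp t ηU c).symm (postcomp _ κ') ≪≫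
    Functor.isoWhiskerLeft (descentFunctor t (F.comp U) c)
      (postcompComp _ (whiskerPre t ηU) κ').symm

/-- The usual uniqueness of universal arrows, with isomorphisms in place of equalities: each
extension classifies the arrow of the other. -/
theorem IsPseudoRan.exists_equivalence {X : J ⥤ᵖ H} {R R' : K ⥤ᵖ H} {κ : t.comp R ⟶ X}
    {κ' : t.comp R' ⟶ X} (h : IsPseudoRan t R κ) (h' : IsPseudoRan t R' κ') :
    ∃ e : R ⟶ R', EquivalenceCell e ∧ Nonempty (whiskerPre t e ≫ κ' ≅ κ) := by
  have h₁ := h R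
  have h₂ := h R'
  have h₃ := h' R
  have h₄ := h' R'
  let e := (ranFunctor t κ' R).objPreimage κ
  let i : whiskerPre t e ≫ κ' ≅ κ := (ranFunctor t κ' R).objObjPreimageIso κ
  let d := (ranFunctor t κ R').objPreimage κ'
  let j : whiskerPre t d ≫ κ ≅ κ' := (ranFunctor t κ R').objObjPreimageIso κ'
  let k : 𝟙 R ≅ e ≫ d := (ranFunctor t κ R).preimageIso
    (show whiskerPre t (𝟙 R) ≫ κ ≅ whiskerPre t (e ≫ d) ≫ κ from
      whiskerRightIso (whiskerPreId t R) κ ≪≫ λ_ κ ≪≫ i.symm ≪≫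
        whiskerLeftIso (whiskerPre t e) j.symm ≪≫ (α_ _ _ _).symm ≪≫
          whiskerRightIso (whiskerPreComp t e d).symm κ)
  let l : d ≫ e ≅ 𝟙 R' := (ranFunctor t κ' R').preimageIso
    (show whiskerPre t (d ≫ e) ≫ κ' ≅ whiskerPre t (𝟙 R') ≫ κ' from
      whiskerRightIso (whiskerPreComp t d e) κ' ≪≫ α_ _ _ _ ≪≫
        whiskerLeftIso (whiskerPre t d) i ≪≫ j ≪≫ (λ_ κ').symm ≪≫
          whiskerRightIso (whiskerPreId t R').symm κ')
  exact ⟨e, ⟨Bicategory.Equivalence.mkOfAdjointifyCounit k l, rfl⟩, ⟨i⟩⟩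

theorem IsPseudoRan.exists_comparison {κ : t.comp R ⟶ t.comp F} (h : IsPseudoRan t R κ) :
    ∃ η : F ⟶ R, IsComparison t κ η :=
  have := h F
  ⟨_, ⟨(ranFunctor t κ F).objObjPreimageIso (𝟙 (t.comp F))⟩⟩

theorem IsComparison.exists_iso {R R' : K ⥤ᵖ H} {κ : t.comp R ⟶ t.comp F}
    {κ' : t.comp R' ⟶ t.comp F} {η : F ⟶ R} {η' : F ⟶ R'} (h : IsPseudoRan t R κ)
    (h' : IsPseudoRan t R' κ') (hη : IsComparison t κ η) (hη' : IsComparison t κ' η') :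
    ∃ e : R ⟶ R', EquivalenceCell e ∧ Nonempty (η ≫ e ≅ η') := by
  obtain ⟨e, he, ⟨i⟩⟩ := h.exists_equivalence h'
  obtain ⟨m⟩ := hη
  obtain ⟨m'⟩ := hη'
  have := h' F
  refine ⟨e, he, ⟨(ranFunctor t κ' F).preimageIso
    (show whiskerPre t (η ≫ e) ≫ κ' ≅ whiskerPre t η' ≫ κ' from
      whiskerRightIso (whiskerPreComp t η e) κ' ≪≫ α_ _ _ _ ≪≫
        whiskerLeftIso (whiskerPre t η) i ≪≫ m ≪≫ m'.symm)⟩⟩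

def isoApp {P Q : K ⥤ᵖ H} {s s' : P ⟶ Q} (i : s ≅ s') (x : K) : s.app x ≅ s'.app x :=
  ⟨i.hom.as.app x, i.inv.as.app x, congrArg (fun m => m.as.app x) i.hom_inv_id,
    congrArg (fun m => m.as.app x) i.inv_hom_id⟩

/-- The definitions of descent allow any pseudo-Kan extension; this passes from it to a pointwise
one. -/
theorem IsComparison.postcomp_iso {R R' : K ⥤ᵖ H} {κ : t.comp R ⟶ t.comp F}
    {κ' : t.comp R' ⟶ t.comp F} {η : F ⟶ R} {η' : F ⟶ R'} (h : IsPseudoRan t R κ)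
    (h' : IsPseudoRan t R' κ') (hη : IsComparison t κ η) (hη' : IsComparison t κ' η')
    (W : H) (c : K) :
    ∃ E : (W ⟶ R.obj c) ⥤ (W ⟶ R'.obj c), E.IsEquivalence ∧
      Nonempty (postcomp W (η.app c) ⋙ E ≅ postcomp W (η'.app c)) := by
  obtain ⟨e, he, ⟨i⟩⟩ := hη.exists_iso h h' hη'
  exact ⟨_, (he.app c).isEquivalence_postcomp W,
    ⟨(postcompComp W (η.app c) (e.app c)).symm ≪≫ postcompIso W (isoApp i c)⟩⟩

/-- The comparison of a pseudofunctor whose restriction has a pointwise pseudo-Kan extension is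
represented by the descent functors. -/
theorem exists_iso_descentFunctor (hF : HasPointwisePseudoRan t (t.comp F))
    (h : IsPseudoRan t R κ) (hη : IsComparison t κ η) (W : H) (c : K) :
    ∃ (E : (W ⟶ R.obj c) ⥤ (t.comp (corepresentable c) ⟶
        (t.comp F).comp (corepresentable W)))
      (E' : (t.comp (corepresentable c) ⟶ t.comp (F.comp (corepresentable W))) ⥤
        (t.comp (corepresentable c) ⟶ (t.comp F).comp (corepresentable W))),
      E.IsEquivalence ∧ E'.IsEquivalence ∧
      Nonempty (postcomp W (η.app c) ⋙ E ≅
        descentFunctor t (F.comp (corepresentable W)) c ⋙ E') := by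
  obtain ⟨R', κ', h'⟩ := hF
  obtain ⟨η', hη'⟩ := h'.1.exists_comparison
  obtain ⟨E₀, hE₀, ⟨i₀⟩⟩ := hη.postcomp_iso h h'.1 hη' W c
  obtain ⟨E, E', hE, hE', ⟨i⟩⟩ := h'.exists_iso hη' W c
  exact ⟨E₀ ⋙ E, E', Functor.isEquivalence_trans _ _, hE', ⟨Functor.isoWhiskerRight i₀ E ≪≫ i⟩⟩

theorem postcomp_comparison_iff (hF : HasPointwisePseudoRan t (t.comp F))
    (h : IsPseudoRan t R κ) (hη : IsComparison t κ η) (W : H) (c : K) :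
    ((postcomp W (η.app c)).Faithful ↔
      (descentFunctor t (F.comp (corepresentable W)) c).Faithful) ∧
    ((postcomp W (η.app c)).Full ↔
      (descentFunctor t (F.comp (corepresentable W)) c).Full) ∧
    ((postcomp W (η.app c)).IsEquivalence ↔
      (descentFunctor t (F.comp (corepresentable W)) c).IsEquivalence) := by
  obtain ⟨E, E', hE, hE', ⟨i⟩⟩ := exists_iso_descentFunctor hF h hη W c
  exact ⟨faithful_iff_of_iso inferInstance inferInstance i,
    full_iff_of_iso (.ofFullyFaithful E) (.ofFullyFaithful E') i,
    isEquivalence_iff_of_iso hE hE' i⟩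

theorem almostDescent_iff (hF : HasPointwisePseudoRan t (t.comp F)) (a : K) :
    AlmostDescent t a F ↔
      ∀ W : H, (descentFunctor t (F.comp (corepresentable W)) a).Faithful := by
  constructor
  · rintro ⟨R, κ, η, h, hη, hf⟩ W
    exact (postcomp_comparison_iff hF h hη W a).1.1 (hf W)
  · intro hf
    obtain ⟨R, κ, h⟩ := id hF
    obtain ⟨η, hη⟩ := h.1.exists_comparison
    exact ⟨R, κ, η, h.1, hη, fun W => (postcomp_comparison_iff hF h.1 hη W a).1.2 (hf W)⟩

theorem descent_iff (hF : HasPointwisePseudoRan t (t.comp F)) (a : K) :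
    Descent t a F ↔
      ∀ W : H, (descentFunctor t (F.comp (corepresentable W)) a).Full ∧
        (descentFunctor t (F.comp (corepresentable W)) a).Faithful := by
  constructor
  · rintro ⟨R, κ, η, h, hη, hf⟩ W
    exact ⟨(postcomp_comparison_iff hF h hη W a).2.1.1 (hf W).1,
      (postcomp_comparison_iff hF h hη W a).1.1 (hf W).2⟩
  · intro hf
    obtain ⟨R, κ, h⟩ := id hF
    obtain ⟨η, hη⟩ := h.1.exists_comparison
    exact ⟨R, κ, η, h.1, hη, fun W =>
      ⟨(postcomp_comparison_iff hF h.1 hη W a).2.1.2 (hf W).1,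
        (postcomp_comparison_iff hF h.1 hη W a).1.2 (hf W).2⟩⟩

/-- Being an equivalence is checked on components. Every object other than `a` lies in the image of
`t`, where the descent functor is automatically an equivalence, so only the condition at `a`
remains. -/
theorem effectiveDescent_iff (hF : HasPointwisePseudoRan t (t.comp F))
    (ht : LocallyEquivalence t) (a : K) (ha : ∀ c : K, c ≠ a → ∃ x, t.obj x = c) :
    EffectiveDescent t F ↔
      ∀ W : H, (descentFunctor t (F.comp (corepresentable W)) a).IsEquivalence := by
  constructor
  · rintro ⟨R, κ, η, h, hη, hf⟩ W
    exact (postcomp_comparison_iff hF h hη W a).2.2.1 ((hf.app a).isEquivalence_postcomp W)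
  · intro hf
    obtain ⟨R, κ, h⟩ := id hF
    obtain ⟨η, hη⟩ := h.1.exists_comparison
    refine ⟨R, κ, η, h.1, hη, equivalenceCell_of_app η fun c => (equivalenceCell_iff _).2
      fun W => (postcomp_comparison_iff hF h.1 hη W c).2.2.2 ?_⟩
    by_cases hc : c = a
    · exact hc ▸ hf W
    · obtain ⟨x, rfl⟩ := ha c hc
      exact descentFunctor_isEquivalence ht _ x

theorem IsInclusion.locallyEquivalence {t : StrictPseudofunctor J K} {a : K}
    (ht : IsInclusion t a) : LocallyEquivalence t.toPseudofunctor where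
  surj {x y} g := by
    obtain ⟨f, hf⟩ := (ht.map_bijective x y).2 g
    exact ⟨f, ⟨eqToIso hf⟩⟩
  full {x y f g} θ := (ht.map₂_bijective f g).2 θ

end Comparison

/-! ### Algebras and Eilenberg-Moore comparisons -/

section AlgebraLemmas

variable {H : Type u} [Bicategory.{w, v} H] {b e : H}

/-- An isomorphism of algebras from an invertible 2-cell that commutes with the actions. -/
def Alg.isoMk {T : Mnd b} {X : H} {M N : Alg T X} (i : M.carrier ≅ N.carrier)
    (h : M.act ≫ i.hom = i.hom ▷ T.T ≫ N.act) : M ≅ N where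
  hom := ⟨i.hom, h⟩
  inv := ⟨i.inv, by
    rw [← cancel_epi (i.hom ▷ T.T), ← reassoc_of% h]
    simp⟩
  hom_inv_id := Alg.Hom.ext i.hom_inv_id
  inv_hom_id := Alg.Hom.ext i.inv_hom_id

/-- The underlying invertible 2-cell of an isomorphism of algebras. -/
def Alg.isoCarrier {T : Mnd b} {X : H} {M N : Alg T X} (i : M ≅ N) : M.carrier ≅ N.carrier where
  hom := i.hom.cell
  inv := i.inv.cell
  hom_inv_id := congrArg Alg.Hom.cell i.hom_inv_id
  inv_hom_id := congrArg Alg.Hom.cell i.inv_hom_id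

/-- Restriction along a composite is the composite of the restrictions. -/
def restrictFunctorComp {T : Mnd b} {X Y : H} (M : Alg T Y) (c : X ⟶ Y) (W : H) :
    postcomp W c ⋙ M.restrictFunctor W ≅ (M.restrict c).restrictFunctor W :=
  NatIso.ofComponents (fun y => Alg.isoMk (α_ y c M.carrier) (by
    change ((α_ (y ≫ c) M.carrier T.T).hom ≫ (y ≫ c) ◁ M.act) ≫ (α_ _ _ _).hom =
      (α_ y c M.carrier).hom ▷ T.T ≫ (α_ _ _ _).hom ≫ y ◁ ((α_ _ _ _).hom ≫ c ◁ M.act)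
    simp)) (fun {y z} θ => Alg.Hom.ext (by
      change (θ ▷ c) ▷ M.carrier ≫ (α_ _ _ _).hom = (α_ _ _ _).hom ≫ θ ▷ (c ≫ M.carrier)
      simp))

/-- Isomorphic algebras have isomorphic restriction functors. -/
def restrictFunctorIso {T : Mnd b} {Y : H} {M N : Alg T Y} (i : M ≅ N) (W : H) :
    M.restrictFunctor W ≅ N.restrictFunctor W :=
  NatIso.ofComponents (fun y => Alg.isoMk (whiskerLeftIso y (Alg.isoCarrier i)) (by
    change ((α_ y M.carrier T.T).hom ≫ y ◁ M.act) ≫ y ◁ i.hom.cell =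
      (y ◁ i.hom.cell) ▷ T.T ≫ (α_ _ _ _).hom ≫ y ◁ N.act
    rw [Category.assoc, ← Bicategory.whiskerLeft_comp, i.hom.comm]
    simp)) (fun {y z} θ => Alg.Hom.ext (by
      change θ ▷ M.carrier ≫ z ◁ i.hom.cell = y ◁ i.hom.cell ≫ θ ▷ N.carrier
      rw [whisker_exchange]))

/-- The comparison functor `H(W, e) ⥤ Alg W` of an adjunction. -/
def comparisonFunctor {l : b ⟶ e} {r : e ⟶ b} (adj : l ⊣ r) (W : H) :
    (W ⟶ e) ⥤ Alg (adjMnd adj) W :=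
  (adjAlg adj).restrictFunctor W

section Monadicity

variable {l : b ⟶ e} {r : e ⟶ b} {adj : l ⊣ r}

/-- Restricting the universal algebra along `c` gives the canonical algebra, so `H(W, c)` followed
by the equivalence `H(W, E) ≃ Alg W` is the comparison functor. -/
theorem IsEMComparison.iff {E : EMObject (adjMnd adj)} {c : e ⟶ E.obj}
    (hc : IsEMComparison adj E c) (W : H) :
    ((postcomp W c).Faithful ↔ (comparisonFunctor adj W).Faithful) ∧
    ((postcomp W c).Full ↔ (comparisonFunctor adj W).Full) ∧
    ((postcomp W c).IsEquivalence ↔ (comparisonFunctor adj W).IsEquivalence) := by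
  obtain ⟨i⟩ := hc
  have hE := E.isEquivalence W
  let j : postcomp W c ⋙ E.univ.restrictFunctor W ≅ comparisonFunctor adj W ⋙ 𝟭 _ :=
    restrictFunctorComp E.univ c W ≪≫ restrictFunctorIso i W ≪≫ (Functor.rightUnitor _).symm
  exact ⟨faithful_iff_of_iso inferInstance inferInstance j,
    full_iff_of_iso (.ofFullyFaithful _) (.ofFullyFaithful _) j,
    isEquivalence_iff_of_iso inferInstance inferInstance j⟩

end Monadicity

end AlgebraLemmas

/-! ### Independence of the left adjoint -/

section ChangeOfAdjunction

variable {H : Type u} [Bicategory.{w, v} H] {b e : H} {l l' : b ⟶ e} {r : e ⟶ b}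
  (adj : l ⊣ r) (adj' : l' ⊣ r)

/-- The canonical 2-cell between two left adjoints. -/
def leftAdjointCell : l' ⟶ l :=
  (λ_ _).inv ≫ adj.unit ▷ l' ≫ (α_ _ _ _).hom ≫ l ◁ adj'.counit ≫ (ρ_ _).hom

theorem unit_leftAdjointCell : adj'.unit ≫ leftAdjointCell adj adj' ▷ r = adj.unit := by
  dsimp only [leftAdjointCell]
  calc
    _ = 𝟙 _ ⊗≫ (𝟙 b ◁ adj'.unit ≫ adj.unit ▷ (l' ≫ r)) ⊗≫ l ◁ adj'.counit ▷ r ⊗≫ 𝟙 _ := by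
      bicategory
    _ = 𝟙 _ ⊗≫ adj.unit ▷ 𝟙 b ⊗≫ l ◁ (rightZigzag adj'.unit adj'.counit) ⊗≫ 𝟙 _ := by
      rw [whisker_exchange]; bicategory
    _ = _ := by rw [adj'.right_triangle]; bicategory

theorem leftAdjointCell_counit : r ◁ leftAdjointCell adj adj' ≫ adj.counit = adj'.counit := by
  dsimp only [leftAdjointCell]
  calc
    _ = 𝟙 _ ⊗≫ r ◁ adj.unit ▷ l' ⊗≫ ((r ≫ l) ◁ adj'.counit ≫ adj.counit ▷ 𝟙 e) ⊗≫ 𝟙 _ := by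
      bicategory
    _ = 𝟙 _ ⊗≫ (rightZigzag adj.unit adj.counit) ▷ l' ⊗≫ 𝟙 e ◁ adj'.counit ⊗≫ 𝟙 _ := by
      rw [whisker_exchange]; bicategory
    _ = _ := by rw [adj.right_triangle]; bicategory

/-- The cell is the conjugate of `𝟙 r`, and conjugation respects composition. -/
theorem leftAdjointCell_comp : leftAdjointCell adj adj' ≫ leftAdjointCell adj' adj = 𝟙 l' := by
  have h (adj₁ : l ⊣ r) (adj₂ : l' ⊣ r) :
      leftAdjointCell adj₁ adj₂ = (conjugateEquiv adj₁ adj₂).symm (𝟙 r) := by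
    rw [conjugateEquiv_symm_apply']
    simp [leftAdjointCell]
  have h' (adj₁ : l' ⊣ r) (adj₂ : l ⊣ r) :
      leftAdjointCell adj₁ adj₂ = (conjugateEquiv adj₁ adj₂).symm (𝟙 r) := by
    rw [conjugateEquiv_symm_apply']
    simp [leftAdjointCell]
  rw [h, h', Bicategory.conjugateEquiv_symm_comp]
  simp

/-- Both multiplications are built from counits. Once `adj'.counit` is written through `adj.counit`,
only interchange is left. -/
theorem whiskerRight_leftAdjointCell_mul :
    (leftAdjointCell adj adj' ▷ r) ▷ (l' ≫ r) ≫ (l ≫ r) ◁ (leftAdjointCell adj adj' ▷ r) ≫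
      (adjMnd adj).mul = (adjMnd adj').mul ≫ leftAdjointCell adj adj' ▷ r := by
  dsimp only [adjMnd]
  rw [← leftAdjointCell_counit adj adj']
  generalize leftAdjointCell adj adj' = k
  calc
    _ = 𝟙 _ ⊗≫ k ▷ r ▷ l' ▷ r ⊗≫ l ◁ (r ◁ k ≫ adj.counit) ▷ r ⊗≫ 𝟙 _ := by bicategory
    _ = 𝟙 _ ⊗≫ (k ▷ (r ≫ l') ≫ l ◁ (r ◁ k ≫ adj.counit)) ▷ r ⊗≫ 𝟙 _ := by bicategory
    _ = _ := by rw [← whisker_exchange]; bicategory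

end ChangeOfAdjunction

/-! ### Morphisms of monads and restriction of algebras -/

section MonadMorphism

variable {H : Type u} [Bicategory.{w, v} H] {b : H} {T T' : Mnd b}

/-- A morphism of monads on the same object. -/
structure MndHom (T' T : Mnd b) where
  cell : T'.T ⟶ T.T
  unit : T'.unit ≫ cell = T.unit
  mul : cell ▷ T'.T ≫ T.T ◁ cell ≫ T.mul = T'.mul ≫ cell

/-- The functor between categories of algebras induced by a morphism of monads. -/
def MndHom.pull (φ : MndHom T' T) (W : H) : Alg T W ⥤ Alg T' W where
  obj M :=
    { carrier := M.carrier
      act := M.carrier ◁ φ.cell ≫ M.act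
      act_unit := by
        rw [← M.act_unit, ← Bicategory.whiskerLeft_comp_assoc, φ.unit]
      act_mul := by
        rw [← Bicategory.whiskerLeft_comp_assoc, ← φ.mul,
          Bicategory.whiskerLeft_comp, Bicategory.whiskerLeft_comp, Category.assoc, Category.assoc,
          M.act_mul, comp_whiskerRight, Category.assoc, ← whisker_exchange_assoc]
        simp }
  map {M N} f := ⟨f.cell, by
    change (M.carrier ◁ φ.cell ≫ M.act) ≫ f.cell = f.cell ▷ T'.T ≫ N.carrier ◁ φ.cell ≫ N.act
    rw [Category.assoc, f.comm, whisker_exchange_assoc]⟩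
  map_id M := rfl
  map_comp f g := rfl

/-- The inverse of an invertible morphism of monads. -/
def MndHom.inv (φ : MndHom T' T) (ψ : T.T ⟶ T'.T) (h : φ.cell ≫ ψ = 𝟙 _) (h' : ψ ≫ φ.cell = 𝟙 _) :
    MndHom T T' where
  cell := ψ
  unit := by rw [← φ.unit, Category.assoc, h, Category.comp_id]
  mul := by
    have e : IsIso φ.cell := ⟨ψ, h, h'⟩
    rw [← cancel_mono φ.cell, Category.assoc, Category.assoc, ← φ.mul, Category.assoc, h',
      Category.comp_id, whisker_exchange_assoc, ← comp_whiskerRight_assoc, h', id_whiskerRight,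
      Category.id_comp, ← Bicategory.whiskerLeft_comp_assoc, h', Bicategory.whiskerLeft_id,
      Category.id_comp]

theorem MndHom.pull_isEquivalence (φ : MndHom T' T) (ψ : T.T ⟶ T'.T) (h : φ.cell ≫ ψ = 𝟙 _)
    (h' : ψ ≫ φ.cell = 𝟙 _) (W : H) : (φ.pull W).IsEquivalence :=
  (CategoryTheory.Equivalence.mk (φ.pull W) ((φ.inv ψ h h').pull W)
    (NatIso.ofComponents (fun M => Alg.isoMk (Iso.refl M.carrier) (by
      change M.act ≫ 𝟙 _ = 𝟙 _ ▷ T.T ≫ M.carrier ◁ ψ ≫ M.carrier ◁ φ.cell ≫ M.act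
      rw [← Bicategory.whiskerLeft_comp_assoc, h']
      simp)) (fun f => Alg.Hom.ext (by
        change f.cell ≫ 𝟙 _ = 𝟙 _ ≫ f.cell
        simp)))
    (NatIso.ofComponents (fun M => Alg.isoMk (Iso.refl M.carrier) (by
      change (M.carrier ◁ φ.cell ≫ M.carrier ◁ ψ ≫ M.act) ≫ 𝟙 _ = 𝟙 _ ▷ T'.T ≫ M.act
      rw [← Bicategory.whiskerLeft_comp_assoc, h]
      simp)) (fun f => Alg.Hom.ext (by
        change f.cell ≫ 𝟙 _ = 𝟙 _ ≫ f.cell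
        simp)))).isEquivalence_functor

end MonadMorphism

/-! ### Monadicity expressed through the comparison functors -/

section MonadicityCriteria

variable {H : Type u} [Bicategory.{w, v} H] {b e : H}

/-- The isomorphism between the monads of two adjunctions with the same right adjoint. -/
def changeAdjunction {l l' : b ⟶ e} {r : e ⟶ b} (adj : l ⊣ r) (adj' : l' ⊣ r) :
    MndHom (adjMnd adj') (adjMnd adj) where
  cell := leftAdjointCell adj adj' ▷ r
  unit := unit_leftAdjointCell adj adj'
  mul := whiskerRight_leftAdjointCell_mul adj adj'

/-- Two left adjoints induce isomorphic monads, and the equivalence between their algebras carries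
one comparison functor to the other. It is needed because monadicity chooses its own left adjoint,
while Beck-Chevalley fixes another. -/
theorem comparisonFunctor_change {l l' : b ⟶ e} {r : e ⟶ b} (adj : l ⊣ r) (adj' : l' ⊣ r) (W : H) :
    ((comparisonFunctor adj W).Faithful ↔ (comparisonFunctor adj' W).Faithful) ∧
    ((comparisonFunctor adj W).Full ↔ (comparisonFunctor adj' W).Full) ∧
    ((comparisonFunctor adj W).IsEquivalence ↔ (comparisonFunctor adj' W).IsEquivalence) := by
  have hE := (changeAdjunction adj adj').pull_isEquivalence (leftAdjointCell adj' adj ▷ r)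
    (by
      change leftAdjointCell adj adj' ▷ r ≫ leftAdjointCell adj' adj ▷ r = 𝟙 (l' ≫ r)
      rw [← comp_whiskerRight, leftAdjointCell_comp, id_whiskerRight])
    (by
      change leftAdjointCell adj' adj ▷ r ≫ leftAdjointCell adj adj' ▷ r = 𝟙 (l ≫ r)
      rw [← comp_whiskerRight, leftAdjointCell_comp, id_whiskerRight]) W
  let j : comparisonFunctor adj W ⋙ (changeAdjunction adj adj').pull W ≅
      comparisonFunctor adj' W ⋙ 𝟭 _ :=
    NatIso.ofComponents (fun y => Alg.isoMk (Iso.refl (y ≫ r)) (by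
      change ((y ≫ r) ◁ (leftAdjointCell adj adj' ▷ r) ≫ (α_ _ _ _).hom ≫
          y ◁ ((α_ r l r).inv ≫ adj.counit ▷ r ≫ (λ_ r).hom)) ≫ 𝟙 _ =
        𝟙 _ ▷ (l' ≫ r) ≫ (α_ _ _ _).hom ≫
          y ◁ ((α_ r l' r).inv ≫ adj'.counit ▷ r ≫ (λ_ r).hom)
      rw [← leftAdjointCell_counit adj adj']
      simp)) (fun {y z} θ => Alg.Hom.ext (by
        change θ ▷ r ≫ 𝟙 _ = 𝟙 _ ≫ θ ▷ r
        simp))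
  exact ⟨faithful_iff_of_iso inferInstance inferInstance j,
    full_iff_of_iso (.ofFullyFaithful _) (.ofFullyFaithful _) j,
    isEquivalence_iff_of_iso inferInstance inferInstance j⟩

variable {l : b ⟶ e} {r : e ⟶ b} (adj : l ⊣ r)

theorem exists_isEMComparison (E : EMObject (adjMnd adj)) :
    ∃ c : e ⟶ E.obj, IsEMComparison adj E c :=
  have := E.isEquivalence e
  ⟨_, ⟨(E.univ.restrictFunctor e).objObjPreimageIso (adjAlg adj)⟩⟩

theorem almostMonadic_iff (hE : Nonempty (EMObject (adjMnd adj))) :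
    AlmostMonadic r ↔ ∀ W : H, (comparisonFunctor adj W).Faithful := by
  constructor
  · rintro ⟨l', adj', E, c, hc, h⟩ W
    exact (comparisonFunctor_change adj' adj W).1.1 ((hc.iff W).1.1 (h W))
  · intro h
    obtain ⟨E⟩ := hE
    obtain ⟨c, hc⟩ := exists_isEMComparison adj E
    exact ⟨l, adj, E, c, hc, fun W => (hc.iff W).1.2 (h W)⟩

theorem premonadic_iff (hE : Nonempty (EMObject (adjMnd adj))) :
    Premonadic r ↔
      ∀ W : H, (comparisonFunctor adj W).Full ∧ (comparisonFunctor adj W).Faithful := by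
  constructor
  · rintro ⟨l', adj', E, c, hc, h⟩ W
    exact ⟨(comparisonFunctor_change adj' adj W).2.1.1 ((hc.iff W).2.1.1 (h W).1),
      (comparisonFunctor_change adj' adj W).1.1 ((hc.iff W).1.1 (h W).2)⟩
  · intro h
    obtain ⟨E⟩ := hE
    obtain ⟨c, hc⟩ := exists_isEMComparison adj E
    exact ⟨l, adj, E, c, hc, fun W => ⟨(hc.iff W).2.1.2 (h W).1, (hc.iff W).1.2 (h W).2⟩⟩

/-- A monadic 1-cell brings its own Eilenberg-Moore object, so none has to be assumed at the objects
`t.obj x`. -/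
theorem Monadic.isEquivalence_comparisonFunctor (h : Monadic r) (W : H) :
    (comparisonFunctor adj W).IsEquivalence := by
  obtain ⟨l', adj', E, c, hc, h⟩ := h
  exact (comparisonFunctor_change adj' adj W).2.2.1
    ((hc.iff W).2.2.1 (h.isEquivalence_postcomp W))

theorem monadic_iff (hE : Nonempty (EMObject (adjMnd adj))) :
    Monadic r ↔ ∀ W : H, (comparisonFunctor adj W).IsEquivalence := by
  refine ⟨fun h => h.isEquivalence_comparisonFunctor adj, fun h => ?_⟩
  obtain ⟨E⟩ := hE
  obtain ⟨c, hc⟩ := exists_isEMComparison adj E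
  exact ⟨l, adj, E, c, hc, (equivalenceCell_iff c).2 fun W => (hc.iff W).2.2.2 (h W)⟩

end MonadicityCriteria

/-! ### The 2-cell between the monads of an invertible square of right adjoints -/

section Squares

variable {H : Type u} [Bicategory.{w, v} H] {b₁ e₁ b₂ e₂ : H} {l₁ : b₁ ⟶ e₁} {r₁ : e₁ ⟶ b₁}
  {l₂ : b₂ ⟶ e₂} {r₂ : e₂ ⟶ b₂} (adj₁ : l₁ ⊣ r₁) (adj₂ : l₂ ⊣ r₂) {g : b₁ ⟶ b₂} {h : e₁ ⟶ e₂}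
  (ν : h ≫ r₂ ≅ r₁ ≫ g)

/-- The mate of an invertible square between right adjoints. -/
def squareMate : g ≫ l₂ ⟶ l₁ ≫ h :=
  (mateEquiv adj₁ adj₂).symm ν.inv

theorem squareMate_eq : squareMate adj₁ adj₂ ν =
    𝟙 _ ⊗≫ adj₁.unit ▷ g ▷ l₂ ⊗≫ l₁ ◁ ν.inv ▷ l₂ ⊗≫ l₁ ◁ h ◁ adj₂.counit ⊗≫ 𝟙 _ :=
  mateEquiv_symm_apply' adj₁ adj₂ ν.inv

/-- The 2-cell `g T₂ ⟶ T₁ g` induced by a square between right adjoints. -/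
def squareCell : g ≫ l₂ ≫ r₂ ⟶ (l₁ ≫ r₁) ≫ g :=
  (α_ _ _ _).inv ≫ squareMate adj₁ adj₂ ν ▷ r₂ ≫ (α_ _ _ _).hom ≫ l₁ ◁ ν.hom ≫ (α_ _ _ _).inv

/-- The Beck-Chevalley condition enters here: `ν` is invertible, so an invertible mate gives an
invertible 2-cell between the monads. -/
theorem squareCell_isIso (hν : IsIso (squareMate adj₁ adj₂ ν)) :
    IsIso (squareCell adj₁ adj₂ ν) := by
  unfold squareCell
  infer_instance

theorem unit_squareMate : g ◁ adj₂.unit ≫ (α_ _ _ _).inv ≫ squareMate adj₁ adj₂ ν ▷ r₂ =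
    (ρ_ _).hom ≫ (λ_ _).inv ≫ adj₁.unit ▷ g ≫ (α_ _ _ _).hom ≫ l₁ ◁ ν.inv ≫ (α_ _ _ _).inv := by
  rw [squareMate_eq]
  calc
    _ = 𝟙 _ ⊗≫ (𝟙 b₁ ◁ (g ◁ adj₂.unit) ≫ adj₁.unit ▷ (g ≫ l₂ ≫ r₂)) ⊗≫
          l₁ ◁ ν.inv ▷ l₂ ▷ r₂ ⊗≫ l₁ ◁ h ◁ adj₂.counit ▷ r₂ ⊗≫ 𝟙 _ := by bicategory
    _ = 𝟙 _ ⊗≫ adj₁.unit ▷ g ⊗≫ l₁ ◁ ((r₁ ≫ g) ◁ adj₂.unit ≫ ν.inv ▷ (l₂ ≫ r₂)) ⊗≫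
          l₁ ◁ h ◁ adj₂.counit ▷ r₂ ⊗≫ 𝟙 _ := by
      rw [whisker_exchange]; bicategory
    _ = 𝟙 _ ⊗≫ adj₁.unit ▷ g ⊗≫ l₁ ◁ ν.inv ⊗≫
          l₁ ◁ h ◁ rightZigzag adj₂.unit adj₂.counit ⊗≫ 𝟙 _ := by
      rw [whisker_exchange]; bicategory
    _ = _ := by rw [adj₂.right_triangle]; bicategory

theorem squareMate_counit :
    r₁ ◁ squareMate adj₁ adj₂ ν ≫ (α_ _ _ _).inv ≫ adj₁.counit ▷ h ≫ (λ_ _).hom =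
      (α_ _ _ _).inv ≫ ν.inv ▷ l₂ ≫ (α_ _ _ _).hom ≫ h ◁ adj₂.counit ≫ (ρ_ _).hom := by
  rw [squareMate_eq]
  calc
    _ = 𝟙 _ ⊗≫ r₁ ◁ adj₁.unit ▷ g ▷ l₂ ⊗≫ r₁ ◁ l₁ ◁ ν.inv ▷ l₂ ⊗≫
          ((r₁ ≫ l₁) ◁ (h ◁ adj₂.counit) ≫ adj₁.counit ▷ (h ≫ 𝟙 e₂)) ⊗≫ 𝟙 _ := by bicategory
    _ = 𝟙 _ ⊗≫ r₁ ◁ adj₁.unit ▷ g ▷ l₂ ⊗≫ ((r₁ ≫ l₁) ◁ ν.inv ≫ adj₁.counit ▷ (h ≫ r₂)) ▷ l₂ ⊗≫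
          h ◁ adj₂.counit ⊗≫ 𝟙 _ := by
      rw [whisker_exchange]; bicategory
    _ = 𝟙 _ ⊗≫ rightZigzag adj₁.unit adj₁.counit ▷ g ▷ l₂ ⊗≫ ν.inv ▷ l₂ ⊗≫
          h ◁ adj₂.counit ⊗≫ 𝟙 _ := by
      rw [whisker_exchange]; bicategory
    _ = _ := by rw [adj₁.right_triangle]; bicategory

theorem unit_squareCell : g ◁ adj₂.unit ≫ squareCell adj₁ adj₂ ν =
    (ρ_ _).hom ≫ (λ_ _).inv ≫ adj₁.unit ▷ g := by
  unfold squareCell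
  rw [reassoc_of% unit_squareMate]
  simp

/-- The action of the monad of an adjunction on the right adjoint. -/
abbrev rightAct {b e : H} {l : b ⟶ e} {r : e ⟶ b} (adj : l ⊣ r) : r ≫ l ≫ r ⟶ r :=
  (α_ r l r).inv ≫ adj.counit ▷ r ≫ (λ_ r).hom

/-- The mate exchanges the counits (`squareMate_counit`), hence also the actions on the right
adjoints. The law for multiplications follows from it, since the multiplication is `l` whiskered
with this action. -/
theorem squareCell_rightAct :
    r₁ ◁ squareCell adj₁ adj₂ ν ≫ (α_ _ _ _).inv ≫ rightAct adj₁ ▷ g =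
      (α_ _ _ _).inv ≫ ν.inv ▷ (l₂ ≫ r₂) ≫ (α_ _ _ _).hom ≫ h ◁ rightAct adj₂ ≫ ν.hom := by
  unfold squareCell rightAct
  calc
    _ = 𝟙 _ ⊗≫ r₁ ◁ squareMate adj₁ adj₂ ν ▷ r₂ ⊗≫
          ((r₁ ≫ l₁) ◁ ν.hom ≫ adj₁.counit ▷ (r₁ ≫ g)) ⊗≫ 𝟙 _ := by bicategory
    _ = 𝟙 _ ⊗≫ (r₁ ◁ squareMate adj₁ adj₂ ν ≫ (α_ _ _ _).inv ≫ adj₁.counit ▷ h ≫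
          (λ_ _).hom) ▷ r₂ ⊗≫ ν.hom ⊗≫ 𝟙 _ := by
      rw [whisker_exchange]; bicategory
    _ = _ := by rw [squareMate_counit]; bicategory

theorem squareCell_comp_mul :
    squareCell adj₁ adj₂ ν ▷ (l₂ ≫ r₂) ≫ (α_ _ _ _).hom ≫ (l₁ ≫ r₁) ◁ squareCell adj₁ adj₂ ν ≫
      (α_ _ _ _).inv ≫ ((α_ _ _ _).hom ≫ l₁ ◁ rightAct adj₁) ▷ g =
    (α_ _ _ _).hom ≫ g ◁ ((α_ _ _ _).hom ≫ l₂ ◁ rightAct adj₂) ≫ squareCell adj₁ adj₂ ν := by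
  have e : squareCell adj₁ adj₂ ν ▷ (l₂ ≫ r₂) ≫ (α_ _ _ _).hom ≫
      (l₁ ≫ r₁) ◁ squareCell adj₁ adj₂ ν ≫ (α_ _ _ _).inv ≫
        ((α_ _ _ _).hom ≫ l₁ ◁ rightAct adj₁) ▷ g =
      squareCell adj₁ adj₂ ν ▷ (l₂ ≫ r₂) ⊗≫
        l₁ ◁ (r₁ ◁ squareCell adj₁ adj₂ ν ≫ (α_ _ _ _).inv ≫ rightAct adj₁ ▷ g) ⊗≫ 𝟙 _ := by
    bicategory
  rw [e, squareCell_rightAct]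
  generalize rightAct adj₂ = k
  unfold squareCell
  calc
    _ = 𝟙 _ ⊗≫ squareMate adj₁ adj₂ ν ▷ r₂ ▷ (l₂ ≫ r₂) ⊗≫
          l₁ ◁ (ν.hom ≫ ν.inv) ▷ (l₂ ≫ r₂) ⊗≫ l₁ ◁ h ◁ k ⊗≫ l₁ ◁ ν.hom ⊗≫ 𝟙 _ := by bicategory
    _ = 𝟙 _ ⊗≫ (squareMate adj₁ adj₂ ν ▷ (r₂ ≫ l₂ ≫ r₂) ≫ (l₁ ≫ h) ◁ k) ⊗≫
          l₁ ◁ ν.hom ⊗≫ 𝟙 _ := by rw [Iso.hom_inv_id]; bicategory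
    _ = _ := by rw [← whisker_exchange]; bicategory

theorem squareCell_mul :
    squareCell adj₁ adj₂ ν ▷ (l₂ ≫ r₂) ≫ (α_ _ _ _).hom ≫ (l₁ ≫ r₁) ◁ squareCell adj₁ adj₂ ν ≫
      (α_ _ _ _).inv ≫ (adjMnd adj₁).mul ▷ g =
    (α_ _ _ _).hom ≫ g ◁ (adjMnd adj₂).mul ≫ squareCell adj₁ adj₂ ν :=
  squareCell_comp_mul adj₁ adj₂ ν

/-- Serves twice for `α`: for the 2-cells of the domain, and for the composition constraints of `𝓐`
and `𝓑`. -/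
theorem squareCell_naturality {g' : b₁ ⟶ b₂} {h' : e₁ ⟶ e₂} (ν' : h' ≫ r₂ ≅ r₁ ≫ g')
    (θ : g ⟶ g') (φ : h ⟶ h') (e : φ ▷ r₂ ≫ ν'.hom = ν.hom ≫ r₁ ◁ θ) :
    θ ▷ (l₂ ≫ r₂) ≫ squareCell adj₁ adj₂ ν' = squareCell adj₁ adj₂ ν ≫ (l₁ ≫ r₁) ◁ θ := by
  have e' : r₁ ◁ θ ≫ ν'.inv = ν.inv ≫ φ ▷ r₂ := by
    rw [Iso.comp_inv_eq, Category.assoc, e, Iso.inv_hom_id_assoc]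
  have k : θ ▷ l₂ ≫ squareMate adj₁ adj₂ ν' = squareMate adj₁ adj₂ ν ≫ l₁ ◁ φ := by
    rw [squareMate_eq, squareMate_eq]
    calc
      _ = 𝟙 _ ⊗≫ (𝟙 b₁ ◁ θ ≫ adj₁.unit ▷ g') ▷ l₂ ⊗≫ l₁ ◁ ν'.inv ▷ l₂ ⊗≫
            l₁ ◁ h' ◁ adj₂.counit ⊗≫ 𝟙 _ := by bicategory
      _ = 𝟙 _ ⊗≫ adj₁.unit ▷ g ▷ l₂ ⊗≫ l₁ ◁ (r₁ ◁ θ ≫ ν'.inv) ▷ l₂ ⊗≫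
            l₁ ◁ h' ◁ adj₂.counit ⊗≫ 𝟙 _ := by rw [whisker_exchange]; bicategory
      _ = 𝟙 _ ⊗≫ adj₁.unit ▷ g ▷ l₂ ⊗≫ l₁ ◁ ν.inv ▷ l₂ ⊗≫
            l₁ ◁ (φ ▷ (r₂ ≫ l₂) ≫ h' ◁ adj₂.counit) ⊗≫ 𝟙 _ := by rw [e']; bicategory
      _ = _ := by rw [← whisker_exchange]; bicategory
  unfold squareCell
  calc
    _ = 𝟙 _ ⊗≫ (θ ▷ l₂ ≫ squareMate adj₁ adj₂ ν') ▷ r₂ ⊗≫ l₁ ◁ ν'.hom ⊗≫ 𝟙 _ := by bicategory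
    _ = 𝟙 _ ⊗≫ squareMate adj₁ adj₂ ν ▷ r₂ ⊗≫ l₁ ◁ (φ ▷ r₂ ≫ ν'.hom) ⊗≫ 𝟙 _ := by
      rw [k]; bicategory
    _ = _ := by rw [e]; bicategory

end Squares

/-! ### Pasting of squares -/

section SquareComp

variable {H : Type u} [Bicategory.{w, v} H] {b₁ e₁ b₂ e₂ b₃ e₃ : H} {l₁ : b₁ ⟶ e₁} {r₁ : e₁ ⟶ b₁}
  {l₂ : b₂ ⟶ e₂} {r₂ : e₂ ⟶ b₂} {l₃ : b₃ ⟶ e₃} {r₃ : e₃ ⟶ b₃}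
  (adj₁ : l₁ ⊣ r₁) (adj₂ : l₂ ⊣ r₂) (adj₃ : l₃ ⊣ r₃) {g : b₁ ⟶ b₂} {h : e₁ ⟶ e₂}
  {g' : b₂ ⟶ b₃} {h' : e₂ ⟶ e₃} (ν : h ≫ r₂ ≅ r₁ ≫ g) (ν' : h' ≫ r₃ ≅ r₂ ≫ g')

/-- The pasting of two squares. -/
def squarePaste : (h ≫ h') ≫ r₃ ≅ r₁ ≫ g ≫ g' :=
  α_ _ _ _ ≪≫ whiskerLeftIso h ν' ≪≫ (α_ _ _ _).symm ≪≫ whiskerRightIso ν g' ≪≫ α_ _ _ _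

/-- Mates are compatible with pasting; the rest is an interchange that moves `ν'` past the first
mate. -/
theorem squareCell_paste : squareCell adj₁ adj₃ (squarePaste ν ν') =
    (α_ _ _ _).hom ≫ g ◁ squareCell adj₂ adj₃ ν' ≫ (α_ _ _ _).inv ≫
      squareCell adj₁ adj₂ ν ▷ g' ≫ (α_ _ _ _).hom := by
  have k : squareMate adj₁ adj₃ (squarePaste ν ν') =
      leftAdjointSquare.vcomp (squareMate adj₁ adj₂ ν) (squareMate adj₂ adj₃ ν') := by
    unfold squareMate
    rw [Equiv.symm_apply_eq, Bicategory.mateEquiv_vcomp adj₁ adj₂ adj₃]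
    simp [squarePaste, rightAdjointSquare.vcomp]
  unfold squareCell
  rw [k]
  simp only [leftAdjointSquare.vcomp, squarePaste]
  generalize squareMate adj₁ adj₂ ν = m
  generalize squareMate adj₂ adj₃ ν' = m'
  symm
  calc
    _ = 𝟙 _ ⊗≫ g ◁ m' ▷ r₃ ⊗≫ ((g ≫ l₂) ◁ ν'.hom ≫ m ▷ (r₂ ≫ g')) ⊗≫
          l₁ ◁ ν.hom ▷ g' ⊗≫ 𝟙 _ := by bicategory
    _ = 𝟙 _ ⊗≫ g ◁ m' ▷ r₃ ⊗≫ m ▷ h' ▷ r₃ ⊗≫ l₁ ◁ (h ◁ ν'.hom) ⊗≫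
          l₁ ◁ ν.hom ▷ g' ⊗≫ 𝟙 _ := by rw [whisker_exchange]; bicategory
    _ = _ := by
      simp only [Iso.trans_hom, whiskerLeftIso_hom, whiskerRightIso_hom, Iso.symm_hom]
      bicategory

end SquareComp

/-! ### Pseudonatural monads, their actions and transformations with action -/

section MonadOn

variable {J : Type u₁} [Bicategory.{w₁, v₁} J]

/-- A pseudonatural monad on a `Cat`-valued pseudofunctor. -/
structure MonadOn (Q : J ⥤ᵖ Cat.{w₂, v₂}) where
  monad (x : J) : CategoryTheory.Monad (Q.obj x)
  cell {x y : J} (f : x ⟶ y) (q : Q.obj x) :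
    (monad y).obj ((Q.map f).toFunctor.obj q) ≅ (Q.map f).toFunctor.obj ((monad x).obj q)
  cell_naturality {x y : J} (f : x ⟶ y) {q q' : Q.obj x} (k : q ⟶ q') :
    (monad y).map ((Q.map f).toFunctor.map k) ≫ (cell f q').hom =
      (cell f q).hom ≫ (Q.map f).toFunctor.map ((monad x).map k)
  cell_map₂ {x y : J} {f f' : x ⟶ y} (θ : f ⟶ f') (q : Q.obj x) :
    (monad y).map ((Q.map₂ θ).toNatTrans.app q) ≫ (cell f' q).hom =
      (cell f q).hom ≫ (Q.map₂ θ).toNatTrans.app ((monad x).obj q)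
  cell_unit {x y : J} (f : x ⟶ y) (q : Q.obj x) :
    (monad y).η.app ((Q.map f).toFunctor.obj q) ≫ (cell f q).hom =
      (Q.map f).toFunctor.map ((monad x).η.app q)
  cell_mul {x y : J} (f : x ⟶ y) (q : Q.obj x) :
    (monad y).μ.app ((Q.map f).toFunctor.obj q) ≫ (cell f q).hom =
      (monad y).map (cell f q).hom ≫ (cell f ((monad x).obj q)).hom ≫
        (Q.map f).toFunctor.map ((monad x).μ.app q)
  cell_comp {x y z : J} (f : x ⟶ y) (g : y ⟶ z) (q : Q.obj x) :
    (cell (f ≫ g) q).hom ≫ (Q.mapComp f g).hom.toNatTrans.app ((monad x).obj q) =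
      (monad z).map ((Q.mapComp f g).hom.toNatTrans.app q) ≫
        (cell g ((Q.map f).toFunctor.obj q)).hom ≫ (Q.map g).toFunctor.map (cell f q).hom

theorem MonadOn.cell_map₂_mapComp {Q : J ⥤ᵖ Cat.{w₂, v₂}} (T : MonadOn Q) {x y z : J}
    {f : x ⟶ y} {g : y ⟶ z} {h : x ⟶ z} (η : h ⟶ f ≫ g) (q : Q.obj x) :
    (T.cell h q).hom ≫ (Q.map₂ η).toNatTrans.app ((T.monad x).obj q) ≫
        (Q.mapComp f g).hom.toNatTrans.app ((T.monad x).obj q) =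
      (T.monad z).map ((Q.map₂ η).toNatTrans.app q ≫ (Q.mapComp f g).hom.toNatTrans.app q) ≫
        (T.cell g ((Q.map f).toFunctor.obj q)).hom ≫
          (Q.map g).toFunctor.map (T.cell f q).hom := by
  rw [CategoryTheory.Functor.map_comp, Category.assoc, ← T.cell_comp,
    reassoc_of% T.cell_map₂]

/-- The restriction of a pseudonatural monad along a pseudofunctor. -/
def MonadOn.restrict {K : Type u₂} [Bicategory.{w₂, v₂} K] {Q : K ⥤ᵖ Cat.{w₃, v₃}} (T : MonadOn Q)
    (t : J ⥤ᵖ K) : MonadOn (t.comp Q) where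
  monad x := T.monad (t.obj x)
  cell f q := T.cell (t.map f) q
  cell_naturality f _ _ k := T.cell_naturality (t.map f) k
  cell_map₂ θ q := T.cell_map₂ (t.map₂ θ) q
  cell_unit f q := T.cell_unit (t.map f) q
  cell_mul f q := T.cell_mul (t.map f) q
  cell_comp f g q :=
    T.cell_map₂_mapComp (t.mapComp f g).hom q

/-- An action of a pseudonatural monad on a pseudonatural transformation. -/
structure MonadOn.Action {Q₀ Q : J ⥤ᵖ Cat.{w₂, v₂}} (T : MonadOn Q) (U : Q₀ ⟶ Q) where
  act (x : J) (q : Q₀.obj x) :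
    (T.monad x).obj ((U.app x).toFunctor.obj q) ⟶ (U.app x).toFunctor.obj q
  act_naturality (x : J) {q q' : Q₀.obj x} (k : q ⟶ q') :
    (T.monad x).map ((U.app x).toFunctor.map k) ≫ act x q' =
      act x q ≫ (U.app x).toFunctor.map k
  act_unit (x : J) (q : Q₀.obj x) :
    (T.monad x).η.app ((U.app x).toFunctor.obj q) ≫ act x q = 𝟙 _
  act_assoc (x : J) (q : Q₀.obj x) :
    (T.monad x).μ.app ((U.app x).toFunctor.obj q) ≫ act x q =
      (T.monad x).map (act x q) ≫ act x q
  act_cell {x y : J} (f : x ⟶ y) (q : Q₀.obj x) :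
    (T.monad y).map ((U.naturality f).hom.toNatTrans.app q) ≫
        (T.cell f ((U.app x).toFunctor.obj q)).hom ≫ (Q.map f).toFunctor.map (act x q) =
      act y ((Q₀.map f).toFunctor.obj q) ≫ (U.naturality f).hom.toNatTrans.app q

namespace MonadOn

/-- Restriction of an action. -/
def Action.restrict {K : Type u₂} [Bicategory.{w₂, v₂} K] {Q₀ Q : K ⥤ᵖ Cat.{w₃, v₃}}
    {T : MonadOn Q} {U : Q₀ ⟶ Q} (A : T.Action U) (t : J ⥤ᵖ K) :
    (T.restrict t).Action (whiskerPre t U) where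
  act x q := A.act (t.obj x) q
  act_naturality x _ _ k := A.act_naturality (t.obj x) k
  act_unit x q := A.act_unit (t.obj x) q
  act_assoc x q := A.act_assoc (t.obj x) q
  act_cell f q := A.act_cell (t.map f) q

/-- With `k` a naturality component of `s`, this is the law `act_cell` for the composite `s ≫ U`. -/
theorem Action.act_cell_comp {Q₀ Q : J ⥤ᵖ Cat.{w₂, v₂}} {T : MonadOn Q} {U : Q₀ ⟶ Q}
    (A : T.Action U) {x y : J} (f : x ⟶ y) {q : Q₀.obj x} {q' : Q₀.obj y}
    (k : q' ⟶ (Q₀.map f).toFunctor.obj q) :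
    (T.monad y).map ((U.app y).toFunctor.map k ≫ (U.naturality f).hom.toNatTrans.app q) ≫
        (T.cell f ((U.app x).toFunctor.obj q)).hom ≫ (Q.map f).toFunctor.map (A.act x q) =
      A.act y q' ≫ (U.app y).toFunctor.map k ≫ (U.naturality f).hom.toNatTrans.app q := by
  refine (congrArg (· ≫ _) ((T.monad y).map_comp _ _)).trans ((Category.assoc _ _ _).trans ?_)
  refine (congrArg (_ ≫ ·) (A.act_cell f q)).trans ?_
  rw [reassoc_of% A.act_naturality y k]

/-- Precomposition of an action. -/
def Action.precomp {P Q₀ Q : J ⥤ᵖ Cat.{w₂, v₂}} {T : MonadOn Q} {U : Q₀ ⟶ Q} (A : T.Action U)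
    (s : P ⟶ Q₀) : T.Action (s ≫ U) where
  act x p := A.act x ((s.app x).toFunctor.obj p)
  act_naturality x _ _ k := A.act_naturality x ((s.app x).toFunctor.map k)
  act_unit x p := A.act_unit x ((s.app x).toFunctor.obj p)
  act_assoc x p := A.act_assoc x ((s.app x).toFunctor.obj p)
  act_cell f p := by
    rw [comp_naturality_app]
    exact A.act_cell_comp f ((s.naturality f).hom.toNatTrans.app p)

variable {P Q₀ Q : J ⥤ᵖ Cat.{w₂, v₂}} {T : MonadOn Q}

/-- The functor into the algebras induced by an action. -/
def Action.comparison {U : Q₀ ⟶ Q} (A : T.Action U) (x : J) :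
    Q₀.obj x ⥤ (T.monad x).Algebra where
  obj q := ⟨(U.app x).toFunctor.obj q, A.act x q, A.act_unit x q, A.act_assoc x q⟩
  map k := ⟨(U.app x).toFunctor.map k, A.act_naturality x k⟩

variable (T) (P)

/-- Transformations into `Q` with an action of `T`. -/
structure ActTrans where
  trans : P ⟶ Q
  action : T.Action trans

variable {T} {P}

/-- Modifications compatible with the actions. -/
@[ext]
structure ActTrans.Hom (s s' : ActTrans P T) where
  modification : s.trans ⟶ s'.trans
  comm (x : J) (p : P.obj x) :
    (T.monad x).map ((modification.as.app x).toNatTrans.app p) ≫ s'.action.act x p =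
      s.action.act x p ≫ (modification.as.app x).toNatTrans.app p

theorem homCategory_comp_app {s s' s'' : P ⟶ Q} (m : s ⟶ s') (n : s' ⟶ s'') (x : J)
    (p : P.obj x) : ((m ≫ n).as.app x).toNatTrans.app p =
      (m.as.app x).toNatTrans.app p ≫ (n.as.app x).toNatTrans.app p := rfl

instance : Category (ActTrans P T) where
  Hom s s' := ActTrans.Hom s s'
  id s := ⟨𝟙 s.trans, fun x p => by
    change (T.monad x).map (𝟙 _) ≫ _ = _ ≫ 𝟙 _
    rw [CategoryTheory.Functor.map_id, Category.id_comp, Category.comp_id]⟩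
  comp m n := ⟨m.modification ≫ n.modification, fun x p => by
    rw [homCategory_comp_app, Functor.map_comp, Category.assoc, n.comm, reassoc_of% m.comm]⟩
  id_comp m := ActTrans.Hom.ext (Category.id_comp _)
  comp_id m := ActTrans.Hom.ext (Category.comp_id _)
  assoc l m n := ActTrans.Hom.ext (Category.assoc _ _ _)

/-- Isomorphisms of transformations with action. -/
def ActTrans.isoMk {s s' : ActTrans P T} (i : s.trans ≅ s'.trans)
    (h : ∀ (x : J) (p : P.obj x),
      (T.monad x).map ((i.hom.as.app x).toNatTrans.app p) ≫ s'.action.act x p =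
        s.action.act x p ≫ (i.hom.as.app x).toNatTrans.app p) : s ≅ s' where
  hom := ⟨i.hom, h⟩
  inv := ⟨i.inv, fun x p => by
    have e₁ : (i.hom.as.app x).toNatTrans.app p ≫ (i.inv.as.app x).toNatTrans.app p = 𝟙 _ :=
      Cat_congr_app (congrArg (fun m => m.as.app x) i.hom_inv_id) p
    have e₂ : (i.inv.as.app x).toNatTrans.app p ≫ (i.hom.as.app x).toNatTrans.app p = 𝟙 _ :=
      Cat_congr_app (congrArg (fun m => m.as.app x) i.inv_hom_id) p
    have e₃ := congrArg ((T.monad x).map ((i.inv.as.app x).toNatTrans.app p) ≫ · ≫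
      (i.inv.as.app x).toNatTrans.app p) (h x p)
    simp only [Category.assoc, e₁] at e₃
    rw [← Functor.map_comp_assoc, e₂] at e₃
    simpa using e₃.symm⟩
  hom_inv_id := ActTrans.Hom.ext i.hom_inv_id
  inv_hom_id := ActTrans.Hom.ext i.inv_hom_id

/-- Postcomposition with a transformation with action. -/
def Action.postcomp {U : Q₀ ⟶ Q} (A : T.Action U) (P : J ⥤ᵖ Cat.{w₂, v₂}) :
    (P ⟶ Q₀) ⥤ ActTrans P T where
  obj s := ⟨s ≫ U, A.precomp s⟩
  map m := ⟨m ▷ U, fun x p => A.act_naturality x ((m.as.app x).toNatTrans.app p)⟩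
  map_id s := ActTrans.Hom.ext (id_whiskerRight s U)
  map_comp m n := ActTrans.Hom.ext (comp_whiskerRight m n U)

variable {U : Q₀ ⟶ Q} (A : T.Action U)

theorem Action.faithful_app {x : J} (h : (A.comparison x).Faithful) :
    (U.app x).toFunctor.Faithful :=
  have : (A.comparison x ⋙ (T.monad x).forget).Faithful := inferInstance
  this

theorem faithfulCell_of_faithful {C D : Cat.{w₂, v₂}} {f : C ⟶ D} (hf : f.toFunctor.Faithful) :
    FaithfulCell f := fun _ => ⟨fun e =>
  Cat.Hom₂.ext (NatTrans.ext (funext fun c => hf.map_injective (Cat_congr_app e c)))⟩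

theorem Action.postcomp_faithful (h : ∀ x, (A.comparison x).Faithful) :
    (A.postcomp P).Faithful where
  map_injective e :=
    (faithful_postcomp U (fun x => faithfulCell_of_faithful (A.faithful_app (h x)))
      P).map_injective (congrArg ActTrans.Hom.modification e)

/-- The components of a morphism in `ActTrans` are morphisms of algebras, so they lift through the
comparisons. The lifts are natural and form a modification because `U` is componentwise faithful. -/
theorem Action.postcomp_full (h : ∀ x, (A.comparison x).Faithful)
    (h' : ∀ x, (A.comparison x).Full) : (A.postcomp P).Full where
  map_surjective {s s'} m := by
    have e (x : J) (p : P.obj x) : ∃ n : (s.app x).toFunctor.obj p ⟶ (s'.app x).toFunctor.obj p,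
        (U.app x).toFunctor.map n = (m.modification.as.app x).toNatTrans.app p := by
      obtain ⟨n, hn⟩ := (A.comparison x).map_surjective
        (X := (s.app x).toFunctor.obj p) (Y := (s'.app x).toFunctor.obj p)
        ⟨(m.modification.as.app x).toNatTrans.app p, m.comm x p⟩
      exact ⟨n, congrArg Monad.Algebra.Hom.f hn⟩
    choose n hn using e
    refine ⟨liftModification U (fun x => faithfulCell_of_faithful (A.faithful_app (h x)))
      m.modification (fun x => ⟨⟨n x, fun p p' k => (A.faithful_app (h x)).map_injective ?_⟩⟩)
      (fun x => Cat.Hom₂.ext (NatTrans.ext (funext fun p => hn x p))), ?_⟩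
    · rw [Functor.map_comp, Functor.map_comp, hn, hn]
      exact (m.modification.as.app x).toNatTrans.naturality k
    · exact ActTrans.Hom.ext (Pseudofunctor.StrongTrans.homCategory.ext fun x =>
        Cat.Hom₂.ext (NatTrans.ext (funext fun p => hn x p)))

end MonadOn

end MonadOn

namespace MonadOn

/-! ### Lifting a transformation with action through componentwise equivalences -/

section EssSurj

variable {J : Type u₁} [Bicategory.{w₁, v₁} J] {P Q₀ Q : J ⥤ᵖ Cat.{w₂, v₂}} {T : MonadOn Q}
  {S : P ⟶ Q} {U : Q₀ ⟶ Q} (B : T.Action S) (A : T.Action U)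

/-- The invertible 2-cell in `Q` underlying the naturality of a lift along `U`. -/
def squareIso {x y : J} (g : x ⟶ y) {p : P.obj x} {q : Q₀.obj x} {q' : Q₀.obj y}
    (i : (U.app x).toFunctor.obj q ≅ (S.app x).toFunctor.obj p)
    (i' : (U.app y).toFunctor.obj q' ≅
      (S.app y).toFunctor.obj ((P.map g).toFunctor.obj p)) :
    (U.app y).toFunctor.obj q' ≅ (U.app y).toFunctor.obj ((Q₀.map g).toFunctor.obj q) :=
  i' ≪≫ naturalityAt S g p ≪≫ (Q.map g).toFunctor.mapIso i.symm ≪≫ (naturalityAt U g q).symm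

/-- Each of the four factors of `squareIso` respects the actions: `i'` and `i` by hypothesis, the
two naturality cells by `act_cell`. -/
theorem act_squareIso {x y : J} (g : x ⟶ y) {p : P.obj x} {q : Q₀.obj x} {q' : Q₀.obj y}
    (i : (U.app x).toFunctor.obj q ≅ (S.app x).toFunctor.obj p)
    (i' : (U.app y).toFunctor.obj q' ≅
      (S.app y).toFunctor.obj ((P.map g).toFunctor.obj p))
    (hi : (T.monad x).map i.hom ≫ B.act x p = A.act x q ≫ i.hom)
    (hi' : (T.monad y).map i'.hom ≫ B.act y _ = A.act y q' ≫ i'.hom) :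
    (T.monad y).map (squareIso g i i').hom ≫ A.act y _ = A.act y q' ≫ (squareIso g i i').hom := by
  have h₁ : (T.monad y).map (naturalityAt S g p).hom ≫ (T.cell g _).hom ≫
      (Q.map g).toFunctor.map (B.act x p) = B.act y _ ≫ (naturalityAt S g p).hom := B.act_cell g p
  have h₂ : (T.monad y).map (naturalityAt U g q).hom ≫ (T.cell g _).hom ≫
      (Q.map g).toFunctor.map (A.act x q) = A.act y _ ≫ (naturalityAt U g q).hom := A.act_cell g q
  have h₃ : (T.monad y).map (naturalityAt U g q).inv ≫ A.act y _ = (T.cell g _).hom ≫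
      (Q.map g).toFunctor.map (A.act x q) ≫ (naturalityAt U g q).inv := by
    rw [← cancel_epi ((T.monad y).map (naturalityAt U g q).hom), reassoc_of% h₂,
      ← CategoryTheory.Functor.map_comp_assoc]
    simp
  have h₄ : (T.monad x).map i.inv ≫ A.act x q = B.act x p ≫ i.inv := by
    rw [← cancel_epi ((T.monad x).map i.hom), reassoc_of% hi,
      ← CategoryTheory.Functor.map_comp_assoc]
    simp
  simp only [squareIso, Iso.trans_hom, Functor.mapIso_hom, Iso.symm_hom,
    CategoryTheory.Functor.map_comp, Category.assoc]
  rw [h₃, reassoc_of% T.cell_naturality g i.inv, ← (Q.map g).toFunctor.map_comp_assoc, h₄,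
    (Q.map g).toFunctor.map_comp_assoc, reassoc_of% h₁, reassoc_of% hi']

theorem Action.postcomp_essSurj (h : ∀ x, (A.comparison x).IsEquivalence) :
    (A.postcomp P).EssSurj := ⟨fun ⟨S, B⟩ => by
  have hU (x : J) : (U.app x).toFunctor.Faithful := A.faithful_app inferInstance
  -- The lift is chosen objectwise by inverting the comparisons. Its naturality cells `n` come from
  -- isomorphisms of algebras, and faithfulness of `U` gives the coherence.
  let s (x : J) : P.obj x ⟶ Q₀.obj x := Cat.Hom.ofFunctor (B.comparison x ⋙ (A.comparison x).inv)
  let i (x : J) (p : P.obj x) :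
      (A.comparison x).obj ((s x).toFunctor.obj p) ≅ (B.comparison x).obj p :=
    (A.comparison x).asEquivalence.counitIso.app ((B.comparison x).obj p)
  let i₀ (x : J) (p : P.obj x) :
      (U.app x).toFunctor.obj ((s x).toFunctor.obj p) ≅ (S.app x).toFunctor.obj p :=
    (T.monad x).forget.mapIso (i x p)
  have hi (x : J) (p : P.obj x) : (T.monad x).map (i₀ x p).hom ≫ B.act x p =
      A.act x ((s x).toFunctor.obj p) ≫ (i₀ x p).hom := (i x p).hom.h
  let j (x : J) : s x ≫ U.app x ≅ S.app x := catIso (NatIso.ofComponents (i₀ x) (fun {p p'} k =>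
    congrArg Monad.Algebra.Hom.f
      ((A.comparison x).asEquivalence.counitIso.hom.naturality ((B.comparison x).map k))))
  let k {x y : J} (g : x ⟶ y) : (P.map g ≫ s y) ≫ U.app y ≅ (s x ≫ Q₀.map g) ≫ U.app y :=
    α_ _ _ _ ≪≫ whiskerLeftIso (P.map g) (j y) ≪≫ S.naturality g ≪≫
      whiskerRightIso (j x).symm (Q.map g) ≪≫ α_ _ _ _ ≪≫
      whiskerLeftIso (s x) (U.naturality g).symm ≪≫ (α_ _ _ _).symm
  let m {x y : J} (g : x ⟶ y) (p : P.obj x) :=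
    squareIso g (i₀ x p) (i₀ y ((P.map g).toFunctor.obj p))
  have hk {x y : J} (g : x ⟶ y) (p : P.obj x) : (k g).hom.toNatTrans.app p = (m g p).hom := by
    change 𝟙 _ ≫ (i₀ y _).hom ≫ (naturalityAt S g p).hom ≫ (Q.map g).toFunctor.map (i₀ x p).inv ≫
      𝟙 _ ≫ (naturalityAt U g _).inv ≫ 𝟙 _ = (i₀ y _).hom ≫ (naturalityAt S g p).hom ≫
        (Q.map g).toFunctor.map (i₀ x p).inv ≫ (naturalityAt U g _).inv
    rw [Category.id_comp, Category.id_comp, Category.comp_id]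
  have hn (x y : J) (g : x ⟶ y) (p : P.obj x) :
      ∃ n : (s y).toFunctor.obj ((P.map g).toFunctor.obj p) ≅
        (Q₀.map g).toFunctor.obj ((s x).toFunctor.obj p),
        (U.app y).toFunctor.map n.hom = (m g p).hom := by
    let e : (A.comparison y).obj ((s y).toFunctor.obj ((P.map g).toFunctor.obj p)) ≅
        (A.comparison y).obj ((Q₀.map g).toFunctor.obj ((s x).toFunctor.obj p)) :=
      Monad.Algebra.isoMk (m g p) (act_squareIso B A g _ _ (hi x p) (hi y _))
    exact ⟨(A.comparison y).preimageIso e,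
      congrArg Monad.Algebra.Hom.f ((A.comparison y).map_preimage e.hom)⟩
  choose n hn using hn
  let ν {x y : J} (g : x ⟶ y) : P.map g ≫ s y ≅ s x ≫ Q₀.map g :=
    catIso (NatIso.ofComponents (n x y g) (fun {p p'} l => (hU y).map_injective (by
      refine ((U.app y).toFunctor.map_comp _ _).trans (Eq.trans ?_
        ((U.app y).toFunctor.map_comp _ _).symm)
      rw [hn, hn, ← hk, ← hk]
      exact (k g).hom.toNatTrans.naturality l)))
  exact ⟨liftTrans U (fun x => faithfulCell_of_faithful (hU x)) S s j ν (fun g =>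
      Cat.Hom₂.ext (NatTrans.ext (funext fun p => (hn _ _ g p).trans (hk g p).symm))),
    ⟨ActTrans.isoMk (liftTransComp _ _ _ _ _ _ _) hi⟩⟩⟩

theorem Action.postcomp_isEquivalence (h : ∀ x, (A.comparison x).IsEquivalence) :
    (A.postcomp P).IsEquivalence where
  faithful := A.postcomp_faithful fun _ => inferInstance
  full := A.postcomp_full (fun _ => inferInstance) fun _ => inferInstance
  essSurj := A.postcomp_essSurj h

end EssSurj

end MonadOn

namespace MonadOn

/-- The components of an isomorphism of transformations of `Cat`-valued pseudofunctors. -/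
def isoAt {J : Type u₁} [Bicategory.{w₁, v₁} J] {P Q : J ⥤ᵖ Cat.{w₂, v₂}} {s s' : P ⟶ Q}
    (i : s ≅ s') (x : J) (p : P.obj x) : (s.app x).toFunctor.obj p ≅ (s'.app x).toFunctor.obj p :=
  ⟨(i.hom.as.app x).toNatTrans.app p, (i.inv.as.app x).toNatTrans.app p,
    Cat_congr_app (congrArg (fun m => m.as.app x) i.hom_inv_id) p,
    Cat_congr_app (congrArg (fun m => m.as.app x) i.inv_hom_id) p⟩

/-! ### Descent for algebras of a pseudonatural monad -/

section AlgebraDescent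

variable {K : Type u₂} [Bicategory.{w, v} K] {Q₀ Q : K ⥤ᵖ Cat.{w, v}} (T : MonadOn Q) {c : K}

/-- The action on the values of `Q` at the transports of an algebra. -/
def algebraAct (M : (T.monad c).Algebra) {x : K} (f : c ⟶ x) :
    (T.monad x).obj ((Q.map f).toFunctor.obj M.A) ⟶ (Q.map f).toFunctor.obj M.A :=
  (T.cell f M.A).hom ≫ (Q.map f).toFunctor.map M.a

theorem algebraAct_map₂ (M : (T.monad c).Algebra) {x : K} {f f' : c ⟶ x} (θ : f ⟶ f') :
    (T.monad x).map ((Q.map₂ θ).toNatTrans.app M.A) ≫ T.algebraAct M f' =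
      T.algebraAct M f ≫ (Q.map₂ θ).toNatTrans.app M.A := by
  have h : (Q.map₂ θ).toNatTrans.app _ ≫ (Q.map f').toFunctor.map M.a =
      (Q.map f).toFunctor.map M.a ≫ (Q.map₂ θ).toNatTrans.app M.A :=
    ((Q.map₂ θ).toNatTrans.naturality M.a).symm
  unfold algebraAct
  rw [reassoc_of% T.cell_map₂, h, Category.assoc]

theorem algebraAct_unit (M : (T.monad c).Algebra) {x : K} (f : c ⟶ x) :
    (T.monad x).η.app ((Q.map f).toFunctor.obj M.A) ≫ T.algebraAct M f = 𝟙 _ := by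
  unfold algebraAct
  rw [reassoc_of% T.cell_unit, ← (Q.map f).toFunctor.map_comp, M.unit,
    CategoryTheory.Functor.map_id]
  rfl

theorem algebraAct_assoc (M : (T.monad c).Algebra) {x : K} (f : c ⟶ x) :
    (T.monad x).μ.app ((Q.map f).toFunctor.obj M.A) ≫ T.algebraAct M f =
      (T.monad x).map (T.algebraAct M f) ≫ T.algebraAct M f := by
  unfold algebraAct
  rw [reassoc_of% T.cell_mul, ← (Q.map f).toFunctor.map_comp, M.assoc,
    (Q.map f).toFunctor.map_comp, (T.monad x).map_comp, Category.assoc,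
    reassoc_of% T.cell_naturality]

theorem algebraAct_mapComp (M : (T.monad c).Algebra) {x y : K} (f : c ⟶ x) (g : x ⟶ y) :
    (T.monad y).map ((Q.mapComp f g).hom.toNatTrans.app M.A) ≫
        (T.cell g ((Q.map f).toFunctor.obj M.A)).hom ≫
          (Q.map g).toFunctor.map (T.algebraAct M f) =
      T.algebraAct M (f ≫ g) ≫ (Q.mapComp f g).hom.toNatTrans.app M.A := by
  unfold algebraAct
  rw [(Q.map g).toFunctor.map_comp, ← reassoc_of% T.cell_comp, Category.assoc,
    mapComp_naturality_app]

theorem algebraAct_map {M N : (T.monad c).Algebra} (k : M ⟶ N) {x : K} (f : c ⟶ x) :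
    (T.monad x).map ((Q.map f).toFunctor.map k.f) ≫ T.algebraAct N f =
      T.algebraAct M f ≫ (Q.map f).toFunctor.map k.f := by
  unfold algebraAct
  rw [reassoc_of% T.cell_naturality, ← (Q.map f).toFunctor.map_comp, k.h,
    (Q.map f).toFunctor.map_comp, Category.assoc]

/-- The action on the transformation that corresponds to an algebra. -/
def yonedaAction (M : (T.monad c).Algebra) : T.Action (yonedaObj Q M.A) where
  act _ f := T.algebraAct M f
  act_naturality _ _ _ θ := T.algebraAct_map₂ M θ
  act_unit _ f := T.algebraAct_unit M f
  act_assoc _ f := T.algebraAct_assoc M f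
  act_cell g f := T.algebraAct_mapComp M f g

variable {J : Type u₁} [Bicategory.{w, v} J] (t : J ⥤ᵖ K)

/-- The descent functor on algebras. -/
def algebraDescentFunctor (c : K) :
    (T.monad c).Algebra ⥤ ActTrans (t.comp (corepresentable c)) (T.restrict t) where
  obj M := ⟨(descentFunctor t Q c).obj M.A, (T.yonedaAction M).restrict t⟩
  map k := ⟨(descentFunctor t Q c).map k.f, fun _ f => T.algebraAct_map k f⟩
  map_id M := ActTrans.Hom.ext ((descentFunctor t Q c).map_id M.A)
  map_comp k l := ActTrans.Hom.ext ((descentFunctor t Q c).map_comp k.f l.f)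

variable {T} {U : Q₀ ⟶ Q} (A : T.Action U)

theorem descentFunctorComp_app (U : Q₀ ⟶ Q) (q : Q₀.obj c) (x : J) (f : c ⟶ t.obj x) :
    (((descentFunctorComp t U c).hom.app q).as.app x).toNatTrans.app f =
      (U.naturality f).hom.toNatTrans.app q :=
  Category.id_comp _

theorem act_descentFunctorComp (q : Q₀.obj c) (x : J) (f : c ⟶ t.obj x) :
    (T.monad _).map ((((descentFunctorComp t U c).hom.app q).as.app x).toNatTrans.app f) ≫
        T.algebraAct ((A.comparison c).obj q) f =
      A.act (t.obj x) ((Q₀.map f).toFunctor.obj q) ≫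
        (((descentFunctorComp t U c).hom.app q).as.app x).toNatTrans.app f := by
  rw [descentFunctorComp_app]
  exact A.act_cell f q

/-- The comparison functors commute with the descent functors. -/
def comparisonDescentIso (c : K) :
    descentFunctor t Q₀ c ⋙ (A.restrict t).postcomp (t.comp (corepresentable c)) ≅
      A.comparison c ⋙ T.algebraDescentFunctor t c :=
  NatIso.ofComponents
    (fun q => ActTrans.isoMk ((descentFunctorComp t U c).app q) (act_descentFunctorComp t A q))
    (fun k => ActTrans.Hom.ext ((descentFunctorComp t U c).hom.naturality k))

theorem algebraDescentFunctor_faithful (h : (descentFunctor t Q c).Faithful) :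
    (T.algebraDescentFunctor t c).Faithful where
  map_injective e := Monad.Algebra.Hom.ext
    (h.map_injective (congrArg ActTrans.Hom.modification e))

/-- Equations in `Q c` may be tested after transport to the objects `t.obj x`; the algebra laws
below are checked in this way. -/
theorem descentFunctor_ext (h : (descentFunctor t Q c).Faithful) {q q' : Q.obj c} {k l : q ⟶ q'}
    (e : ∀ (x : J) (f : c ⟶ t.obj x), (Q.map f).toFunctor.map k = (Q.map f).toFunctor.map l) :
    k = l :=
  h.map_injective (Pseudofunctor.StrongTrans.homCategory.ext fun x =>
    Cat.Hom₂.ext (NatTrans.ext (funext fun f => e x f)))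

theorem algebraDescentFunctor_full (h : (descentFunctor t Q c).Faithful)
    (h' : (descentFunctor t Q c).Full) : (T.algebraDescentFunctor t c).Full where
  map_surjective {M N} m := by
    obtain ⟨k, hk⟩ := h'.map_surjective m.modification
    refine ⟨⟨k, descentFunctor_ext t h fun x f => ?_⟩, ActTrans.Hom.ext hk⟩
    have e : (T.monad _).map ((Q.map f).toFunctor.map k) ≫ T.algebraAct N f =
        T.algebraAct M f ≫ (Q.map f).toFunctor.map k := by
      have e' := m.comm x f
      rw [← hk] at e'
      exact e'
    unfold algebraAct at e
    -- Cancelling the invertible cell leaves the image under `Q.map f` of the law of a morphism of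
    -- algebras.
    rw [reassoc_of% T.cell_naturality, Category.assoc, cancel_epi] at e
    rw [(Q.map f).toFunctor.map_comp, (Q.map f).toFunctor.map_comp, e]

/-- Transport of an action along an isomorphism. -/
def Action.ofIso {V : Q₀ ⟶ Q} (i : V ≅ U) : T.Action V where
  act x q := (T.monad x).map (isoAt i x q).hom ≫ A.act x q ≫ (isoAt i x q).inv
  act_naturality x q q' k := by
    have h₁ : (V.app x).toFunctor.map k ≫ (isoAt i x q').hom =
        (isoAt i x q).hom ≫ (U.app x).toFunctor.map k :=
      (i.hom.as.app x).toNatTrans.naturality k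
    have h₂ : (U.app x).toFunctor.map k ≫ (isoAt i x q').inv =
        (isoAt i x q).inv ≫ (V.app x).toFunctor.map k :=
      (i.inv.as.app x).toNatTrans.naturality k
    rw [← CategoryTheory.Functor.map_comp_assoc, h₁, CategoryTheory.Functor.map_comp_assoc,
      reassoc_of% A.act_naturality, h₂]
    simp only [Category.assoc]
  act_unit x q := by
    have h : (isoAt i x q).hom ≫ (T.monad x).η.app ((U.app x).toFunctor.obj q) =
        (T.monad x).η.app ((V.app x).toFunctor.obj q) ≫ (T.monad x).map (isoAt i x q).hom :=
      (T.monad x).η.naturality (isoAt i x q).hom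
    rw [← reassoc_of% h, reassoc_of% A.act_unit, Iso.hom_inv_id]
    rfl
  act_assoc x q := by
    have h : (T.monad x).map ((T.monad x).map (isoAt i x q).hom) ≫
          (T.monad x).μ.app ((U.app x).toFunctor.obj q) =
        (T.monad x).μ.app ((V.app x).toFunctor.obj q) ≫ (T.monad x).map (isoAt i x q).hom :=
      (T.monad x).μ.naturality (isoAt i x q).hom
    rw [← reassoc_of% h, reassoc_of% A.act_assoc]
    simp only [CategoryTheory.Functor.map_comp, Category.assoc]
    rw [← CategoryTheory.Functor.map_comp_assoc _ (isoAt i x q).inv, Iso.inv_hom_id,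
      CategoryTheory.Functor.map_id, Category.id_comp]
  act_cell {x y} f q := by
    have h₁ : (V.naturality f).hom.toNatTrans.app q ≫
        (Q.map f).toFunctor.map (isoAt i x q).hom =
          (isoAt i y ((Q₀.map f).toFunctor.obj q)).hom ≫ (U.naturality f).hom.toNatTrans.app q :=
      (modification_naturality_app i.hom f q).symm
    have h₂ : (U.naturality f).hom.toNatTrans.app q ≫
        (Q.map f).toFunctor.map (isoAt i x q).inv =
          (isoAt i y ((Q₀.map f).toFunctor.obj q)).inv ≫ (V.naturality f).hom.toNatTrans.app q :=
      (modification_naturality_app i.inv f q).symm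
    have h₃ : (T.monad y).map ((U.naturality f).hom.toNatTrans.app q) ≫
        (T.cell f ((U.app x).toFunctor.obj q)).hom ≫ (Q.map f).toFunctor.map (A.act x q) =
      A.act y ((Q₀.map f).toFunctor.obj q) ≫ (U.naturality f).hom.toNatTrans.app q :=
      A.act_cell f q
    rw [(Q.map f).toFunctor.map_comp, (Q.map f).toFunctor.map_comp,
      ← reassoc_of% T.cell_naturality, ← CategoryTheory.Functor.map_comp_assoc]
    refine (congrArg (fun k => (T.monad y).map k ≫ (T.cell f ((U.app x).toFunctor.obj q)).hom ≫
      (Q.map f).toFunctor.map (A.act x q) ≫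
        (Q.map f).toFunctor.map (isoAt i x q).inv) h₁).trans ?_
    rw [CategoryTheory.Functor.map_comp_assoc, reassoc_of% h₃, h₂]
    simp only [Category.assoc]

section EssSurj

variable {z : Q.obj c} (b : ∀ {x : J} (f : c ⟶ t.obj x),
    (T.monad (t.obj x)).obj ((Q.map f).toFunctor.obj z) ⟶ (Q.map f).toFunctor.obj z)
  (h₁ : ∀ {x : J} {f f' : c ⟶ t.obj x} (θ : f ⟶ f'),
    (T.monad (t.obj x)).map ((Q.map₂ θ).toNatTrans.app z) ≫ b f' =
      b f ≫ (Q.map₂ θ).toNatTrans.app z)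
  (h₂ : ∀ {x y : J} (g : x ⟶ y) (f : c ⟶ t.obj x),
    (T.monad (t.obj y)).map ((Q.mapComp f (t.map g)).hom.toNatTrans.app z) ≫
        (T.cell (t.map g) ((Q.map f).toFunctor.obj z)).hom ≫
          (Q.map (t.map g)).toFunctor.map (b f) =
      b (f ≫ t.map g) ≫ (Q.mapComp f (t.map g)).hom.toNatTrans.app z)

/-- The modification that transports an action on the descent datum of `z`. -/
def actModification :
    (descentFunctor t Q c).obj ((T.monad c).obj z) ⟶ (descentFunctor t Q c).obj z :=
  have e₁ {x : J} {f f' : c ⟶ t.obj x} (θ : f ⟶ f') :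
      (Q.map₂ θ).toNatTrans.app ((T.monad c).obj z) ≫ (T.cell f' z).inv ≫ b f' =
        ((T.cell f z).inv ≫ b f) ≫ (Q.map₂ θ).toNatTrans.app z := by
    rw [Category.assoc, ← h₁, ← cancel_epi (T.cell f z).hom, ← reassoc_of% T.cell_map₂,
      Iso.hom_inv_id_assoc, Iso.hom_inv_id_assoc]
  have e₂ {x y : J} (g : x ⟶ y) (f : c ⟶ t.obj x) :
      ((T.cell (f ≫ t.map g) z).inv ≫ b (f ≫ t.map g)) ≫
          (Q.mapComp f (t.map g)).hom.toNatTrans.app z =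
        (Q.mapComp f (t.map g)).hom.toNatTrans.app ((T.monad c).obj z) ≫
          (Q.map (t.map g)).toFunctor.map ((T.cell f z).inv ≫ b f) := by
    rw [Category.assoc, ← h₂, ← cancel_epi (T.cell (f ≫ t.map g) z).hom,
      Iso.hom_inv_id_assoc, reassoc_of% T.cell_comp, ← (Q.map (t.map g)).toFunctor.map_comp,
      Iso.hom_inv_id_assoc]
  -- Invertibility of the cells is essential: their inverses turn an action on the transports of `z`
  -- into a morphism from the descent datum of `T z`, to which fullness can be applied.
  catModification (s := (descentFunctor t Q c).obj ((T.monad c).obj z))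
    (s' := (descentFunctor t Q c).obj z) (fun _ f => (T.cell f z).inv ≫ b f)
    (fun _ {_ _} θ => e₁ θ) (fun g f => e₂ g f)

/-- The algebra that corresponds to an action on the descent datum of `z`. -/
theorem exists_algebra
    (h₁ : ∀ {x : J} {f f' : c ⟶ t.obj x} (θ : f ⟶ f'),
      (T.monad (t.obj x)).map ((Q.map₂ θ).toNatTrans.app z) ≫ b f' =
        b f ≫ (Q.map₂ θ).toNatTrans.app z)
    (h₂ : ∀ {x y : J} (g : x ⟶ y) (f : c ⟶ t.obj x),
      (T.monad (t.obj y)).map ((Q.mapComp f (t.map g)).hom.toNatTrans.app z) ≫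
          (T.cell (t.map g) ((Q.map f).toFunctor.obj z)).hom ≫
            (Q.map (t.map g)).toFunctor.map (b f) =
        b (f ≫ t.map g) ≫ (Q.mapComp f (t.map g)).hom.toNatTrans.app z)
    (h₃ : ∀ {x : J} (f : c ⟶ t.obj x),
      (T.monad (t.obj x)).η.app ((Q.map f).toFunctor.obj z) ≫ b f = 𝟙 _)
    (h₄ : ∀ {x : J} (f : c ⟶ t.obj x),
      (T.monad (t.obj x)).μ.app ((Q.map f).toFunctor.obj z) ≫ b f =
        (T.monad (t.obj x)).map (b f) ≫ b f)
    (hf : (descentFunctor t Q c).Faithful) (hf' : (descentFunctor t Q c).Full) :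
    ∃ (a : (T.monad c).obj z ⟶ z) (e₁ : (T.monad c).η.app z ≫ a = 𝟙 z)
      (e₂ : (T.monad c).μ.app z ≫ a = (T.monad c).map a ≫ a),
      ∀ (x : J) (f : c ⟶ t.obj x), T.algebraAct ⟨z, a, e₁, e₂⟩ f = b f := by
  obtain ⟨a, ha⟩ := hf'.map_surjective (actModification t b h₁ h₂)
  have ha (x : J) (f : c ⟶ t.obj x) : (T.cell f z).hom ≫ (Q.map f).toFunctor.map a = b f := by
    have e : (Q.map f).toFunctor.map a = (T.cell f z).inv ≫ b f :=
      Cat_congr_app (congrArg (fun m => m.as.app x) ha) f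
    rw [e, Iso.hom_inv_id_assoc]
  refine ⟨a, descentFunctor_ext t hf fun x f => ?_, descentFunctor_ext t hf fun x f => ?_, ha⟩
  · rw [(Q.map f).toFunctor.map_comp, ← T.cell_unit, Category.assoc, ha, h₃]
    exact ((Q.map f).toFunctor.map_id z).symm
  · rw [(Q.map f).toFunctor.map_comp, (Q.map f).toFunctor.map_comp,
      ← cancel_epi (T.cell f ((T.monad c).obj z)).hom,
      ← cancel_epi ((T.monad (t.obj x)).map (T.cell f z).hom), ← reassoc_of% T.cell_mul, ha,
      ← reassoc_of% T.cell_naturality, ha, ← CategoryTheory.Functor.map_comp_assoc, ha, h₄]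

end EssSurj

/-- For essential surjectivity, the underlying datum descends to an object `z`, the action is
carried to the datum of `z`, and full faithfulness descends it to an algebra structure on `z`. -/
theorem algebraDescentFunctor_isEquivalence (h : (descentFunctor t Q c).IsEquivalence) :
    (T.algebraDescentFunctor t c).IsEquivalence where
  faithful := algebraDescentFunctor_faithful t inferInstance
  full := algebraDescentFunctor_full t inferInstance inferInstance
  essSurj := ⟨fun ⟨S, B⟩ => by
    let i := (descentFunctor t Q c).objObjPreimageIso S
    let B' := B.ofIso i
    obtain ⟨a, h₁, h₂, e⟩ := exists_algebra t (fun {x} f => B'.act x f)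
      (fun {x f f'} θ => B'.act_naturality x θ) (fun g f => B'.act_cell g f)
      (fun {x} f => B'.act_unit x f) (fun {x} f => B'.act_assoc x f) inferInstance inferInstance
    refine ⟨⟨_, a, h₁, h₂⟩, ⟨ActTrans.isoMk i fun x f => Eq.symm ?_⟩⟩
    refine (congrArg (· ≫ (isoAt i x f).hom) (e x f)).trans ((Category.assoc _ _ _).trans ?_)
    exact congrArg (_ ≫ ·) ((Category.assoc _ _ _).trans
      ((congrArg (_ ≫ ·) (isoAt i x f).inv_hom_id).trans (Category.comp_id _)))⟩

end AlgebraDescent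

/-! ### The square of comparison and descent functors -/

section Descent

variable {K : Type u₂} [Bicategory.{w, v} K] {Q₀ Q : K ⥤ᵖ Cat.{w, v}} {T : MonadOn Q}
  {U : Q₀ ⟶ Q} (A : T.Action U) {J : Type u₁} [Bicategory.{w, v} J] (t : J ⥤ᵖ K)

/-- The core of the theorem in `Cat`. In the square `comparisonDescentIso`, `hA` makes
postcomposition an equivalence, and the hypothesis on `Q` passes to the descent functor on algebras;
the transfer lemmas apply to the other two sides. -/
theorem Action.comparison_iff_descentFunctor (hA : ∀ x, (A.comparison (t.obj x)).IsEquivalence)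
    (c : K) :
    ((descentFunctor t Q c).Faithful →
      ((A.comparison c).Faithful ↔ (descentFunctor t Q₀ c).Faithful)) ∧
    ((descentFunctor t Q c).Full ∧ (descentFunctor t Q c).Faithful →
      ((A.comparison c).Full ∧ (A.comparison c).Faithful ↔
        (descentFunctor t Q₀ c).Full ∧ (descentFunctor t Q₀ c).Faithful)) ∧
    ((descentFunctor t Q c).IsEquivalence →
      ((A.comparison c).IsEquivalence ↔ (descentFunctor t Q₀ c).IsEquivalence)) := by
  have := (A.restrict t).postcomp_isEquivalence (P := t.comp (corepresentable c)) hA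
  let i := comparisonDescentIso t A c
  have h₁ (h : (descentFunctor t Q c).Faithful) :
      (A.comparison c).Faithful ↔ (descentFunctor t Q₀ c).Faithful :=
    (faithful_iff_of_iso inferInstance (algebraDescentFunctor_faithful t h) i).symm
  refine ⟨h₁, fun h => and_congr ?_ (h₁ h.2), fun h =>
    (isEquivalence_iff_of_iso inferInstance (algebraDescentFunctor_isEquivalence t h) i).symm⟩
  have := algebraDescentFunctor_faithful (T := T) t h.2
  have := algebraDescentFunctor_full (T := T) t h.2 h.1
  exact (full_iff_of_iso (.ofFullyFaithful _) (.ofFullyFaithful _) i).symm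

end Descent

end MonadOn

/-! ### Components at a 1-cell of the 2-cells between monads -/

section CellAt

variable {H : Type u} [Bicategory.{w, v} H] {W b b' b'' : H} {T : b ⟶ b} {T' : b' ⟶ b'}
  {T'' : b'' ⟶ b''} {g : b ⟶ b'}

/-- The component at a 1-cell `z` of a 2-cell `g T' ⟶ T g`. -/
def cellAt (z : W ⟶ b) (β : g ≫ T' ⟶ T ≫ g) : (z ≫ g) ≫ T' ⟶ (z ≫ T) ≫ g :=
  (α_ z g T').hom ≫ z ◁ β ≫ (α_ z T g).inv

/-- The component of an invertible 2-cell. -/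
noncomputable def cellIsoAt (z : W ⟶ b) (β : g ≫ T' ⟶ T ≫ g) (hβ : IsIso β) :
    (z ≫ g) ≫ T' ≅ (z ≫ T) ≫ g :=
  α_ z g T' ≪≫ whiskerLeftIso z (asIso β) ≪≫ (α_ z T g).symm

theorem cellAt_naturality (β : g ≫ T' ⟶ T ≫ g) {z z' : W ⟶ b} (k : z ⟶ z') :
    (k ▷ g) ▷ T' ≫ cellAt z' β = cellAt z β ≫ (k ▷ T) ▷ g := by
  unfold cellAt
  rw [associator_naturality_left_assoc, ← whisker_exchange_assoc, Category.assoc, Category.assoc,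
    associator_inv_naturality_left]

theorem cellAt_map₂ {g' : b ⟶ b'} {β : g ≫ T' ⟶ T ≫ g} {β' : g' ≫ T' ⟶ T ≫ g'} {θ : g ⟶ g'}
    (h : θ ▷ T' ≫ β' = β ≫ T ◁ θ) (z : W ⟶ b) :
    (z ◁ θ) ▷ T' ≫ cellAt z β' = cellAt z β ≫ (z ≫ T) ◁ θ := by
  unfold cellAt
  rw [associator_naturality_middle_assoc, ← Bicategory.whiskerLeft_comp_assoc, h]
  simp

theorem cellAt_unit {β : g ≫ T' ⟶ T ≫ g} {η : 𝟙 b ⟶ T} {η' : 𝟙 b' ⟶ T'}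
    (h : g ◁ η' ≫ β = (ρ_ _).hom ≫ (λ_ _).inv ≫ η ▷ g) (z : W ⟶ b) :
    ((ρ_ (z ≫ g)).inv ≫ (z ≫ g) ◁ η') ≫ cellAt z β = ((ρ_ z).inv ≫ z ◁ η) ▷ g := by
  unfold cellAt
  have h' := congrArg (z ◁ ·) h
  simp only [Bicategory.whiskerLeft_comp] at h'
  rw [Category.assoc, associator_naturality_right_assoc, reassoc_of% h']
  simp

theorem cellAt_mul {β : g ≫ T' ⟶ T ≫ g} {μ : T ≫ T ⟶ T} {μ' : T' ≫ T' ⟶ T'}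
    (h : β ▷ T' ≫ (α_ _ _ _).hom ≫ T ◁ β ≫ (α_ _ _ _).inv ≫ μ ▷ g =
      (α_ _ _ _).hom ≫ g ◁ μ' ≫ β) (z : W ⟶ b) :
    ((α_ (z ≫ g) T' T').hom ≫ (z ≫ g) ◁ μ') ≫ cellAt z β =
      cellAt z β ▷ T' ≫ cellAt (z ≫ T) β ≫ ((α_ z T T).hom ≫ z ◁ μ) ▷ g := by
  unfold cellAt
  have h' := congrArg (z ◁ ·) h
  simp only [Bicategory.whiskerLeft_comp] at h'
  calc
    _ = 𝟙 _ ⊗≫ (z ◁ (α_ g T' T').hom ≫ z ◁ g ◁ μ' ≫ z ◁ β) ⊗≫ 𝟙 _ := by bicategory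
    _ = _ := by rw [← h']; bicategory

theorem cellAt_comp {g' : b' ⟶ b''} {k : b ⟶ b''} {β : g ≫ T' ⟶ T ≫ g}
    {β' : g' ≫ T'' ⟶ T' ≫ g'} {γ : k ≫ T'' ⟶ T ≫ k} {δ : (g ≫ g') ≫ T'' ⟶ T ≫ g ≫ g'}
    {m : k ⟶ g ≫ g'} (h : m ▷ T'' ≫ δ = γ ≫ T ◁ m)
    (h' : δ = (α_ _ _ _).hom ≫ g ◁ β' ≫ (α_ _ _ _).inv ≫ β ▷ g' ≫ (α_ _ _ _).hom) (z : W ⟶ b) :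
    cellAt z γ ≫ (z ≫ T) ◁ m ≫ (α_ (z ≫ T) g g').inv =
      (z ◁ m ≫ (α_ z g g').inv) ▷ T'' ≫ cellAt (z ≫ g) β' ≫ cellAt z β ▷ g' := by
  rw [← reassoc_of% cellAt_map₂ h, h', comp_whiskerRight, Category.assoc]
  congr 1
  unfold cellAt
  bicategory

theorem cellAt_act {e e' : H} {r : e ⟶ b} {r' : e' ⟶ b'} {k : e ⟶ e'} {β : g ≫ T' ⟶ T ≫ g}
    {ν : k ≫ r' ≅ r ≫ g} {a : r ≫ T ⟶ r} {a' : r' ≫ T' ⟶ r'}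
    (h : r ◁ β ≫ (α_ _ _ _).inv ≫ a ▷ g =
      (α_ _ _ _).inv ≫ ν.inv ▷ T' ≫ (α_ _ _ _).hom ≫ k ◁ a' ≫ ν.hom) (q : W ⟶ e) :
    ((α_ q k r').hom ≫ q ◁ ν.hom ≫ (α_ q r g).inv) ▷ T' ≫ cellAt (q ≫ r) β ≫
        ((α_ q r T).hom ≫ q ◁ a) ▷ g =
      ((α_ (q ≫ k) r' T').hom ≫ (q ≫ k) ◁ a') ≫
        (α_ q k r').hom ≫ q ◁ ν.hom ≫ (α_ q r g).inv := by
  unfold cellAt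
  calc
    _ = 𝟙 _ ⊗≫ q ◁ ν.hom ▷ T' ⊗≫ q ◁ (r ◁ β ≫ (α_ _ _ _).inv ≫ a ▷ g) ⊗≫ 𝟙 _ := by bicategory
    _ = 𝟙 _ ⊗≫ q ◁ (ν.hom ≫ ν.inv) ▷ T' ⊗≫ q ◁ (k ◁ a' ≫ ν.hom) ⊗≫ 𝟙 _ := by
      rw [h]; bicategory
    _ = _ := by rw [Iso.hom_inv_id]; bicategory

end CellAt

/-! ### From monads in a bicategory to monads on hom-categories -/

section MonadOfMnd

variable {H : Type u} [Bicategory.{w, v} H] {b : H}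

/-- The monad on `H(W, b)` induced by a monad on `b`. -/
def Mnd.toMonad (T : Mnd b) (W : H) : CategoryTheory.Monad (W ⟶ b) where
  toFunctor := postcomp W T.T
  η := { app := fun z => (ρ_ z).inv ≫ z ◁ T.unit
         naturality := fun z z' k => by
          change k ≫ (ρ_ z').inv ≫ z' ◁ T.unit = ((ρ_ z).inv ≫ z ◁ T.unit) ≫ k ▷ T.T
          rw [Category.assoc, whisker_exchange]
          simp }
  μ := { app := fun z => (α_ z T.T T.T).hom ≫ z ◁ T.mul
         naturality := fun z z' k => by
          change k ▷ T.T ▷ T.T ≫ (α_ z' T.T T.T).hom ≫ z' ◁ T.mul =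
            ((α_ z T.T T.T).hom ≫ z ◁ T.mul) ≫ k ▷ T.T
          rw [Category.assoc, whisker_exchange]
          simp }
  assoc z := by
    change ((α_ z T.T T.T).hom ≫ z ◁ T.mul) ▷ T.T ≫ (α_ z T.T T.T).hom ≫ z ◁ T.mul =
      ((α_ (z ≫ T.T) T.T T.T).hom ≫ (z ≫ T.T) ◁ T.mul) ≫ (α_ z T.T T.T).hom ≫ z ◁ T.mul
    have h := congrArg (z ◁ ·) T.mul_assoc
    simp only [Bicategory.whiskerLeft_comp] at h
    rw [comp_whiskerRight, Category.assoc, associator_naturality_middle_assoc, h]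
    simp
  -- The sides are exchanged: the unit at `z ≫ T.T` inserts the new factor after `T.T`, so this law
  -- is `unit_right`.
  left_unit z := by
    change ((ρ_ (z ≫ T.T)).inv ≫ (z ≫ T.T) ◁ T.unit) ≫ (α_ z T.T T.T).hom ≫ z ◁ T.mul = 𝟙 _
    have h := congrArg (z ◁ ·) T.unit_right
    simp only [Bicategory.whiskerLeft_comp] at h
    rw [Category.assoc, associator_naturality_right_assoc, h]
    simp
  right_unit z := by
    change ((ρ_ z).inv ≫ z ◁ T.unit) ▷ T.T ≫ (α_ z T.T T.T).hom ≫ z ◁ T.mul = 𝟙 _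
    have h := congrArg (z ◁ ·) T.unit_left
    simp only [Bicategory.whiskerLeft_comp] at h
    rw [comp_whiskerRight, Category.assoc, associator_naturality_middle_assoc, h]
    simp

/-- Algebras of a monad in a bicategory as algebras of the induced monads. -/
def Mnd.toAlgebra (T : Mnd b) (W : H) : Alg T W ⥤ (T.toMonad W).Algebra where
  obj M :=
    { A := M.carrier
      a := M.act
      unit := by
        change ((ρ_ M.carrier).inv ≫ M.carrier ◁ T.unit) ≫ M.act = 𝟙 _
        rw [Category.assoc, M.act_unit, Iso.inv_hom_id]
      assoc := by
        change ((α_ M.carrier T.T T.T).hom ≫ M.carrier ◁ T.mul) ≫ M.act = M.act ▷ T.T ≫ M.act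
        rw [Category.assoc, M.act_mul, Iso.hom_inv_id_assoc] }
  map k := ⟨k.cell, k.comm.symm⟩

/-- An algebra from an action that satisfies the laws of an algebra of the induced monad. -/
def Alg.ofAct {T : Mnd b} {W : H} (z : W ⟶ b) (a : z ≫ T.T ⟶ z)
    (h₁ : ((ρ_ z).inv ≫ z ◁ T.unit) ≫ a = 𝟙 z)
    (h₂ : ((α_ z T.T T.T).hom ≫ z ◁ T.mul) ≫ a = a ▷ T.T ≫ a) : Alg T W where
  carrier := z
  act := a
  act_unit := by rwa [Category.assoc, Iso.inv_comp_eq, Category.comp_id] at h₁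
  act_mul := by rwa [Category.assoc, ← Iso.eq_inv_comp] at h₂

theorem Mnd.toAlgebra_isEquivalence (T : Mnd b) (W : H) : (T.toAlgebra W).IsEquivalence where
  faithful := ⟨fun e => Alg.Hom.ext (congrArg Monad.Algebra.Hom.f e)⟩
  full := ⟨fun k => ⟨⟨k.f, k.h.symm⟩, rfl⟩⟩
  essSurj := ⟨fun M => ⟨Alg.ofAct M.A M.a M.unit M.assoc, ⟨Iso.refl _⟩⟩⟩

end MonadOfMnd

/-! ### The pseudonatural monad induced by a Beck-Chevalley transformation -/

section Representables

variable {K : Type u₁} [Bicategory.{w₁, v₁} K] {H : Type u} [Bicategory.{w, v} H] {𝓐 𝓑 : K ⥤ᵖ H}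
  (α : 𝓐 ⟶ 𝓑) (l : ∀ x : K, 𝓑.obj x ⟶ 𝓐.obj x) (adj : ∀ x : K, l x ⊣ α.app x)

/-- The 2-cells between the monads of `α` at a 1-cell of the domain. -/
def transCell {x y : K} (f : x ⟶ y) :
    𝓑.map f ≫ l y ≫ α.app y ⟶ (l x ≫ α.app x) ≫ 𝓑.map f :=
  squareCell (adj x) (adj y) (α.naturality f)

theorem transCell_comp {x y z : K} (f : x ⟶ y) (g : y ⟶ z) :
    (𝓑.mapComp f g).hom ▷ (l z ≫ α.app z) ≫
        squareCell (adj x) (adj z) (squarePaste (α.naturality f) (α.naturality g)) =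
      transCell α l adj (f ≫ g) ≫ (l x ≫ α.app x) ◁ (𝓑.mapComp f g).hom := by
  refine squareCell_naturality (adj x) (adj z) (α.naturality (f ≫ g))
    (squarePaste (α.naturality f) (α.naturality g)) (𝓑.mapComp f g).hom (𝓐.mapComp f g).hom ?_
  rw [α.naturality_comp]
  simp [squarePaste]

variable (hl : ∀ {x y : K} (f : x ⟶ y),
  IsIso ((mateEquiv (adj x) (adj y)).symm (α.naturality f).inv)) (W : H)

/-- The pseudonatural monad on `H(W, 𝓑 -)` induced by `α`. -/
noncomputable def monadOnOfBeckChevalley : MonadOn (𝓑.comp (corepresentable W)) where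
  monad x := (adjMnd (adj x)).toMonad W
  cell {x y} f z := cellIsoAt (H := H) (b := 𝓑.obj x) (b' := 𝓑.obj y) z (transCell α l adj f)
    (squareCell_isIso (adj x) (adj y) (α.naturality f) (hl f))
  cell_naturality {x y} f {_ _} k :=
    cellAt_naturality (H := H) (b := 𝓑.obj x) (b' := 𝓑.obj y) (transCell α l adj f) k
  cell_map₂ {x y f f'} θ z := cellAt_map₂ (H := H) (b := 𝓑.obj x) (b' := 𝓑.obj y)
    (squareCell_naturality (adj x) (adj y) (α.naturality f) (α.naturality f') (𝓑.map₂ θ)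
      (𝓐.map₂ θ) (α.naturality_naturality θ)) z
  cell_unit {x y} f z := cellAt_unit (H := H) (b := 𝓑.obj x) (b' := 𝓑.obj y)
    (unit_squareCell (adj x) (adj y) (α.naturality f)) z
  cell_mul {x y} f z := cellAt_mul (H := H) (b := 𝓑.obj x) (b' := 𝓑.obj y)
    (squareCell_mul (adj x) (adj y) (α.naturality f)) z
  cell_comp {x y z} f g q :=
    cellAt_comp (H := H) (b := 𝓑.obj x) (b' := 𝓑.obj y) (b'' := 𝓑.obj z)
      (transCell_comp α l adj f g)
      (squareCell_paste (adj x) (adj y) (adj z) (α.naturality f) (α.naturality g)) q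

/-- The action on `H(W, α)` of the pseudonatural monad induced by `α`. -/
noncomputable def actionOfBeckChevalley :
    (monadOnOfBeckChevalley α l adj hl W).Action (whiskerRightTrans α (corepresentable W)) where
  act x q := ((adjAlg (adj x)).restrict q).act
  act_naturality x _ _ k := ((((adjAlg (adj x)).restrictFunctor W).map k).comm).symm
  act_unit x q := (((adjMnd (adj x)).toAlgebra W).obj ((adjAlg (adj x)).restrict q)).unit
  act_assoc x q := (((adjMnd (adj x)).toAlgebra W).obj ((adjAlg (adj x)).restrict q)).assoc
  act_cell {x y} f q := cellAt_act (H := H) (b := 𝓑.obj x) (b' := 𝓑.obj y)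
    (squareCell_rightAct (adj x) (adj y) (α.naturality f)) q

end Representables

/-- Composing with an equivalence preserves and reflects faithfulness, fullness and
equivalences. -/
theorem comp_equivalence_iff {C : Type u₁} [Category.{v₁} C] {D : Type u₂} [Category.{v₂} D]
    {E : Type u₃} [Category.{v₃} E] (F : C ⥤ D) (G : D ⥤ E) (hG : G.IsEquivalence) :
    (F.Faithful ↔ (F ⋙ G).Faithful) ∧ (F.Full ↔ (F ⋙ G).Full) ∧
      (F.IsEquivalence ↔ (F ⋙ G).IsEquivalence) :=
  ⟨⟨fun _ => inferInstance, fun _ => Functor.Faithful.of_comp F G⟩,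
    ⟨fun _ => inferInstance, fun _ => Functor.Full.of_comp_faithful F G⟩,
    ⟨fun _ => inferInstance, fun _ => Functor.isEquivalence_of_comp_right F G⟩⟩

/-! ### The generalized Bénabou-Roubaud theorem -/

section BenabouRoubaud

variable {J : Type u₁} [Bicategory.{w, v} J] {K : Type u₂} [Bicategory.{w, v} K]
  {H : Type u₃} [Bicategory.{w, v} H] {𝓐 𝓑 : K ⥤ᵖ H} (α : 𝓐 ⟶ 𝓑)

/-- The comparison functors of `α` at an object are faithful, fully faithful or equivalences if and
only if the descent functors of `𝓐` are, provided that the descent functors of `𝓑` are. -/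
theorem comparisonFunctor_iff_descentFunctor (l : ∀ x : K, 𝓑.obj x ⟶ 𝓐.obj x)
    (adj : ∀ x : K, l x ⊣ α.app x)
    (hl : ∀ {x y : K} (f : x ⟶ y),
      IsIso ((mateEquiv (adj x) (adj y)).symm (α.naturality f).inv)) (t : J ⥤ᵖ K)
    (hmon : ∀ x : J, Monadic (α.app (t.obj x))) (W : H) (c : K) :
    ((descentFunctor t (𝓑.comp (corepresentable W)) c).Faithful →
      ((comparisonFunctor (adj c) W).Faithful ↔
        (descentFunctor t (𝓐.comp (corepresentable W)) c).Faithful)) ∧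
    ((descentFunctor t (𝓑.comp (corepresentable W)) c).Full ∧
        (descentFunctor t (𝓑.comp (corepresentable W)) c).Faithful →
      ((comparisonFunctor (adj c) W).Full ∧ (comparisonFunctor (adj c) W).Faithful ↔
        (descentFunctor t (𝓐.comp (corepresentable W)) c).Full ∧
          (descentFunctor t (𝓐.comp (corepresentable W)) c).Faithful)) ∧
    ((descentFunctor t (𝓑.comp (corepresentable W)) c).IsEquivalence →
      ((comparisonFunctor (adj c) W).IsEquivalence ↔
        (descentFunctor t (𝓐.comp (corepresentable W)) c).IsEquivalence)) := by
  let A := actionOfBeckChevalley α l adj hl W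
  have hE (x : K) : ((adjMnd (adj x)).toAlgebra W).IsEquivalence :=
    (adjMnd (adj x)).toAlgebra_isEquivalence W
  -- `A.comparison x` is the bicategorical comparison functor followed by the passage to algebras of
  -- the induced ordinary monad, which is an equivalence.
  have h (x : K) : ((comparisonFunctor (adj x) W).Faithful ↔ (A.comparison x).Faithful) ∧
      ((comparisonFunctor (adj x) W).Full ↔ (A.comparison x).Full) ∧
      ((comparisonFunctor (adj x) W).IsEquivalence ↔ (A.comparison x).IsEquivalence) :=
    comp_equivalence_iff (comparisonFunctor (adj x) W) ((adjMnd (adj x)).toAlgebra W) (hE x)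
  rw [(h c).1, (h c).2.1, (h c).2.2]
  exact A.comparison_iff_descentFunctor t
    (fun x => (h _).2.2.1 ((hmon x).isEquivalence_comparisonFunctor (adj _) W)) c

end BenabouRoubaud

end PseudoDescent

theorem mainTheorem7
    {𝔞 : Type u₁} [Bicategory.{w, v} 𝔞] [Bicategory.Strict 𝔞]
    {𝔞' : Type u₂} [Bicategory.{w, v} 𝔞'] [Bicategory.Strict 𝔞']
    {H : Type u₃} [Bicategory.{w, v} H] [Bicategory.Strict H]
    (t : StrictPseudofunctor 𝔞 𝔞') (a : 𝔞') (ht : PseudoDescent.IsInclusion t a)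
    (𝓐 𝓑 : 𝔞' ⥤ᵖ H)
    (hA : PseudoDescent.HasPointwisePseudoRan t.toPseudofunctor (t.toPseudofunctor.comp 𝓐))
    (hB : PseudoDescent.HasPointwisePseudoRan t.toPseudofunctor (t.toPseudofunctor.comp 𝓑))
    (α : 𝓐 ⟶ 𝓑)
    (hEM : ∀ (l : 𝓑.obj a ⟶ 𝓐.obj a) (adj : l ⊣ α.app a),
      Nonempty (PseudoDescent.EMObject (PseudoDescent.adjMnd adj)))
    (hBC : PseudoDescent.BeckChevalley α)
    (hmon : ∀ x : 𝔞, PseudoDescent.Monadic (α.app (t.obj x))) :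
    (PseudoDescent.AlmostDescent t.toPseudofunctor a 𝓑 →
      (PseudoDescent.AlmostMonadic (α.app a) ↔
        PseudoDescent.AlmostDescent t.toPseudofunctor a 𝓐)) ∧
    (PseudoDescent.Descent t.toPseudofunctor a 𝓑 →
      (PseudoDescent.Premonadic (α.app a) ↔
        PseudoDescent.Descent t.toPseudofunctor a 𝓐)) ∧
    (PseudoDescent.EffectiveDescent t.toPseudofunctor 𝓑 →
      (PseudoDescent.Monadic (α.app a) ↔
        PseudoDescent.EffectiveDescent t.toPseudofunctor 𝓐)) := by
  obtain ⟨l, adj, hl⟩ := hBC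
  have hE := hEM (l a) (adj a)
  have ha (c : 𝔞') (hc : c ≠ a) : ∃ x, t.obj x = c := (ht.mem_range_iff c).2 hc
  -- Both sides of each bullet become conditions for every `W`, so the equivalence is proved one `W`
  -- at a time.
  have key (W : H) := PseudoDescent.comparisonFunctor_iff_descentFunctor α l adj hl
    t.toPseudofunctor hmon W a
  rw [PseudoDescent.almostMonadic_iff (adj a) hE, PseudoDescent.premonadic_iff (adj a) hE,
    PseudoDescent.monadic_iff (adj a) hE, PseudoDescent.almostDescent_iff hA,
    PseudoDescent.almostDescent_iff hB, PseudoDescent.descent_iff hA,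
    PseudoDescent.descent_iff hB,
    PseudoDescent.effectiveDescent_iff hA ht.locallyEquivalence a ha,
    PseudoDescent.effectiveDescent_iff hB ht.locallyEquivalence a ha]
  exact ⟨fun h => forall_congr' fun W => (key W).1 (h W),
    fun h => forall_congr' fun W => (key W).2.1 (h W),
    fun h => forall_congr' fun W => (key W).2.2 (h W)⟩
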